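/- Let $\Gamma$ be a countable group and let $(\Omega,\mu)$ be an ergodic standard Borel probability $\Gamma$-space, i.e. a standard Borel space with a measurable $\Gamma$-action and an invariant ergodic probability measure $\mu$. Let $X$ be a dendrite: a non-empty connected compact metrizable space in which any two distinct points are separated by a point. Let $\mathrm{CL}(X)$ be the set of non-empty closed subsets of $X$ with the Borel structure of the Vietoris topology, and $\mathrm{Homeo}(X)$ the homeomorphism group with the Borel structure of the compact-open topology. Let $\sigma:\Gamma\times\Omega\to\mathrm{Homeo}(X)$ be a virtual dendro-morphism, i.e. a Borel map with $\sigma(\gamma_1\gamma_2,s)=\sigma(\gamma_1,\gamma_2 s)\,\sigma(\gamma_2,s)$ for all $\gamma_1,\gamma_2\in\Gamma$ and almost every $s\in\Omega$. A Borel map $\kappa:\Omega\to\mathrm{CL}(X)$ is $\sigma$-equivariant if $\kappa(\gamma s)=\sigma(\gamma,s)\kappa(s)$ for every $\gamma\in\Gamma$ and almost every $s$. Assume that $\sigma$ is non-elementary, i.e. that there is no $\sigma$-equivariant Borel map from $\Omega$ to the set of subsets of $X$ with one or two points. Let $(B,\nu)$ be a $\Gamma$-boundary in the sense of Bader and Furman: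 a standard Borel space with a non-zero $\sigma$-finite measure whose class is preserved by a measurable $\Gamma$-action, which is amenable in the sense of Zimmer (every Borel field over $B$ of non-empty weak-$*$ compact convex subsets of the unit ball of the dual of a separable Banach space $E$, invariant under the dual of a measurable cocycle with values in the linear isometries of $E$, has a measurable equivariant section), and for which both projections $B\times B\to B$ are relatively metrically ergodic. Here a measurable map $q:Y\to Z$ is relatively metrically ergodic if, for every Borel equivariant map $p:U\to V$ of standard Borel $\Gamma$-spaces with a $\Gamma$-invariant Borel family of separable metrics on the fibers of $p$, and all measurable equivariant maps $f:Y\to U$, $g:Z\to V$ with $p\circ f=g\circ q$, there is a measurable equivariant $\psi:Z\to U$ with $\psi\circ q=f$ and $p\circ\psi=g$ (equivariance of $f,g,\psi$ and the equalities holding almost everywhere). A subdendrite of $X$ is a non-empty closed connected subset. Then there is an equivariant minimal family of subdendrites, i.e. a $\sigma$-equivariant Borel map $s\mapsto M_s\in\mathrm{CL}(X)$ with every $M_s$ a subdendrite such that $M_s\subseteq N_s$ for almost every $s$, for every $\sigma$-equivariant Borel family $\{N_s\}_{s\in\Omega}$ of subdendrites; it is unique up to null sets. Moreover: 1. There is a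 Furstenberg map for $\sigma$, i.e. a Borel map $\phi:B\times\Omega\to X$ such that $\phi(\gamma b,\gamma s)=\sigma(\gamma,s)\phi(b,s)$ for every $\gamma\in\Gamma$ and almost every $(b,s)\in B\times\Omega$, which has the following property: for the minimal family $\{M_s\}_{s\in\Omega}$, for almost every $s\in\Omega$, the slice $\phi_s=\phi(\cdot,s)$ takes values in $\mathrm{Ends}(M_s)$, the set of points $x\in M_s$ such that $M_s\setminus\{x\}$ has exactly one connected component. 2. The Furstenberg map is essentially unique: every Furstenberg map $\psi:B\times\Omega\to X$ for $\sigma$ satisfies $\psi(b,s)=\phi(b,s)$ for almost every $(b,s)\in B\times\Omega$. -/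

import Mathlib

open MeasureTheory TopologicalSpace

universe u

namespace Dendro

/-! ### Dendrites -/

/-- A dendrite: a continuum (non-empty connected compact metrizable space) in which any two
distinct points are separated by a point `z`, i.e. they lie in the two pieces of a partition of
the complement of `z` into two open sets. -/
structure IsDendrite (X : Type u) [TopologicalSpace X] : Prop where
  connected : ConnectedSpace X
  compact : CompactSpace X
  metrizable : MetrizableSpace X
  separated : ∀ x y : X, x ≠ y → ∃ z : X, ∃ U V : Set X,
    IsOpen U ∧ IsOpen V ∧ Disjoint U V ∧ U ∪ V = {z}ᶜ ∧ x ∈ U ∧ y ∈ V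

/-- The end points of a subset `M` (in practice a subdendrite): the points `x` of `M` of order `1`,
that is, such that `M \ {x}` has exactly one connected component. -/
def ends {X : Type u} [TopologicalSpace X] (M : Set X) : Set X :=
  {x | x ∈ M ∧ Nat.card (ConnectedComponents ↥(M \ {x})) = 1}

/-- The Borel structure of the Vietoris topology on `CL(X)`, the space of non-empty closed subsets
of a compact space `X`. -/
abbrev borelCL (X : Type u) [TopologicalSpace X] : MeasurableSpace (NonemptyCompacts X) :=
  borel (NonemptyCompacts X)

/-- The Borel structure of the compact-open topology on the homeomorphism group of `X`. -/
abbrev borelHomeo (X : Type u) [TopologicalSpace X] : MeasurableSpace (X ≃ₜ X) :=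
  @borel (X ≃ₜ X) (TopologicalSpace.induced (fun h : X ≃ₜ X => (h : C(X, X))) inferInstance)

/-! ### Virtual dendro-morphisms -/

section Cocycles

variable {Γ Ω X : Type u} [Group Γ] [MeasurableSpace Ω] [MulAction Γ Ω] [TopologicalSpace X]

/-- Virtual dendro-morphisms, i.e. measurable cocycles `σ : Γ × Ω → Homeo(X)`; the group `Γ` is
countable and discrete, so that measurability is measurability of each `σ γ`. -/
structure IsVirtualDendroMorphism (μ : Measure Ω) (σ : Γ → Ω → (X ≃ₜ X)) : Prop where
  measurable : ∀ γ : Γ, @Measurable Ω (X ≃ₜ X) _ (borelHomeo X) (σ γ)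
  cocycle : ∀ γ₁ γ₂ : Γ, ∀ᵐ s ∂μ, σ (γ₁ * γ₂) s = σ γ₁ (γ₂ • s) * σ γ₂ s

/-- `σ`-equivariant Borel maps from `Ω` to the non-empty closed subsets of `X`. -/
structure IsEquivariantFamily (μ : Measure Ω) (σ : Γ → Ω → (X ≃ₜ X))
    (κ : Ω → NonemptyCompacts X) : Prop where
  measurable : @Measurable Ω (NonemptyCompacts X) _ (borelCL X) κ
  equivariant : ∀ γ : Γ, ∀ᵐ s ∂μ, (κ (γ • s) : Set X) = σ γ s '' (κ s : Set X)

/-- `σ` is elementary if there is a `σ`-equivariant Borel map to the set of subsets of `X` with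
one or two points. -/
def IsElementary (μ : Measure Ω) (σ : Γ → Ω → (X ≃ₜ X)) : Prop :=
  ∃ κ : Ω → NonemptyCompacts X, IsEquivariantFamily μ σ κ ∧
    ∀ s, ∃ x y : X, (κ s : Set X) = {x, y}

/-- Equivariant families of subdendrites (the subdendrites of a dendrite are its non-empty closed
connected subsets). -/
structure IsSubdendriteFamily (μ : Measure Ω) (σ : Γ → Ω → (X ≃ₜ X))
    (M : Ω → NonemptyCompacts X) : Prop extends IsEquivariantFamily μ σ M where
  connected : ∀ s, IsConnected (M s : Set X)

/-- Minimal equivariant families of subdendrites: those which are almost everywhere contained in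
every equivariant family of subdendrites. -/
structure IsMinimalFamily (μ : Measure Ω) (σ : Γ → Ω → (X ≃ₜ X))
    (M : Ω → NonemptyCompacts X) : Prop extends IsSubdendriteFamily μ σ M where
  minimal : ∀ N : Ω → NonemptyCompacts X, IsSubdendriteFamily μ σ N →
    ∀ᵐ s ∂μ, (M s : Set X) ⊆ N s

end Cocycles

/-! ### Boundaries -/

/-- A metric along `p : U → V`: a function `d` which is Borel on the fibered product of `U` with
itself over `p` and restricts to a separable metric on each fiber of `p`. Only the values of `d` at
pairs of points of the same fiber matter. -/
structure IsMetricAlong {U V : Type u} [MeasurableSpace U] (p : U → V) (d : U → U → ℝ) :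
    Prop where
  measurable : Measurable (fun w : {w : U × U // p w.1 = p w.2} => d w.1.1 w.1.2)
  nonneg : ∀ x y, p x = p y → 0 ≤ d x y
  eq_zero_iff : ∀ x y, p x = p y → (d x y = 0 ↔ x = y)
  symm : ∀ x y, p x = p y → d x y = d y x
  triangle : ∀ x y z, p x = p y → p y = p z → d x z ≤ d x y + d y z
  separable : ∀ v : V, ∃ S : Set U, S.Countable ∧ S ⊆ p ⁻¹' {v} ∧
    ∀ x ∈ p ⁻¹' {v}, ∀ ε > 0, ∃ y ∈ S, d x y < ε

section Boundaries

variable (Γ : Type u) [Group Γ]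

/-- A fiberwise isometric action of `Γ` along `p : U → V`, with respect to a metric `d` along
`p`. -/
structure IsFiberwiseIsometric {U V : Type u} [MeasurableSpace U] [MeasurableSpace V]
    [MulAction Γ U] [MulAction Γ V] (p : U → V) (d : U → U → ℝ) : Prop
    extends IsMetricAlong p d where
  measurable_proj : Measurable p
  equivariant_proj : ∀ (γ : Γ) (x : U), p (γ • x) = γ • p x
  isometric : ∀ (γ : Γ) (x y : U), p x = p y → d (γ • x) (γ • y) = d x y

/-- Relative metric ergodicity of a map `q` between the spaces `(Y, η)` and `(Z, ζ)`. As usual for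
spaces equipped with a measure class, equivariance and commutativity of the diagrams are
understood almost everywhere. -/
def IsRelativelyMetricallyErgodic {Y Z : Type u} [MeasurableSpace Y] [MeasurableSpace Z]
    [MulAction Γ Y] [MulAction Γ Z] (η : Measure Y) (ζ : Measure Z) (q : Y → Z) : Prop :=
  ∀ (U V : Type u) [MeasurableSpace U] [StandardBorelSpace U] [MeasurableSpace V]
    [StandardBorelSpace V] [MulAction Γ U] [MeasurableConstSMul Γ U] [MulAction Γ V]
    [MeasurableConstSMul Γ V] (p : U → V) (d : U → U → ℝ) (f : Y → U) (g : Z → V),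
    IsFiberwiseIsometric Γ p d →
    Measurable f → (∀ γ : Γ, ∀ᵐ y ∂η, f (γ • y) = γ • f y) →
    Measurable g → (∀ γ : Γ, ∀ᵐ z ∂ζ, g (γ • z) = γ • g z) →
    (∀ᵐ y ∂η, p (f y) = g (q y)) →
    ∃ ψ : Z → U, Measurable ψ ∧ (∀ γ : Γ, ∀ᵐ z ∂ζ, ψ (γ • z) = γ • ψ z) ∧
      (∀ᵐ y ∂η, ψ (q y) = f y) ∧ (∀ᵐ z ∂ζ, p (ψ z) = g z)

/-- Amenability (in the sense of Zimmer) of the action of `Γ` on `(B, ν)`. For every separable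
Banach space `E`, every measurable cocycle `α` with values in the linear isometries of `E` (with
the Borel structure of the strong operator topology) and every Borel field `A` of non-empty
weak-* compact convex subsets of the unit ball of the dual `E*`, invariant under the dual cocycle
`α* γ b f = f ∘ (α γ b)⁻¹`, there is a measurable equivariant section of `A`.
Note that `g = α* γ b f` means that `g (α γ b e) = f e` for all `e`. -/
def IsZimmerAmenable {B : Type u} [MeasurableSpace B] [MulAction Γ B] (ν : Measure B) : Prop :=
  ∀ (E : Type u) [NormedAddCommGroup E] [NormedSpace ℝ E] [CompleteSpace E] [SeparableSpace E]
    (α : Γ → B → (E ≃ₗᵢ[ℝ] E)) (A : B → Set (WeakDual ℝ E)),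
    (∀ (γ : Γ) (e : E), @Measurable B E _ (borel E) (fun b => α γ b e)) →
    (∀ γ₁ γ₂ : Γ, ∀ᵐ b ∂ν, α (γ₁ * γ₂) b = α γ₁ (γ₂ • b) * α γ₂ b) →
    (∀ b, (A b).Nonempty ∧ IsCompact (A b) ∧ Convex ℝ (A b) ∧ ∀ f ∈ A b, ∀ e : E, |f e| ≤ ‖e‖) →
    @MeasurableSet (B × WeakDual ℝ E) (@Prod.instMeasurableSpace _ _ _ (borel (WeakDual ℝ E)))
      {w | w.2 ∈ A w.1} →
    (∀ γ : Γ, ∀ᵐ b ∂ν, ∀ f g : WeakDual ℝ E, (∀ e, g (α γ b e) = f e) →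
      (f ∈ A b ↔ g ∈ A (γ • b))) →
    ∃ ξ : B → WeakDual ℝ E, @Measurable B (WeakDual ℝ E) _ (borel (WeakDual ℝ E)) ξ ∧
      (∀ᵐ b ∂ν, ξ b ∈ A b) ∧
      ∀ γ : Γ, ∀ᵐ b ∂ν, ∀ e, ξ (γ • b) (α γ b e) = ξ b e

/-- `Γ`-boundaries: amenable Lebesgue `Γ`-spaces (the action preserves the class of `ν`) for which
both projections `B × B → B` are relatively metrically ergodic; `Γ` acts diagonally on `B × B`. -/
structure IsBoundary {B : Type u} [MeasurableSpace B] [MulAction Γ B] (ν : Measure B) :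
    Prop where
  quasiInvariant : ∀ γ : Γ, Measure.QuasiMeasurePreserving (fun b : B => γ • b) ν ν
  amenable : IsZimmerAmenable Γ ν
  ergodic_fst : IsRelativelyMetricallyErgodic Γ (ν.prod ν) ν (Prod.fst : B × B → B)
  ergodic_snd : IsRelativelyMetricallyErgodic Γ (ν.prod ν) ν (Prod.snd : B × B → B)

end Boundaries

/-- Furstenberg maps for `σ`: Borel maps `φ : B × Ω → X` which are `σ`-equivariant. -/
structure IsFurstenbergMap {Γ Ω B X : Type u} [Group Γ] [MeasurableSpace Ω] [MulAction Γ Ω]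
    [MeasurableSpace B] [MulAction Γ B] [TopologicalSpace X] [MeasurableSpace X]
    (ν : Measure B) (μ : Measure Ω) (σ : Γ → Ω → (X ≃ₜ X)) (φ : B × Ω → X) : Prop where
  measurable : Measurable φ
  equivariant : ∀ γ : Γ, ∀ᵐ w ∂(ν.prod μ), φ (γ • w.1, γ • w.2) = σ γ w.2 (φ w)

end Dendro

set_option linter.unusedSectionVars false

/-! In a dendrite the closed connected sets behave like subtrees of a tree: their intersections are
connected, a pairwise meeting family of them has a common point (Helly), and a non-empty
subcontinuum `L` disjoint from a non-empty `K` is seen from `K` through a single point, its gate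
(`exists_gate`). All this follows from separation by cut points. The canonical sets of the proof are
cores, that is, intersections of all subcontinua with a given monotone property. A core is
determined by countably many subcontinua, which makes it measurable (`measurable_of_eq_core`), and
it moves with its defining property under homeomorphisms (`image_core`).

The minimal family: if two equivariant families of subdendrites were disjoint, the gate of one in
the other would be an equivariant point, so non-elementarity forces them to meet. By Helly,
countably many families then have an equivariant intersection (`exists_countable_inter_family`), and
an exhaustion argument produces a smallest family `M`.

Relative metric ergodicity enters through two facts: `B × B × Ω` is ergodic (`ergodic_prod`), and
the component of the complement of `K (b, s)` that contains `L (b', s)` does not depend on `b'`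
(`ae_sameSide`). Both come from replacing a field over `Ω` by the measure carried by its graph. Such
measures form a `Γ`-space on which total variation is an invariant metric, and this metric is
separable along projections with countable fibers.

For an equivariant family `K` of subcontinua over `B × Ω` there are two cases. If almost all pairs
`K (b, s)`, `K (b', s)` meet, then `M s ⊆ K (b, s)` (`subset_of_ae_inter`). If they are disjoint,
then `M s` lies in the closure of one component of the complement of `K (b, s)`, and this closure
meets `K (b, s)` at most in the gate (`exists_gate_closure`). Taking for `K` the points `φ` shows
that Furstenberg maps take values in the ends; taking the arcs from `φ` to `ψ` gives uniqueness.

Existence: amenability, applied to the states on `L¹(Ω, C(X))`, yields an equivariant field of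
probability measures on `X`. Let `J` be the core of the sets of mass greater than `1/2`. Every
non-empty subcontinuum of `J` is an arc or a point, so if the sets `J` met one another, `M` would
consist of arcs and `σ` would be elementary. Hence they are disjoint, and the gate of `J (b, s)`
towards the others is a Furstenberg map. -/

namespace Dendro

/-! ### Subcontinua of dendrites -/

section Topology

open Set

/-- Any two distinct points are separated by a point. -/
class PointSeparated (X : Type u) [TopologicalSpace X] : Prop where
  separated : ∀ x y : X, x ≠ y → ∃ z : X, ∃ U V : Set X,
    IsOpen U ∧ IsOpen V ∧ Disjoint U V ∧ U ∪ V = {z}ᶜ ∧ x ∈ U ∧ y ∈ V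

/-- Closed preconnected sets. -/
structure IsSubcontinuum {X : Type u} [TopologicalSpace X] (D : Set X) : Prop where
  isClosed : IsClosed D
  isPreconnected : IsPreconnected D

variable {X : Type u} [TopologicalSpace X]

/-- A separation of the part of `A` on the side of `U` extends to a separation of `A`: `V` is thrown
into the open piece containing `z`, and the other piece is intersected with `U`. -/
theorem isPreconnected_inter_cut {A U V : Set X} {z : X} (hA : IsPreconnected A) (hz : z ∈ A)
    (hU : IsOpen U) (hV : IsOpen V) (hd : Disjoint U V) (huv : U ∪ V = {z}ᶜ) :
    IsPreconnected (A ∩ insert z U) := by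
  have hzU : z ∉ U := fun h => by
    have : z ∈ ({z} : Set X)ᶜ := huv ▸ Or.inl h
    exact this rfl
  have key : ∀ O₁ O₂ : Set X, IsOpen O₁ → IsOpen O₂ → A ∩ insert z U ⊆ O₁ ∪ O₂ →
      (A ∩ insert z U ∩ O₂).Nonempty → z ∈ O₁ → (A ∩ insert z U ∩ (O₁ ∩ O₂)).Nonempty := by
    intro O₁ O₂ h₁ h₂ hc hne hz₁
    obtain ⟨t, ⟨htA, htU⟩, ht₂⟩ := hne
    rcases htU with rfl | htU
    · exact ⟨t, ⟨htA, Or.inl rfl⟩, hz₁, ht₂⟩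
    obtain ⟨x, hxA, hx₁, hx₂, hxU⟩ := hA (O₁ ∪ V) (O₂ ∩ U) (h₁.union hV) (h₂.inter hU)
      (fun x hx => by
        by_cases hxz : x = z
        · exact Or.inl (Or.inl (hxz ▸ hz₁))
        have : x ∈ U ∪ V := huv ▸ hxz
        rcases this with h | h
        · rcases hc ⟨hx, Or.inr h⟩ with h' | h'
          · exact Or.inl (Or.inl h')
          · exact Or.inr ⟨h', h⟩
        · exact Or.inl (Or.inr h)) ⟨z, hz, Or.inl hz₁⟩ ⟨t, htA, ht₂, htU⟩
    rcases hx₁ with hx₁ | hx₁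
    · exact ⟨x, ⟨hxA, Or.inr hxU⟩, hx₁, hx₂⟩
    · exact absurd hx₁ (Set.disjoint_left.1 hd hxU)
  intro O₁ O₂ h₁ h₂ hc hne₁ hne₂
  rcases hc ⟨hz, Or.inl rfl⟩ with h | h
  · exact key O₁ O₂ h₁ h₂ hc hne₂ h
  · rw [inter_comm O₁]
    exact key O₂ O₁ h₂ h₁ (by rwa [union_comm]) hne₁ h

theorem isClosed_insert_cut {U V : Set X} {z : X} (hV : IsOpen V) (hd : Disjoint U V)
    (huv : U ∪ V = {z}ᶜ) : IsClosed (insert z U) := by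
  have : insert z U = Vᶜ := by
    ext x
    have h1 : x ∈ U ∪ V ↔ x ≠ z := by rw [huv]; rfl
    have h2 : x ∈ U → x ∉ V := fun h => Set.disjoint_left.1 hd h
    simp only [mem_union] at h1
    simp only [mem_insert_iff, mem_compl_iff]
    tauto
  rw [this]; exact hV.isClosed_compl

theorem isSubcontinuum_insert_cut [PreconnectedSpace X] {U V : Set X} {z : X} (hU : IsOpen U)
    (hV : IsOpen V) (hd : Disjoint U V) (huv : U ∪ V = {z}ᶜ) : IsSubcontinuum (insert z U) := by
  refine ⟨isClosed_insert_cut hV hd huv, ?_⟩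
  simpa using isPreconnected_inter_cut (A := univ) isPreconnected_univ (mem_univ z) hU hV hd huv

theorem mem_of_cut {A U V : Set X} {z x y : X} (hA : IsPreconnected A)
    (hU : IsOpen U) (hV : IsOpen V) (hd : Disjoint U V) (huv : U ∪ V = {z}ᶜ) (hx : x ∈ A)
    (hy : y ∈ A) (hxU : x ∈ U) (hyV : y ∈ V) : z ∈ A := by
  by_contra hz
  obtain ⟨w, -, hw⟩ := hA U V hU hV (fun a ha => by
    rw [huv]; rintro rfl; exact hz ha) ⟨x, hx, hxU⟩ ⟨y, hy, hyV⟩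
  exact Set.disjoint_left.1 hd hw.1 hw.2

theorem isPreconnected_sInter_of_directedOn [T2Space X] [CompactSpace X] {S : Set (Set X)}
    (hne : S.Nonempty) (hdir : DirectedOn (· ⊇ ·) S) (hS : ∀ D ∈ S, IsSubcontinuum D) :
    IsPreconnected (⋂₀ S) := by
  have hcl : IsClosed (⋂₀ S) := isClosed_sInter fun D hD => (hS D hD).isClosed
  rw [isPreconnected_closed_iff]
  intro F₁ F₂ h₁ h₂ hc hne₁ hne₂
  by_contra hemp
  have hdisj : Disjoint (⋂₀ S ∩ F₁) (⋂₀ S ∩ F₂) := by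
    rw [Set.disjoint_left]
    exact fun x hx hx' => hemp ⟨x, hx.1, hx.2, hx'.2⟩
  obtain ⟨O₁, O₂, ho₁, ho₂, hs₁, hs₂, hO⟩ :=
    normal_separation (hcl.inter h₁) (hcl.inter h₂) hdisj
  have : Nonempty S := hne.to_subtype
  obtain ⟨⟨D, hD⟩, hDO⟩ := exists_subset_nhds_of_isCompact' (V := fun D : S => (D : Set X))
    (U := O₁ ∪ O₂)
    (directedOn_iff_directed.1 hdir)
    (fun D => (hS D D.2).isClosed.isCompact) (fun D => (hS D D.2).isClosed)
    (fun x hx => (ho₁.union ho₂).mem_nhds (by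
      rw [← sInter_eq_iInter] at hx
      rcases hc hx with h | h
      · exact Or.inl (hs₁ ⟨hx, h⟩)
      · exact Or.inr (hs₂ ⟨hx, h⟩)))
  have hsub : ⋂₀ S ⊆ D := sInter_subset_of_mem hD
  obtain ⟨x, hx, hx₁⟩ := hne₁
  obtain ⟨y, hy, hy₂⟩ := hne₂
  obtain ⟨w, -, hw⟩ := (hS D hD).isPreconnected O₁ O₂ ho₁ ho₂ hDO
    ⟨x, hsub hx, hs₁ ⟨hx, hx₁⟩⟩ ⟨y, hsub hy, hs₂ ⟨hy, hy₂⟩⟩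
  exact Set.disjoint_left.1 hO hw.1 hw.2

theorem IsSubcontinuum.union {A B : Set X} (hA : IsSubcontinuum A) (hB : IsSubcontinuum B)
    (h : (A ∩ B).Nonempty) : IsSubcontinuum (A ∪ B) :=
  ⟨hA.isClosed.union hB.isClosed, hA.isPreconnected.union' h hB.isPreconnected⟩

theorem IsSubcontinuum.univ [PreconnectedSpace X] : IsSubcontinuum (univ : Set X) :=
  ⟨isClosed_univ, isPreconnected_univ⟩

theorem isSubcontinuum_singleton [T1Space X] (x : X) : IsSubcontinuum ({x} : Set X) :=
  ⟨isClosed_singleton, isPreconnected_singleton⟩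

/-- Such a minimal continuum plays the role of an arc from `P` to `Q`. Compactness keeps the
intersections with `P` and `Q` non-empty along chains. -/
theorem exists_minimal_subcontinuum [T2Space X] [CompactSpace X] {A P Q : Set X}
    (hA : IsSubcontinuum A) (hP : IsClosed P)
    (hQ : IsClosed Q) (hAP : (A ∩ P).Nonempty) (hAQ : (A ∩ Q).Nonempty) :
    ∃ D, D ⊆ A ∧ Minimal (fun D => IsSubcontinuum D ∧ (D ∩ P).Nonempty ∧ (D ∩ Q).Nonempty) D := by
  refine zorn_superset_nonempty
    {D | IsSubcontinuum D ∧ (D ∩ P).Nonempty ∧ (D ∩ Q).Nonempty} ?_ A ⟨hA, hAP, hAQ⟩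
  intro c hc hchain hcne
  have : Nonempty c := hcne.to_subtype
  have hdir : DirectedOn (· ⊇ ·) c := by
    intro D hD E hE
    rcases hchain.total hD hE with h | h
    · exact ⟨D, hD, subset_rfl, h⟩
    · exact ⟨E, hE, h, subset_rfl⟩
  have hmeet : ∀ R : Set X, IsClosed R → (∀ D ∈ c, (D ∩ R).Nonempty) → (⋂₀ c ∩ R).Nonempty := by
    intro R hR h
    have := IsCompact.nonempty_iInter_of_directed_nonempty_isCompact_isClosed
      (fun D : c => (D : Set X) ∩ R)
      (fun D E => by
        obtain ⟨F, hF, hFD, hFE⟩ := hdir D D.2 E E.2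
        exact ⟨⟨F, hF⟩, inter_subset_inter_left _ hFD, inter_subset_inter_left _ hFE⟩)
      (fun D => h D D.2) (fun D => ((hc D.2).1.isClosed.inter hR).isCompact)
      (fun D => (hc D.2).1.isClosed.inter hR)
    rwa [← iInter_inter, ← sInter_eq_iInter] at this
  refine ⟨⋂₀ c, ⟨⟨isClosed_sInter fun D hD => (hc hD).1.isClosed,
    isPreconnected_sInter_of_directedOn hcne hdir fun D hD => (hc hD).1⟩,
    hmeet P hP fun D hD => (hc hD).2.1, hmeet Q hQ fun D hD => (hc hD).2.2⟩,
    fun D hD => sInter_subset_of_mem hD⟩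

variable [T2Space X] [CompactSpace X] [PointSeparated X]

/-- Hereditary unicoherence. If `A ∩ B` fell into two closed pieces, let `D ⊆ A` be a minimal
continuum joining them, with points `p` and `q` in the two pieces. A point `z` separating `p` from
`q` lies in `D` and in `B`, hence in one of the pieces, and cutting `D` at `z` leaves a smaller
continuum that still joins them. -/
theorem IsSubcontinuum.inter {A B : Set X} (hA : IsSubcontinuum A) (hB : IsSubcontinuum B) :
    IsSubcontinuum (A ∩ B) := by
  refine ⟨hA.isClosed.inter hB.isClosed, ?_⟩
  rw [isPreconnected_closed_iff]
  intro F₁ F₂ h₁ h₂ hc hne₁ hne₂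
  by_contra hemp
  obtain ⟨D, hDA, hD⟩ := exists_minimal_subcontinuum (P := B ∩ F₁) (Q := B ∩ F₂) hA
    (hB.isClosed.inter h₁) (hB.isClosed.inter h₂)
    (by rwa [← inter_assoc]) (by rwa [← inter_assoc])
  obtain ⟨⟨hDc, ⟨p, hpD, hpB, hp⟩, ⟨q, hqD, hqB, hq⟩⟩, hmin⟩ := hD
  have hpq : p ≠ q := by
    rintro rfl
    exact hemp ⟨p, ⟨hDA hpD, hpB⟩, hp, hq⟩
  obtain ⟨z, U, V, hU, hV, hd, huv, hpU, hqV⟩ := PointSeparated.separated p q hpq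
  have hzD := mem_of_cut hDc.isPreconnected hU hV hd huv hpD hqD hpU hqV
  have hzB := mem_of_cut hB.isPreconnected hU hV hd huv hpB hqB hpU hqV
  have hd' := hd.symm
  have huv' : V ∪ U = {z}ᶜ := by rwa [union_comm]
  rcases hc ⟨hDA hzD, hzB⟩ with hz | hz
  · have := hmin (y := D ∩ insert z V) ⟨⟨hDc.isClosed.inter (isClosed_insert_cut hU hd' huv'),
      isPreconnected_inter_cut hDc.isPreconnected hzD hV hU hd' huv'⟩,
      ⟨z, ⟨hzD, Or.inl rfl⟩, hzB, hz⟩, ⟨q, ⟨hqD, Or.inr hqV⟩, hqB, hq⟩⟩ inter_subset_left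
    rcases (this hpD).2 with h | h
    · have : p ∈ ({z} : Set X)ᶜ := huv ▸ Or.inl hpU
      exact this h
    · exact Set.disjoint_left.1 hd hpU h
  · have := hmin (y := D ∩ insert z U) ⟨⟨hDc.isClosed.inter (isClosed_insert_cut hV hd huv),
      isPreconnected_inter_cut hDc.isPreconnected hzD hU hV hd huv⟩,
      ⟨p, ⟨hpD, Or.inr hpU⟩, hpB, hp⟩, ⟨z, ⟨hzD, Or.inl rfl⟩, hzB, hz⟩⟩ inter_subset_left
    rcases (this hqD).2 with h | h
    · have : q ∈ ({z} : Set X)ᶜ := huv ▸ Or.inr hqV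
      exact this h
    · exact Set.disjoint_left.1 hd h hqV

/-- The set `A ∩ (B ∪ C)` is connected and covered by the closed sets `B` and `C`, each of which it
meets, so it meets `B ∩ C`. -/
theorem IsSubcontinuum.helly {A B C : Set X} (hA : IsSubcontinuum A) (hB : IsSubcontinuum B)
    (hC : IsSubcontinuum C) (hAB : (A ∩ B).Nonempty) (hAC : (A ∩ C).Nonempty)
    (hBC : (B ∩ C).Nonempty) : (A ∩ B ∩ C).Nonempty := by
  have h := (hA.inter (hB.union hC hBC)).isPreconnected
  rw [isPreconnected_closed_iff] at h
  obtain ⟨x, hx⟩ := h B C hB.isClosed hC.isClosed inter_subset_right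
    (hAB.mono fun x hx => ⟨⟨hx.1, Or.inl hx.2⟩, hx.2⟩)
    (hAC.mono fun x hx => ⟨⟨hx.1, Or.inr hx.2⟩, hx.2⟩)
  exact ⟨x, ⟨hx.1.1, hx.2.1⟩, hx.2.2⟩

theorem isSubcontinuum_sInter_finite [PreconnectedSpace X] {S : Set (Set X)} (hf : S.Finite)
    (hS : ∀ D ∈ S, IsSubcontinuum D) : IsSubcontinuum (⋂₀ S) := by
  induction S, hf using Set.Finite.induction_on with
  | empty => simpa using IsSubcontinuum.univ
  | @insert D S _ _ ih =>
    rw [sInter_insert]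
    exact (hS D (mem_insert _ _)).inter (ih fun E hE => hS E (mem_insert_of_mem _ hE))

theorem isSubcontinuum_sInter [PreconnectedSpace X] {S : Set (Set X)}
    (hS : ∀ D ∈ S, IsSubcontinuum D) : IsSubcontinuum (⋂₀ S) := by
  let T : Set (Set X) := {E | ∃ R ⊆ S, R.Finite ∧ E = ⋂₀ R}
  have hST : ⋂₀ S = ⋂₀ T := by
    apply Subset.antisymm
    · rintro x hx _ ⟨R, hR, -, rfl⟩
      exact fun D hD => hx D (hR hD)
    · exact fun x hx D hD => hx D ⟨{D}, by simpa, finite_singleton _, by simp⟩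
  have hT : ∀ E ∈ T, IsSubcontinuum E := by
    rintro _ ⟨R, hR, hf, rfl⟩
    exact isSubcontinuum_sInter_finite hf fun D hD => hS D (hR hD)
  refine ⟨isClosed_sInter fun D hD => (hS D hD).isClosed, ?_⟩
  rw [hST]
  refine isPreconnected_sInter_of_directedOn ⟨univ, ∅, empty_subset _, finite_empty, by simp⟩ ?_ hT
  rintro _ ⟨R, hR, hf, rfl⟩ _ ⟨R', hR', hf', rfl⟩
  exact ⟨⋂₀ (R ∪ R'), ⟨R ∪ R', union_subset hR hR', hf.union hf', rfl⟩,
    sInter_subset_sInter subset_union_left, sInter_subset_sInter subset_union_right⟩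

theorem helly_finite [PreconnectedSpace X] {S : Set (Set X)} (hf : S.Finite) :
    ∀ A : Set X, IsSubcontinuum A → A.Nonempty → (∀ D ∈ S, IsSubcontinuum D) →
    (∀ D ∈ S, (A ∩ D).Nonempty) → (∀ D ∈ S, ∀ E ∈ S, (D ∩ E).Nonempty) → (A ∩ ⋂₀ S).Nonempty := by
  induction S, hf using Set.Finite.induction_on with
  | empty => intro A _ hA _ _ _; simpa
  | @insert D S _ _ ih =>
    intro A hA _ hS hAS hSS
    rw [sInter_insert, ← inter_assoc]
    have hD := hS D (mem_insert _ _)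
    refine ih (A ∩ D) (hA.inter hD) (hAS D (mem_insert _ _))
      (fun E hE => hS E (mem_insert_of_mem _ hE)) (fun E hE => ?_)
      (fun E hE F hF => hSS E (mem_insert_of_mem _ hE) F (mem_insert_of_mem _ hF))
    exact hA.helly hD (hS E (mem_insert_of_mem _ hE)) (hAS D (mem_insert _ _))
      (hAS E (mem_insert_of_mem _ hE)) (hSS D (mem_insert _ _) E (mem_insert_of_mem _ hE))

theorem helly_sInter [ConnectedSpace X] {S : Set (Set X)} (hS : ∀ D ∈ S, IsSubcontinuum D)
    (hSS : ∀ D ∈ S, ∀ E ∈ S, (D ∩ E).Nonempty) : (⋂₀ S).Nonempty := by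
  rw [sInter_eq_iInter]
  have := (isCompact_univ (X := X)).inter_iInter_nonempty (fun D : S => (D : Set X))
    (fun D => (hS D D.2).isClosed) (fun u => by
      have h := helly_finite (X := X) (S := (fun D : S => (D : Set X)) '' (u : Set S))
        (u.finite_toSet.image _) univ IsSubcontinuum.univ univ_nonempty
        (by rintro _ ⟨D, -, rfl⟩; exact hS D D.2)
        (by rintro _ ⟨D, -, rfl⟩; simpa using hSS D D.2 D D.2)
        (by rintro _ ⟨D, -, rfl⟩ _ ⟨E, -, rfl⟩; exact hSS D D.2 E E.2)
      simpa [sInter_image] using h)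
  simpa using this

/-- Each point outside `O` is cut off from `x` by a closed half `insert z U`. By compactness
finitely many halves suffice, and their intersection is connected. -/
theorem exists_subcontinuum_nhds [ConnectedSpace X] {x : X} {O : Set X} (hO : IsOpen O)
    (hx : x ∈ O) : ∃ D, IsSubcontinuum D ∧ x ∈ interior D ∧ D ⊆ O := by
  have hsep : ∀ y : X, y ∈ Oᶜ → ∃ E : Set X, ∃ V : Set X, IsSubcontinuum E ∧ x ∈ interior E ∧
      IsOpen V ∧ y ∈ V ∧ Disjoint E V := by
    intro y hy
    have hxy : x ≠ y := by rintro rfl; exact hy hx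
    obtain ⟨z, U, V, hU, hV, hd, huv, hxU, hyV⟩ := PointSeparated.separated x y hxy
    refine ⟨insert z U, V, isSubcontinuum_insert_cut hU hV hd huv,
      interior_maximal (subset_insert _ _) hU hxU, hV, hyV, ?_⟩
    rw [Set.disjoint_left]
    rintro a (rfl | ha) haV
    · have : a ∈ ({a} : Set X)ᶜ := huv ▸ Or.inr haV
      exact this rfl
    · exact Set.disjoint_left.1 hd ha haV
  choose! E V hE hxE hV hyV hEV using hsep
  obtain ⟨t, ht, htc⟩ := hO.isClosed_compl.isCompact.elim_nhds_subcover V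
    fun y hy => (hV y hy).mem_nhds (hyV y hy)
  refine ⟨⋂₀ (E '' (t : Set X)), isSubcontinuum_sInter ?_, ?_, ?_⟩
  · rintro _ ⟨y, hy, rfl⟩
    exact hE y (ht y hy)
  · rw [sInter_image, (Finset.finite_toSet t).interior_biInter]
    exact mem_iInter₂.2 fun y hy => hxE y (ht y hy)
  · intro a ha
    by_contra haO
    obtain ⟨y, hy, hay⟩ := mem_iUnion₂.1 (htc haO)
    exact Set.disjoint_left.1 (hEV y (ht y hy)) (ha _ ⟨y, hy, rfl⟩) hay

theorem exists_subcontinuum_thickening [ConnectedSpace X] {D O : Set X} (hD : IsSubcontinuum D)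
    (hO : IsOpen O) (hDO : D ⊆ O) : ∃ E, IsSubcontinuum E ∧ D ⊆ interior E ∧ E ⊆ O := by
  have h : ∀ x : X, x ∈ D → ∃ E, IsSubcontinuum E ∧ x ∈ interior E ∧ E ⊆ O :=
    fun x hx => exists_subcontinuum_nhds hO (hDO hx)
  choose! E hE hxE hEO using h
  obtain ⟨t, ht, htc⟩ := hD.isClosed.isCompact.elim_nhds_subcover (fun x => interior (E x))
    fun x hx => isOpen_interior.mem_nhds (hxE x hx)
  have hsub : D ⊆ ⋃ x ∈ t, E x :=
    htc.trans (iUnion₂_mono fun x _ => interior_subset)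
  refine ⟨⋃ x ∈ t, E x, ⟨?_, ?_⟩, ?_, iUnion₂_subset fun x hx => hEO x (ht x hx)⟩
  · exact t.finite_toSet.isClosed_biUnion fun x hx => (hE x (ht x hx)).isClosed
  · rcases D.eq_empty_or_nonempty with rfl | ⟨d, hd⟩
    · have : t = ∅ := Finset.eq_empty_of_forall_notMem fun x hx => ht x hx
      simpa [this] using isPreconnected_empty
    · have heq : (⋃ x ∈ t, E x) = ⋃₀ ((fun x => D ∪ E x) '' (t : Set X)) := by
        rw [sUnion_image]
        apply Subset.antisymm
        · exact iUnion₂_mono fun x _ => subset_union_right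
        · exact iUnion₂_subset fun x hx => union_subset hsub
            (subset_biUnion_of_mem (u := fun x => E x) hx)
      rw [heq]
      refine isPreconnected_sUnion d _ ?_ ?_
      · rintro _ ⟨x, -, rfl⟩; exact Or.inl hd
      · rintro _ ⟨x, hx, rfl⟩
        exact hD.isPreconnected.union' ⟨x, ht x hx, interior_subset (hxE x (ht x hx))⟩
          (hE x (ht x hx)).isPreconnected
  · exact htc.trans (iUnion₂_subset fun x hx =>
      interior_mono (subset_biUnion_of_mem (u := fun x => E x) hx))

theorem exists_finite_basis_between {b : Set (Set X)} (hb : IsTopologicalBasis b) {K O : Set X}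
    (hK : IsCompact K) (hO : IsOpen O) (hKO : K ⊆ O) :
    ∃ F ⊆ b, F.Finite ∧ K ⊆ ⋃₀ F ∧ ⋃₀ F ⊆ O := by
  have h : ∀ x : X, x ∈ K → ∃ B ∈ b, x ∈ B ∧ B ⊆ O := fun x hx =>
    hb.exists_subset_of_mem_open (hKO hx) hO
  choose! B hB hxB hBO using h
  obtain ⟨t, ht, htc⟩ := hK.elim_nhds_subcover B fun x hx =>
    (hb.isOpen (hB x hx)).mem_nhds (hxB x hx)
  refine ⟨B '' (t : Set X), ?_, t.finite_toSet.image _, by rwa [sUnion_image], ?_⟩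
  · rintro _ ⟨x, hx, rfl⟩; exact hB x (ht x hx)
  · rw [sUnion_image]; exact iUnion₂_subset fun x hx => hBO x (ht x hx)

/-- One subcontinuum is chosen between each pair of finite unions of basic open sets, whenever there
is one. Thickening `D` inside `O` leaves room for such a pair. -/
theorem exists_countable_subcontinua (X : Type u) [TopologicalSpace X] [T2Space X] [CompactSpace X]
    [PointSeparated X] [ConnectedSpace X] [SecondCountableTopology X] :
    ∃ 𝒟 : ℕ → Set X, (∀ n, IsSubcontinuum (𝒟 n) ∧ (𝒟 n).Nonempty) ∧
      ∀ D O : Set X, IsSubcontinuum D → D.Nonempty → IsOpen O → D ⊆ O →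
        ∃ n, D ⊆ 𝒟 n ∧ 𝒟 n ⊆ O := by
  classical
  let b := countableBasis X
  have hb : IsTopologicalBasis b := isBasis_countableBasis X
  let F : Set (Set (Set X)) := {f | f.Finite ∧ f ⊆ b}
  have hF : F.Countable := countable_ofPred_finite_subset (countable_countableBasis X)
  let Q : Set (Set X) × Set (Set X) → Set X → Prop := fun p E =>
    IsSubcontinuum E ∧ E.Nonempty ∧ ⋃₀ p.1 ⊆ E ∧ E ⊆ ⋃₀ p.2
  let G : Set (Set (Set X) × Set (Set X)) := {p ∈ F ×ˢ F | ∃ E, Q p E}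
  have hG : G.Countable := (hF.prod hF).mono (sep_subset _ _)
  have hch : ∀ p : Set (Set X) × Set (Set X), p ∈ G → ∃ E, Q p E := fun p hp => hp.2
  choose! c hc using hch
  have key : ∀ D O : Set X, IsSubcontinuum D → D.Nonempty → IsOpen O → D ⊆ O →
      ∃ E ∈ c '' G, D ⊆ E ∧ E ⊆ O := by
    intro D O hD hne hO hDO
    obtain ⟨E, hE, hDE, hEO⟩ := exists_subcontinuum_thickening hD hO hDO
    obtain ⟨F₁, hF₁, hf₁, hs₁, hs₁'⟩ :=
      exists_finite_basis_between hb hD.isClosed.isCompact isOpen_interior hDE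
    obtain ⟨F₂, hF₂, hf₂, hs₂, hs₂'⟩ :=
      exists_finite_basis_between hb hE.isClosed.isCompact hO hEO
    have hmem : (F₁, F₂) ∈ G := ⟨⟨⟨hf₁, hF₁⟩, hf₂, hF₂⟩, E, hE,
      hne.mono (hDE.trans interior_subset), hs₁'.trans interior_subset, hs₂⟩
    exact ⟨_, ⟨_, hmem, rfl⟩, hs₁.trans (hc _ hmem).2.2.1, (hc _ hmem).2.2.2.trans hs₂'⟩
  have hne : (c '' G).Nonempty := by
    obtain ⟨E, hE, -⟩ := key univ univ IsSubcontinuum.univ univ_nonempty isOpen_univ subset_rfl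
    exact ⟨E, hE⟩
  obtain ⟨𝒟, h𝒟⟩ := (hG.image c).exists_eq_range hne
  refine ⟨𝒟, fun n => ?_, fun D O hD hDn hO hDO => ?_⟩
  · have : 𝒟 n ∈ c '' G := h𝒟 ▸ mem_range_self n
    obtain ⟨p, hp, hpn⟩ := this
    rw [← hpn]
    exact ⟨(hc p hp).1, (hc p hp).2.1⟩
  · obtain ⟨E, hE, h⟩ := key D O hD hDn hO hDO
    rw [h𝒟] at hE
    obtain ⟨n, rfl⟩ := hE
    exact ⟨n, h⟩

/-! ### Cores, hulls, gates and sides -/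

/-- The intersection of all the closed connected sets satisfying `P`. -/
def core (P : Set X → Prop) : Set X := ⋂₀ {D | IsSubcontinuum D ∧ P D}

/-- The smallest closed connected set containing `L`. -/
def hull (L : Set X) : Set X := core (L ⊆ ·)

theorem core_subset {P : Set X → Prop} {D : Set X} (hD : IsSubcontinuum D) (h : P D) :
    core P ⊆ D := sInter_subset_of_mem ⟨hD, h⟩

theorem subset_hull (L : Set X) : L ⊆ hull L := fun _ hx _ hD => hD.2 hx

theorem hull_subset {L D : Set X} (hD : IsSubcontinuum D) (h : L ⊆ D) : hull L ⊆ D :=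
  core_subset hD h

theorem isSubcontinuum_core [PreconnectedSpace X] (P : Set X → Prop) : IsSubcontinuum (core P) :=
  isSubcontinuum_sInter fun _ hD => hD.1

theorem isSubcontinuum_hull [PreconnectedSpace X] (L : Set X) : IsSubcontinuum (hull L) :=
  isSubcontinuum_core _

theorem core_nonempty [ConnectedSpace X] {P : Set X → Prop}
    (h : ∀ D E, IsSubcontinuum D → IsSubcontinuum E → P D → P E → (D ∩ E).Nonempty) :
    (core P).Nonempty :=
  helly_sInter (fun _ hD => hD.1) fun D hD E hE => h D E hD.1 hE.1 hD.2 hE.2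

/-- The conditions defining the gate of `L` in `K`. -/
def GatePred (K L D : Set X) : Prop := K ⊆ D ∨ ((D ∩ K).Nonempty ∧ L ⊆ D)

/-- Any two subcontinua satisfying `GatePred K L` meet, so Helly gives a point of the core. Two
points of the core would be separated by some `z ∈ K`. As `L` avoids `z`, it lies on one side, and
the closed half on that side satisfies the predicate while missing one of the two points. -/
theorem exists_gate [ConnectedSpace X] {K L : Set X} (hK : IsSubcontinuum K)
    (hL : IsSubcontinuum L) (hKne : K.Nonempty) (hLne : L.Nonempty) (hKL : Disjoint K L) :
    ∃ q ∈ K, core (GatePred K L) = {q} := by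
  have hcK : core (GatePred K L) ⊆ K := core_subset hK (Or.inl subset_rfl)
  have hne : (core (GatePred K L)).Nonempty := by
    refine core_nonempty fun D E hD hE h h' => ?_
    rcases h with h | h <;> rcases h' with h' | h'
    · exact hKne.mono (subset_inter h h')
    · exact h'.1.mono fun x hx => ⟨h hx.2, hx.1⟩
    · exact h.1.mono fun x hx => ⟨hx.1, h' hx.2⟩
    · exact hLne.mono (subset_inter h.2 h'.2)
  obtain ⟨q, hq⟩ := hne
  refine ⟨q, hcK hq, Subset.antisymm (fun v hv => ?_) (singleton_subset_iff.2 hq)⟩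
  by_contra hvq
  obtain ⟨z, U, V, hU, hV, hd, huv, hvU, hqV⟩ := PointSeparated.separated v q hvq
  have hzK := mem_of_cut hK.isPreconnected hU hV hd huv (hcK hv) (hcK hq) hvU hqV
  have hd' := hd.symm
  have huv' : V ∪ U = {z}ᶜ := by rwa [union_comm]
  have hLUV : L ⊆ U ∪ V := fun x hx => by
    rw [huv]; rintro rfl; exact Set.disjoint_left.1 hKL hzK hx
  rcases hL.isPreconnected.subset_or_subset hU hV hd hLUV with h | h
  · have := core_subset (P := GatePred K L) (isSubcontinuum_insert_cut hU hV hd huv)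
      (Or.inr ⟨⟨z, Or.inl rfl, hzK⟩, h.trans (subset_insert _ _)⟩) hq
    rcases this with rfl | h
    · have : q ∈ ({q} : Set X)ᶜ := huv ▸ Or.inr hqV
      exact this rfl
    · exact Set.disjoint_left.1 hd h hqV
  · have := core_subset (P := GatePred K L) (isSubcontinuum_insert_cut hV hU hd' huv')
      (Or.inr ⟨⟨z, Or.inl rfl, hzK⟩, h.trans (subset_insert _ _)⟩) hv
    rcases this with rfl | h
    · have : v ∈ ({v} : Set X)ᶜ := huv ▸ Or.inl hvU
      exact this rfl
    · exact Set.disjoint_left.1 hd hvU h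

/-- `L` and `L'` lie in the same component of the complement of `K`. -/
def SameSide (K L L' : Set X) : Prop := ∃ D, IsSubcontinuum D ∧ L ⊆ D ∧ L' ⊆ D ∧ Disjoint K D

theorem SameSide.symm {K L L' : Set X} (h : SameSide K L L') : SameSide K L' L := by
  obtain ⟨D, hD, h1, h2, h3⟩ := h
  exact ⟨D, hD, h2, h1, h3⟩

theorem SameSide.trans {K L L' L'' : Set X} (hne : L'.Nonempty) (h : SameSide K L L')
    (h' : SameSide K L' L'') : SameSide K L L'' := by
  obtain ⟨D, hD, h1, h2, h3⟩ := h
  obtain ⟨E, hE, h1', h2', h3'⟩ := h'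
  exact ⟨D ∪ E, hD.union hE (hne.mono (subset_inter h2 h1')), h1.trans subset_union_left,
    h2'.trans subset_union_right, h3.union_right h3'⟩

/-- Replacing `L` by the larger continuum `D` makes the predicate harder to satisfy, so the core can
only grow; both cores are single points, hence equal. -/
theorem SameSide.core_gate_eq [ConnectedSpace X] {K L L' : Set X} (h : SameSide K L L')
    (hK : IsSubcontinuum K) (hL : IsSubcontinuum L) (hL' : IsSubcontinuum L') (hKne : K.Nonempty)
    (hLne : L.Nonempty) (hLne' : L'.Nonempty) :
    core (GatePred K L) = core (GatePred K L') := by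
  obtain ⟨D, hD, h1, h2, h3⟩ := h
  have key : ∀ L : Set X, IsSubcontinuum L → L.Nonempty → L ⊆ D →
      core (GatePred K L) = core (GatePred K D) := by
    intro L hL hLne hLD
    obtain ⟨q, -, hq⟩ := exists_gate hK hL hKne hLne (h3.mono_right hLD)
    obtain ⟨r, -, hr⟩ := exists_gate hK hD hKne (hLne.mono hLD) h3
    have : core (GatePred K L) ⊆ core (GatePred K D) := by
      refine sInter_subset_sInter fun E hE => ⟨hE.1, hE.2.imp_right fun h => ⟨h.1, hLD.trans h.2⟩⟩
    rw [hq, hr] at this ⊢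
    rw [singleton_subset_singleton.1 this]
  rw [key L hL hLne h1, key L' hL' hLne' h2]

/-- The closure of the component of the complement of `K` which contains `x`. -/
theorem exists_side_closure [ConnectedSpace X] {K : Set X} (hK : IsSubcontinuum K)
    (hKne : K.Nonempty) {x : X} (hx : x ∉ K) :
    ∃ C : Set X, ∃ q ∈ K, IsSubcontinuum C ∧ K ∩ C ⊆ {q} ∧ core (GatePred K {x}) = {q} ∧
      (∀ L, SameSide K {x} L → L ⊆ C) ∧ ∀ y ∈ C, y ∉ K → SameSide K {x} {y} := by
  obtain ⟨q, hqK, hq⟩ := exists_gate hK (isSubcontinuum_singleton x) hKne (singleton_nonempty x)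
    (by simpa using hx)
  let C₀ : Set X := {y | SameSide K {x} {y}}
  have hC₀ : C₀ = ⋃₀ {D | IsSubcontinuum D ∧ x ∈ D ∧ Disjoint K D} := by
    ext y
    constructor
    · rintro ⟨D, hD, h1, h2, h3⟩
      exact ⟨D, ⟨hD, by simpa using h1, h3⟩, by simpa using h2⟩
    · rintro ⟨D, ⟨hD, h1, h3⟩, h2⟩
      exact ⟨D, hD, by simpa using h1, by simpa using h2, h3⟩
  refine ⟨closure C₀, q, hqK, ⟨isClosed_closure, IsPreconnected.closure ?_⟩, ?_, hq, ?_, ?_⟩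
  · rw [hC₀]
    exact isPreconnected_sUnion x _ (fun D hD => hD.2.1) fun D hD => hD.1.isPreconnected
  -- A second point `v` of `K` in the closure is separated from `q` by some `z ∈ K`. A point `c` of
  -- the component on the side of `v` then has its gate in the closed half containing `v`, but this
  -- gate is `q`.
  · rintro v ⟨hvK, hvC⟩
    by_contra hvq
    obtain ⟨z, U, V, hU, hV, hd, huv, hvU, hqV⟩ := PointSeparated.separated v q hvq
    have hzK := mem_of_cut hK.isPreconnected hU hV hd huv hvK hqK hvU hqV
    obtain ⟨c, hcU, hc⟩ := mem_closure_iff.1 hvC U hU hvU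
    have hgc := SameSide.core_gate_eq hc hK (isSubcontinuum_singleton x)
      (isSubcontinuum_singleton c) hKne (singleton_nonempty x) (singleton_nonempty c)
    have hqc : q ∈ core (GatePred K {c}) := by rw [← hgc, hq]; rfl
    have := core_subset (P := GatePred K {c}) (isSubcontinuum_insert_cut hU hV hd huv)
      (Or.inr ⟨⟨z, Or.inl rfl, hzK⟩, singleton_subset_iff.2 (Or.inr hcU)⟩) hqc
    rcases this with rfl | h
    · have : q ∈ ({q} : Set X)ᶜ := huv ▸ Or.inr hqV
      exact this rfl
    · exact Set.disjoint_left.1 hd h hqV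
  · rintro L ⟨D, hD, h1, h2, h3⟩ y hy
    exact subset_closure ⟨D, hD, h1, singleton_subset_iff.2 (h2 hy), h3⟩
  -- Local connectedness: the component is relatively closed in the complement of `K`.
  · intro y hy hyK
    obtain ⟨D, hD, hyD, hDK⟩ := exists_subcontinuum_nhds hK.isClosed.isOpen_compl hyK
    obtain ⟨c, hcD, hc⟩ := mem_closure_iff.1 hy _ isOpen_interior hyD
    exact SameSide.trans (singleton_nonempty c) hc ⟨D, hD,
      singleton_subset_iff.2 (interior_subset hcD), singleton_subset_iff.2 (interior_subset hyD),
      disjoint_left.2 fun a ha ha' => hDK ha' ha⟩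

/-! ### Arcs -/

/-- A cut point between `x` and `x'` leaves `y` in one of the two closed halves. That half contains
the hull of `y` and one of the two points, and misses the other point. -/
theorem eq_of_mem_hull_pair [ConnectedSpace X] {x x' y : X} (h : x ∈ hull {x', y})
    (h' : x' ∈ hull {x, y}) : x = x' := by
  by_contra hne
  obtain ⟨z, U, V, hU, hV, hd, huv, hxU, hxV⟩ := PointSeparated.separated x x' hne
  have hd' := hd.symm
  have huv' : V ∪ U = {z}ᶜ := by rwa [union_comm]
  have hy : y ∈ insert z U ∨ y ∈ insert z V := by
    by_cases hyz : y = z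
    · exact Or.inl (Or.inl hyz)
    · have : y ∈ U ∪ V := huv ▸ hyz
      exact this.imp Or.inr Or.inr
  rcases hy with hy | hy
  · have := hull_subset (isSubcontinuum_insert_cut hU hV hd huv)
      (insert_subset (Or.inr hxU) (singleton_subset_iff.2 hy)) h'
    rcases this with rfl | h
    · have : x' ∈ ({x'} : Set X)ᶜ := huv ▸ Or.inr hxV
      exact this rfl
    · exact Set.disjoint_left.1 hd h hxV
  · have := hull_subset (isSubcontinuum_insert_cut hV hU hd' huv')
      (insert_subset (Or.inr hxV) (singleton_subset_iff.2 hy)) h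
    rcases this with rfl | h
    · have : x ∈ ({x} : Set X)ᶜ := huv ▸ Or.inl hxU
      exact this rfl
    · exact Set.disjoint_left.1 hd hxU h

/-- An arc determines its end points. The point `y` lies in the hull of `{a, x}` or of `{x, b}`. In
the first case so does `b`, whence `x = b`; in the second `a` lies in the hull of `{x, b}`, whence
`x = a`. -/
theorem pair_eq_of_hull_eq [ConnectedSpace X] {x y a b : X} (h : hull {x, y} = hull {a, b}) :
    ({x, y} : Set X) = {a, b} := by
  have key : ∀ x y a b : X, hull {x, y} = hull {a, b} → x ∈ ({a, b} : Set X) := by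
    intro x y a b h
    have hx : x ∈ hull {a, b} := h ▸ subset_hull _ (by simp)
    have hy : y ∈ hull {a, b} := h ▸ subset_hull _ (by simp)
    have ha : a ∈ hull {x, y} := h ▸ subset_hull _ (by simp)
    have hb : b ∈ hull {x, y} := h ▸ subset_hull _ (by simp)
    have hu : hull {a, b} ⊆ hull {a, x} ∪ hull {x, b} := by
      refine hull_subset ((isSubcontinuum_hull _).union (isSubcontinuum_hull _)
        ⟨x, subset_hull _ (by simp), subset_hull _ (by simp)⟩) ?_
      exact insert_subset (Or.inl (subset_hull _ (by simp)))
        (singleton_subset_iff.2 (Or.inr (subset_hull _ (by simp))))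
    rcases hu hy with hy | hy
    · have hb' : b ∈ hull {x, a} := by
        rw [pair_comm]
        exact hull_subset (isSubcontinuum_hull _)
          (insert_subset (subset_hull _ (by simp)) (singleton_subset_iff.2 hy)) hb
      exact Or.inr (eq_of_mem_hull_pair (by rwa [pair_comm]) hb')
    · have ha' : a ∈ hull {x, b} :=
        hull_subset (isSubcontinuum_hull _)
          (insert_subset (subset_hull _ (by simp)) (singleton_subset_iff.2 hy)) ha
      exact Or.inl (eq_of_mem_hull_pair hx ha')
  apply Subset.antisymm
  · exact insert_subset (key _ _ _ _ h)
      (singleton_subset_iff.2 (key y x a b (by rwa [pair_comm y x])))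
  · exact insert_subset (key _ _ _ _ h.symm)
      (singleton_subset_iff.2 (key b a x y (by rw [pair_comm b a, h])))

theorem isClosed_setOf_mem_hull_pair [ConnectedSpace X] (t : X) :
    IsClosed {p : X × X | t ∈ hull {p.1, p.2}} := by
  rw [← isOpen_compl_iff, isOpen_iff_mem_nhds]
  rintro ⟨x, y⟩ hxy
  obtain ⟨E, hE, hsub, hEt⟩ := exists_subcontinuum_thickening (isSubcontinuum_hull {x, y})
    (isOpen_compl_singleton (x := t)) (fun a ha => by rintro rfl; exact hxy ha)
  have hx : interior E ∈ nhds x := isOpen_interior.mem_nhds (hsub (subset_hull _ (by simp)))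
  have hy : interior E ∈ nhds y := isOpen_interior.mem_nhds (hsub (subset_hull _ (by simp)))
  filter_upwards [prod_mem_nhds hx hy] with p hp
  intro ht
  exact hEt (hull_subset hE (insert_subset (interior_subset hp.1)
    (singleton_subset_iff.2 (interior_subset hp.2))) ht) rfl

/-- The hypothesis `htri` excludes branch points. Zorn's lemma, with chains bounded by compactness
of `M ×ˢ M`, gives a maximal hull of two points `x`, `y` of `M`. The gate `p` of a further point `z`
belongs to all three hulls, so it is `x`, `y` or `z`; each case enlarges the hull or puts `z` into
it. -/
theorem exists_eq_hull_pair [ConnectedSpace X] {M : Set X} (hM : IsSubcontinuum M)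
    (hne : M.Nonempty) (htri : ∀ x ∈ M, ∀ y ∈ M, ∀ z ∈ M, ∀ p, p ∈ hull {x, y} →
      p ∈ hull {y, z} → p ∈ hull {x, z} → p = x ∨ p = y ∨ p = z) :
    ∃ x y, M = hull {x, y} := by
  obtain ⟨m, hm⟩ := hne
  let S : Set (Set X) := {H | ∃ x ∈ M, ∃ y ∈ M, H = hull {x, y}}
  obtain ⟨H, -, ⟨x, hx, y, hy, rfl⟩, hmax⟩ := zorn_subset_nonempty S (fun c hc hchain hcne => by
    have hcpt : IsCompact (M ×ˢ M) := hM.isClosed.isCompact.prod hM.isClosed.isCompact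
    have := hcpt.inter_iInter_nonempty (fun t : ⋃₀ c => {p : X × X | (t : X) ∈ hull {p.1, p.2}})
      (fun t => isClosed_setOf_mem_hull_pair _) (fun u => by
        have : ∃ H ∈ c, ∀ t ∈ u, (t : X) ∈ H := by
          classical
          induction u using Finset.induction_on with
          | empty => obtain ⟨H, hH⟩ := hcne; exact ⟨H, hH, by simp⟩
          | insert a u _ ih =>
            obtain ⟨H, hH, h⟩ := ih
            obtain ⟨H', hH', h'⟩ := a.2
            rcases hchain.total hH hH' with hle | hle
            · exact ⟨H', hH', fun t ht => by
                rcases Finset.mem_insert.1 ht with rfl | ht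
                · exact h'
                · exact hle (h t ht)⟩
            · exact ⟨H, hH, fun t ht => by
                rcases Finset.mem_insert.1 ht with rfl | ht
                · exact hle h'
                · exact h t ht⟩
        obtain ⟨H, hH, h⟩ := this
        obtain ⟨x, hx, y, hy, rfl⟩ := hc hH
        exact ⟨(x, y), ⟨hx, hy⟩, mem_iInter₂.2 fun t ht => h t ht⟩)
    obtain ⟨⟨x, y⟩, ⟨hx, hy⟩, h⟩ := this
    refine ⟨hull {x, y}, ⟨x, hx, y, hy, rfl⟩, fun H hH t ht => ?_⟩
    exact mem_iInter.1 h ⟨t, H, hH, ht⟩) (hull {m, m}) ⟨m, hm, m, hm, rfl⟩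
  refine ⟨x, y, Subset.antisymm (fun z hz => ?_) (hull_subset hM (insert_subset hx (by simpa)))⟩
  by_contra hzK
  obtain ⟨p, hpK, hp⟩ := exists_gate (isSubcontinuum_hull {x, y}) (isSubcontinuum_singleton z)
    ⟨x, subset_hull _ (by simp)⟩ (singleton_nonempty z) (by simpa using hzK)
  have hpm : p ∈ core (GatePred (hull {x, y}) {z}) := by rw [hp]; rfl
  have hpx : p ∈ hull {x, z} := core_subset (isSubcontinuum_hull _)
    (Or.inr ⟨⟨x, subset_hull _ (by simp), subset_hull _ (by simp)⟩,
      singleton_subset_iff.2 (subset_hull _ (by simp))⟩) hpm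
  have hpy : p ∈ hull {y, z} := core_subset (isSubcontinuum_hull _)
    (Or.inr ⟨⟨y, subset_hull _ (by simp), subset_hull _ (by simp)⟩,
      singleton_subset_iff.2 (subset_hull _ (by simp))⟩) hpm
  have hbig : ∀ a ∈ M, hull {x, y} ⊆ hull {a, z} → False := fun a ha hsub =>
    hzK (hmax ⟨a, ha, z, hz, rfl⟩ hsub (subset_hull _ (by simp)))
  rcases htri x hx y hy z hz p hpK hpy hpx with rfl | rfl | rfl
  · exact hbig y hy (hull_subset (isSubcontinuum_hull _)
      (insert_subset hpy (singleton_subset_iff.2 (subset_hull _ (by simp)))))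
  · exact hbig x hx (hull_subset (isSubcontinuum_hull _)
      (insert_subset (subset_hull _ (by simp)) (singleton_subset_iff.2 hpx)))
  · exact hzK hpK

theorem mem_ends_of_connected {M : Set X} {p : X} (hp : p ∈ M) (h : IsConnected (M \ {p})) :
    p ∈ ends M := by
  refine ⟨hp, ?_⟩
  have : ConnectedSpace ↥(M \ {p}) := isConnected_iff_connectedSpace.1 h
  have : Nonempty (ConnectedComponents ↥(M \ {p})) :=
    ⟨ConnectedComponents.mk (Classical.arbitrary _)⟩
  exact Nat.card_of_subsingleton (Classical.arbitrary _)

theorem mem_ends_of_sameSide [ConnectedSpace X] {M : Set X} {p : X} (hM : IsSubcontinuum M)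
    (hp : p ∈ M) (hne : (M \ {p}).Nonempty)
    (h : ∀ x ∈ M, ∀ y ∈ M, x ≠ p → y ≠ p → SameSide {p} {x} {y}) : p ∈ ends M := by
  refine mem_ends_of_connected hp ⟨hne, isPreconnected_of_forall_pair fun x hx y hy => ?_⟩
  obtain ⟨D, hD, hxD, hyD, hpD⟩ := h x hx.1 y hy.1 hx.2 hy.2
  refine ⟨M ∩ D, fun a ha => ⟨ha.1, ?_⟩, ⟨hx.1, hxD rfl⟩, ⟨hy.1, hyD rfl⟩,
    (hM.inter hD).isPreconnected⟩
  rintro rfl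
  exact Set.disjoint_left.1 hpD rfl ha.2

end Topology
end Dendro

namespace Dendro

/-! ### Measurability of maps to the hyperspace -/

section Measurability

open Set

attribute [local instance] borelCL

variable {X : Type u} [TopologicalSpace X]

instance borelSpace_CL : @BorelSpace (NonemptyCompacts X) _ (borelCL X) :=
  @BorelSpace.mk _ _ (borelCL X) rfl

/-- The compact-open topology on the homeomorphism group. -/
abbrev topHomeo (X : Type u) [TopologicalSpace X] : TopologicalSpace (X ≃ₜ X) :=
  TopologicalSpace.induced (fun h : X ≃ₜ X => (h : C(X, X))) inferInstance

attribute [local instance] topHomeo borelHomeo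

instance borelSpace_homeo : @BorelSpace (X ≃ₜ X) (topHomeo X) (borelHomeo X) :=
  @BorelSpace.mk _ (topHomeo X) (borelHomeo X) rfl

/-- The image of a compact set under a homeomorphism. -/
def mapCL (g : X ≃ₜ X) (K : NonemptyCompacts X) : NonemptyCompacts X := K.map g g.continuous

@[simp] theorem coe_mapCL (g : X ≃ₜ X) (K : NonemptyCompacts X) :
    (mapCL g K : Set X) = g '' K := rfl

theorem mapCL_mul (g h : X ≃ₜ X) (K : NonemptyCompacts X) :
    mapCL (g * h) K = mapCL g (mapCL h K) := by
  apply SetLike.coe_injective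
  simp only [coe_mapCL, image_image]
  rfl

theorem mapCL_one (K : NonemptyCompacts X) : mapCL 1 K = K := by
  apply SetLike.coe_injective
  ext; simp

theorem mapCL_singleton (g : X ≃ₜ X) (x : X) : mapCL g {x} = {g x} := by
  apply SetLike.coe_injective
  simp

section Compact

variable [CompactSpace X] [T2Space X] [SecondCountableTopology X]

theorem polishSpace_of_compact (X : Type u) [TopologicalSpace X] [CompactSpace X] [T2Space X]
    [SecondCountableTopology X] : PolishSpace X := by
  let := metrizableSpaceMetric X
  infer_instance

instance standardBorel_CL : StandardBorelSpace (NonemptyCompacts X) := by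
  have : PolishSpace (NonemptyCompacts X) := polishSpace_of_compact _
  infer_instance

theorem continuous_mapCL : Continuous fun p : (X ≃ₜ X) × NonemptyCompacts X => mapCL p.1 p.2 := by
  unfold mapCL
  refine Continuous.nonemptyCompacts_map' (g := fun (p : (X ≃ₜ X) × NonemptyCompacts X) => ⇑p.1)
    continuous_snd ?_
  have h : Continuous fun q : C(X, X) × X => q.1 q.2 := continuous_eval
  have h' : Continuous fun g : X ≃ₜ X => (g : C(X, X)) := continuous_induced_dom
  exact h.comp ((h'.comp (continuous_fst.comp continuous_fst)).prodMk continuous_snd)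

theorem continuous_homeo_apply : Continuous fun p : (X ≃ₜ X) × X => p.1 p.2 := by
  have h : Continuous fun q : C(X, X) × X => q.1 q.2 := continuous_eval
  have h' : Continuous fun g : X ≃ₜ X => (g : C(X, X)) := continuous_induced_dom
  exact h.comp ((h'.comp continuous_fst).prodMk continuous_snd)

variable {Y : Type*} [MeasurableSpace Y]

theorem measurable_mapCL {g : Y → (X ≃ₜ X)} {K : Y → NonemptyCompacts X} (hg : Measurable g)
    (hK : Measurable K) : Measurable fun y => mapCL (g y) (K y) :=
  continuous_mapCL.measurable.comp (hg.prodMk hK)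

theorem measurable_homeo_apply [MeasurableSpace X] [BorelSpace X] {g : Y → (X ≃ₜ X)} {f : Y → X}
    (hg : Measurable g) (hf : Measurable f) : Measurable fun y => g y (f y) :=
  continuous_homeo_apply.measurable.comp (hg.prodMk hf)

/-- Open sets are countable unions of closed sets, so hitting closed sets controls both kinds of
conditions defining the Vietoris topology. -/
theorem measurable_CL_of_closed {f : Y → NonemptyCompacts X}
    (h : ∀ F : Set X, IsClosed F → MeasurableSet {y | ((f y : Set X) ∩ F).Nonempty}) :
    Measurable f := by
  have hb := (isBasis_countableBasis X).nonemptyCompacts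
  have hgen : borelCL X = _ := hb.borel_eq_generateFrom
  rw [hgen]
  refine measurable_generateFrom ?_
  rintro _ ⟨u, ⟨hf, -, hub⟩, rfl⟩
  have hopen : ∀ U ∈ u, IsOpen U := fun U hU => (isBasis_countableBasis X).isOpen (hub hU)
  have h1 : MeasurableSet {y | (f y : Set X) ⊆ ⋃₀ u} := by
    have := (h (⋃₀ u)ᶜ (isOpen_sUnion hopen).isClosed_compl).compl
    convert! this using 1
    ext y
    simp [inter_compl_nonempty_iff]
  have h2 : ∀ U ∈ u, MeasurableSet {y | ((f y : Set X) ∩ U).Nonempty} := by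
    intro U hU
    let := metrizableSpaceMetric X
    obtain ⟨F, hF, -, hFU, -⟩ := (hopen U hU).exists_iUnion_isClosed
    have : {y | ((f y : Set X) ∩ U).Nonempty} = ⋃ n, {y | ((f y : Set X) ∩ F n).Nonempty} := by
      ext y
      simp only [← hFU, inter_iUnion, nonempty_iUnion, mem_ofPred_eq, mem_iUnion]
    rw [this]
    exact MeasurableSet.iUnion fun n => h _ (hF n)
  have : f ⁻¹' {K : NonemptyCompacts X | ↑K ⊆ ⋃₀ u ∧ ∀ U ∈ u, (↑K ∩ U).Nonempty} =
      {y | (f y : Set X) ⊆ ⋃₀ u} ∩ ⋂ U ∈ u, {y | ((f y : Set X) ∩ U).Nonempty} := by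
    ext y; simp
  rw [this]
  exact h1.inter (MeasurableSet.biInter hf.countable h2)

theorem measurableSet_subset {f : Y → NonemptyCompacts X} (hf : Measurable f) {F : Set X}
    (hF : IsClosed F) : MeasurableSet {y | (f y : Set X) ⊆ F} :=
  hf (NonemptyCompacts.isClosed_subsets_of_isClosed hF).measurableSet

theorem measurableSet_inter_nonempty {f : Y → NonemptyCompacts X} (hf : Measurable f) {F : Set X}
    (hF : IsClosed F) : MeasurableSet {y | ((f y : Set X) ∩ F).Nonempty} :=
  hf (NonemptyCompacts.isClosed_inter_nonempty_of_isClosed hF).measurableSet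

theorem measurableSet_disjoint {f g : Y → NonemptyCompacts X} (hf : Measurable f)
    (hg : Measurable g) : MeasurableSet {y | Disjoint (f y : Set X) (g y : Set X)} :=
  (hf.prodMk hg) (NonemptyCompacts.isOpen_setOfPred_disjoint_coe (α := X)).measurableSet

theorem measurable_singletonCL [MeasurableSpace X] [BorelSpace X] {f : Y → X} :
    (Measurable fun y => ({f y} : NonemptyCompacts X)) ↔ Measurable f :=
  (NonemptyCompacts.isClosedEmbedding_singleton (α := X)).measurableEmbedding.measurable_comp_iff

end Compact

/-! ### Measurability of cores -/

section Core

variable [CompactSpace X] [T2Space X] [SecondCountableTopology X] [PointSeparated X]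
  [ConnectedSpace X] {Y : Type*} [MeasurableSpace Y]

variable (X) in
/-- A countable family of closed connected sets approximating all the others from outside. -/
noncomputable def net : ℕ → Set X := Classical.choose (exists_countable_subcontinua X)

theorem isSubcontinuum_net (n : ℕ) : IsSubcontinuum (net X n) :=
  ((Classical.choose_spec (exists_countable_subcontinua X)).1 n).1

theorem net_nonempty (n : ℕ) : (net X n).Nonempty :=
  ((Classical.choose_spec (exists_countable_subcontinua X)).1 n).2

theorem exists_net {D O : Set X} (hD : IsSubcontinuum D) (hne : D.Nonempty) (hO : IsOpen O)
    (hDO : D ⊆ O) : ∃ n, D ⊆ net X n ∧ net X n ⊆ O :=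
  (Classical.choose_spec (exists_countable_subcontinua X)).2 D O hD hne hO hDO

/-- A point outside a non-empty subcontinuum `D` is also outside some member of the net containing
`D`, and monotonicity passes `P` to that member. The property must fail for `∅` because the net
approximates non-empty continua only. -/
theorem core_eq_iInter_net {P : Set X → Prop} (hmono : ∀ D E, D ⊆ E → P D → P E) (hP : ¬ P ∅) :
    core P = ⋂ n, ⋂ _ : P (net X n), net X n := by
  apply Subset.antisymm
  · exact subset_iInter₂ fun n hn => core_subset (isSubcontinuum_net n) hn
  · rintro x hx D ⟨hD, hPD⟩
    by_contra hxD
    have hne : D.Nonempty := nonempty_iff_ne_empty.2 fun h => hP (h ▸ hPD)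
    obtain ⟨n, hn, hnx⟩ := exists_net hD hne (isOpen_compl_singleton (x := x))
      (fun a ha => by rintro rfl; exact hxD ha)
    exact hnx (mem_iInter₂.1 hx n (hmono _ _ hn hPD)) rfl

/-- By compactness the core meets `F` exactly when, for every `N`, `F` meets the intersection of the
members of the net of index below `N` that satisfy `P y`. For a given `N` only finitely many
selections `T` of members can occur. -/
theorem measurable_of_eq_core {P : Y → Set X → Prop} (hmono : ∀ y D E, D ⊆ E → P y D → P y E)
    (hP : ∀ y, ¬ P y ∅) (hmeas : ∀ n, MeasurableSet {y | P y (net X n)})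
    {f : Y → NonemptyCompacts X} (hf : ∀ y, (f y : Set X) = core (P y)) : Measurable f := by
  classical
  refine measurable_CL_of_closed fun F hF => ?_
  let G : Y → ℕ → Set X := fun y N => F ∩ ⋂ n ∈ (Finset.range N).filter (fun n => P y (net X n)),
    net X n
  have hset : {y | ((f y : Set X) ∩ F).Nonempty} = ⋂ N, {y | (G y N).Nonempty} := by
    ext y
    simp only [mem_ofPred_eq, mem_iInter]
    rw [hf, core_eq_iInter_net (hmono y) (hP y)]
    constructor
    · rintro ⟨x, hx, hxF⟩ N
      refine ⟨x, hxF, mem_iInter₂.2 fun n hn => ?_⟩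
      exact mem_iInter₂.1 hx n (Finset.mem_filter.1 hn).2
    · intro h
      have hcl : ∀ N, IsClosed (G y N) := fun N => hF.inter
        (isClosed_biInter fun n _ => (isSubcontinuum_net n).isClosed)
      obtain ⟨x, hx⟩ := IsCompact.nonempty_iInter_of_sequence_nonempty_isCompact_isClosed (G y)
        (fun N => inter_subset_inter_right _ (biInter_subset_biInter_left fun n hn => by
          simp only [Finset.coe_filter, Finset.mem_range, mem_ofPred_eq] at hn ⊢
          exact ⟨hn.1.trans (Nat.lt_succ_self N), hn.2⟩)) h (hcl 0).isCompact hcl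
      rw [mem_iInter] at hx
      refine ⟨x, mem_iInter₂.2 fun n hn => ?_, (hx 0).1⟩
      exact mem_iInter₂.1 (hx (n + 1)).2 n (Finset.mem_filter.2 ⟨by simp, hn⟩)
  rw [hset]
  refine MeasurableSet.iInter fun N => ?_
  have : {y | (G y N).Nonempty} = ⋃ T ∈ (Finset.range N).powerset.filter
      (fun T => (F ∩ ⋂ n ∈ T, net X n).Nonempty),
      {y | ∀ n ∈ Finset.range N, (n ∈ T ↔ P y (net X n))} := by
    ext y
    simp only [mem_ofPred_eq, mem_iUnion, exists_prop, Finset.mem_filter, Finset.mem_powerset]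
    constructor
    · intro h
      refine ⟨_, ⟨Finset.filter_subset _ _, h⟩, fun n hn => ?_⟩
      simp only [Finset.mem_filter, hn, true_and]
    · rintro ⟨T, ⟨hT, h⟩, hy⟩
      have : T = (Finset.range N).filter (fun n => P y (net X n)) := by
        ext n
        simp only [Finset.mem_filter]
        exact ⟨fun hn => ⟨hT hn, (hy n (hT hn)).1 hn⟩, fun hn => (hy n hn.1).2 hn.2⟩
      rwa [this] at h
  rw [this]
  refine Finset.measurableSet_biUnion _ fun T _ => ?_
  have : {y | ∀ n ∈ Finset.range N, (n ∈ T ↔ P y (net X n))} =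
      ⋂ n ∈ Finset.range N, {y | n ∈ T ↔ P y (net X n)} := by ext; simp
  rw [this]
  refine Finset.measurableSet_biInter _ fun n _ => ?_
  by_cases hn : n ∈ T
  · simpa [hn] using hmeas n
  · simp only [hn, false_iff]
    exact (hmeas n).compl

/-- A non-empty core as an element of the hyperspace. -/
noncomputable def coreCL (P : Set X → Prop) (h : (core P).Nonempty) : NonemptyCompacts X :=
  ⟨⟨core P, (isSubcontinuum_core P).isClosed.isCompact⟩, h⟩

end Core

theorem IsSubcontinuum.image {D : Set X} (hD : IsSubcontinuum D) (g : X ≃ₜ X) :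
    IsSubcontinuum (g '' D) :=
  ⟨g.isClosedMap _ hD.isClosed, hD.isPreconnected.image _ g.continuous.continuousOn⟩

/-- The source of equivariance for all the families built below: it suffices to compare the defining
properties. -/
theorem image_core (g : X ≃ₜ X) {P Q : Set X → Prop}
    (h : ∀ D, IsSubcontinuum D → (P D ↔ Q (g '' D))) : g '' core P = core Q := by
  apply Subset.antisymm
  · rintro _ ⟨x, hx, rfl⟩ D ⟨hD, hQ⟩
    have hD' : IsSubcontinuum (g.symm '' D) := hD.image g.symm
    have : P (g.symm '' D) := (h _ hD').2 (by simpa [image_image] using hQ)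
    obtain ⟨y, hy, hyx⟩ := hx _ ⟨hD', this⟩
    rw [← hyx]; simpa using hy
  · intro x hx
    refine ⟨g.symm x, fun D hD => ?_, by simp⟩
    obtain ⟨y, hy, hyx⟩ := hx _ ⟨hD.1.image g, (h D hD.1).1 hD.2⟩
    rw [← hyx]; simpa using hy

theorem image_hull (g : X ≃ₜ X) (L : Set X) : g '' hull L = hull (g '' L) :=
  image_core g fun _ _ => by simp [image_subset_image_iff g.injective]

theorem SameSide.image {K L L' : Set X} (h : SameSide K L L') (g : X ≃ₜ X) :
    SameSide (g '' K) (g '' L) (g '' L') := by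
  obtain ⟨D, hD, h1, h2, h3⟩ := h
  exact ⟨g '' D, hD.image g, image_mono h1, image_mono h2, (disjoint_image_iff g.injective).2 h3⟩

/-! ### Measurable choice of the end points of an arc -/

section Pairs

variable [CompactSpace X] [T2Space X] [SecondCountableTopology X] [PointSeparated X]
  [ConnectedSpace X] {Y : Type*} [MeasurableSpace Y]

/-- The hull of a non-empty compact set. -/
noncomputable def hullCL (K : NonemptyCompacts X) : NonemptyCompacts X :=
  coreCL ((K : Set X) ⊆ ·) (K.nonempty.mono (subset_hull _))

@[simp] theorem coe_hullCL (K : NonemptyCompacts X) : (hullCL K : Set X) = hull (K : Set X) := rfl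

theorem measurable_hullCL : Measurable (hullCL (X := X)) := by
  refine measurable_of_eq_core (P := fun (K : NonemptyCompacts X) D => (K : Set X) ⊆ D)
    (fun K D E h h' => h'.trans h)
    (fun K h => ?_) (fun n => ?_) (fun K => coe_hullCL K)
  · exact K.nonempty.ne_empty (subset_empty_iff.1 h)
  · exact measurableSet_subset measurable_id (isSubcontinuum_net n).isClosed

theorem exists_measurable_pair {M : Y → NonemptyCompacts X} (hM : Measurable M)
    (h : ∀ y, ∃ a b : X, (M y : Set X) = hull {a, b}) :
    ∃ κ : Y → NonemptyCompacts X, Measurable κ ∧ (∀ y, ∃ a b : X, (κ y : Set X) = {a, b}) ∧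
      ∀ y, (M y : Set X) = hull (κ y : Set X) := by
  let pr : X × X → NonemptyCompacts X := fun p => {p.1} ⊔ {p.2}
  have hpr : Continuous pr := by
    refine Continuous.sup ?_ ?_
    · exact NonemptyCompacts.continuous_singleton.comp continuous_fst
    · exact NonemptyCompacts.continuous_singleton.comp continuous_snd
  have hcoe : ∀ p, (pr p : Set X) = {p.1, p.2} := fun p => by
    simp only [pr, NonemptyCompacts.coe_sup, NonemptyCompacts.coe_singleton]; rfl
  let T : Set (NonemptyCompacts X) := range pr
  have hT : MeasurableSet T := (isCompact_range hpr).isClosed.measurableSet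
  have : StandardBorelSpace T := hT.standardBorel
  have hinj : Function.Injective fun K : T => hullCL (K : NonemptyCompacts X) := by
    rintro ⟨_, p, rfl⟩ ⟨_, q, rfl⟩ h
    have h' := congrArg (fun K : NonemptyCompacts X => (K : Set X)) h
    simp only [coe_hullCL, hcoe] at h'
    have := pair_eq_of_hull_eq h'
    apply Subtype.ext
    apply SetLike.coe_injective
    simpa [hcoe] using this
  -- Lusin–Souslin: an injective Borel map between standard Borel spaces has a Borel inverse on its
  -- image, so `κ` inherits its measurability from `M`.
  have hemb : MeasurableEmbedding fun K : T => hullCL (K : NonemptyCompacts X) :=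
    (measurable_hullCL.comp measurable_subtype_coe).measurableEmbedding hinj
  choose a b hab using h
  let κ : Y → T := fun y => ⟨pr (a y, b y), mem_range_self _⟩
  have hκM : ∀ y, hullCL (κ y : NonemptyCompacts X) = M y := fun y => by
    apply SetLike.coe_injective
    rw [coe_hullCL, hab, hcoe]
  have hκ : Measurable κ := by
    rw [← hemb.measurable_comp_iff]
    convert! hM using 1
    exact funext hκM
  exact ⟨fun y => κ y, measurable_subtype_coe.comp hκ, fun y => ⟨a y, b y, hcoe _⟩,
    fun y => by rw [← hκM y]; rfl⟩

end Pairs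

end Measurability
end Dendro

namespace Dendro

/-! ### The space of probability measures on a standard Borel space -/

section StandardBorel

open Set

theorem standardBorel_of_measurableEmbedding {α β : Type*} [MeasurableSpace α] [MeasurableSpace β]
    [StandardBorelSpace β] {e : α → β} (he : MeasurableEmbedding e) : StandardBorelSpace α := by
  obtain ⟨t', hb, hp⟩ := he.measurableSet_range.standardBorel.polish
  let f : α → range e := he.equivRange
  let t : TopologicalSpace α := TopologicalSpace.induced f inferInstance
  have hf : Topology.IsClosedEmbedding f :=
    ⟨⟨⟨rfl⟩, he.equivRange.injective⟩, by
      rw [show range f = univ from he.equivRange.surjective.range_eq]; exact isClosed_univ⟩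
  refine ⟨⟨t, ⟨?_⟩, hf.polishSpace⟩⟩
  have h := he.equivRange.measurableEmbedding.comap_eq
  have h' : MeasurableSpace.comap f (borel (range e)) = borel α := borel_comap.symm
  rw [← h', ← hb.measurable_eq]
  exact h.symm

theorem exists_countable_setAlgebra (T : Type*) [MeasurableSpace T]
    [MeasurableSpace.CountablyGenerated T] : ∃ A : ℕ → Set T, IsSetAlgebra (range A) ∧
      ‹MeasurableSpace T› = MeasurableSpace.generateFrom (range A) := by
  obtain ⟨b, hb, hgen⟩ := MeasurableSpace.CountablyGenerated.isCountablyGenerated (α := T)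
  have hc : (generateSetAlgebra b).Countable := countable_generateSetAlgebra hb
  have halg : IsSetAlgebra (generateSetAlgebra b) := isSetAlgebra_generateSetAlgebra
  obtain ⟨A, hA⟩ := hc.exists_eq_range ⟨∅, halg.empty_mem⟩
  refine ⟨A, hA ▸ halg, ?_⟩
  rw [← hA, generateFrom_generateSetAlgebra_eq, hgen]

theorem measurable_lintegral_measure_of_closed {K Y : Type*} [TopologicalSpace K]
    [PseudoMetrizableSpace K] [MeasurableSpace K] [BorelSpace K] [MeasurableSpace Y]
    {m : Y → Measure K} [∀ y, IsProbabilityMeasure (m y)]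
    (h : ∀ f : BoundedContinuousFunction K NNReal, Measurable fun y => ∫⁻ x, f x ∂(m y)) :
    Measurable m := by
  refine Measurable.measure_of_isPiSystem_of_isProbabilityMeasure
    (BorelSpace.measurable_eq.trans borel_eq_generateFrom_isClosed) isPiSystem_isClosed
    fun F hF => ?_
  refine measurable_of_tendsto_metrizable (f := fun n y => ∫⁻ x, hF.apprSeq n x ∂(m y))
    (fun n => h _) (tendsto_pi_nhds.2 fun y => ?_)
  exact HasOuterApproxClosed.tendsto_lintegral_apprSeq hF (m y)

/-- The weak topology is Polish. The evaluations on a countable generating algebra form an injective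
Borel map, so by Lusin–Souslin the σ-algebra that they generate is the whole Borel σ-algebra. -/
theorem standardBorel_probabilityMeasure_compact (K : Type*) [TopologicalSpace K] [CompactSpace K]
    [MetrizableSpace K] [SecondCountableTopology K] [MeasurableSpace K] [BorelSpace K] :
    StandardBorelSpace (ProbabilityMeasure K) := by
  have : SecondCountableTopology (ProbabilityMeasure K) := by
    let := metrizableSpaceMetric (ProbabilityMeasure K)
    infer_instance
  have hpol : PolishSpace (ProbabilityMeasure K) := by
    let := metrizableSpaceMetric (ProbabilityMeasure K)
    infer_instance
  obtain ⟨A, hA, hgen⟩ := exists_countable_setAlgebra K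
  have hmeas : Measurable[borel (ProbabilityMeasure K)]
      (fun m : ProbabilityMeasure K => (m : Measure K)) := by
    let : MeasurableSpace (ProbabilityMeasure K) := borel _
    have : BorelSpace (ProbabilityMeasure K) := ⟨rfl⟩
    refine measurable_lintegral_measure_of_closed fun f => ?_
    have hc : Continuous fun m : ProbabilityMeasure K =>
        m.toFiniteMeasure.testAgainstNN f :=
      (FiniteMeasure.continuous_testAgainstNN_eval f).comp
        ProbabilityMeasure.toFiniteMeasure_continuous
    have hc' := (ENNReal.continuous_coe.comp hc).measurable
    convert! hc' using 2 with m
    simp only [Function.comp_apply, FiniteMeasure.testAgainstNN_coe_eq]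
    rfl
  let e : ProbabilityMeasure K → ℕ → ENNReal := fun m n => (m : Measure K) (A n)
  have hAm : ∀ n, MeasurableSet (A n) := fun n => by
    rw [hgen]; exact MeasurableSpace.measurableSet_generateFrom (mem_range_self n)
  have hinj : Function.Injective e := by
    intro m m' h
    refine Subtype.ext (?_ : (m : Measure K) = (m' : Measure K))
    have : IsProbabilityMeasure (m : Measure K) := m.2
    have : IsProbabilityMeasure (m' : Measure K) := m'.2
    refine ext_of_generate_finite (range A) hgen
      (fun s hs t ht _ => hA.inter_mem hs ht) ?_
      (by rw [measure_univ (μ := (m : Measure K)), measure_univ (μ := (m' : Measure K))])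
    rintro _ ⟨n, rfl⟩
    exact congrFun h n
  have heq : (inferInstance : MeasurableSpace (ProbabilityMeasure K)) = borel _ := by
    apply le_antisymm
    · exact hmeas.comap_le
    · have hm : Measurable[borel (ProbabilityMeasure K)] e :=
        @measurable_pi_lambda _ _ _ (borel _) _ _ fun n =>
          (Measure.measurable_coe (hAm n)).comp hmeas
      have hsb : @StandardBorelSpace (ProbabilityMeasure K) (borel _) :=
        @StandardBorelSpace.mk _ (borel _)
          ⟨inferInstance, @BorelSpace.mk _ _ (borel _) rfl, hpol⟩
      have hemb := @Measurable.measurableEmbedding _ _ _ _ _ (borel (ProbabilityMeasure K)) hsb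
        hm hinj
      have he : Measurable e := measurable_pi_iff.2 fun n =>
        (Measure.measurable_coe (hAm n)).comp measurable_subtype_coe
      exact (@MeasurableEmbedding.comap_eq _ _ (borel _) _ e hemb).ge.trans he.comap_le
  exact ⟨⟨inferInstance, ⟨heq⟩, hpol⟩⟩

theorem exists_measurableEmbedding_cantor (T : Type*) [MeasurableSpace T] [StandardBorelSpace T] :
    ∃ e : T → (ℕ → Bool), MeasurableEmbedding e := by
  obtain ⟨e, he, hinj⟩ := MeasurableSpace.measurable_injection_nat_bool_of_countablySeparated T
  exact ⟨e, he.measurableEmbedding hinj⟩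

/-- Relative metric ergodicity only admits standard Borel targets, and spaces of measures will serve
as such. A Borel embedding `e` into the Cantor space identifies the measures on `T` with those
carried by `range e`, which is a measurable condition. -/
instance standardBorel_probabilityMeasure (T : Type*) [MeasurableSpace T] [StandardBorelSpace T] :
    StandardBorelSpace (ProbabilityMeasure T) := by
  classical
  obtain ⟨e, he⟩ := exists_measurableEmbedding_cantor T
  have := standardBorel_probabilityMeasure_compact (ℕ → Bool)
  rcases isEmpty_or_nonempty (ProbabilityMeasure T) with hemp | ⟨⟨m₀⟩⟩
  · infer_instance
  let F : ProbabilityMeasure T → ProbabilityMeasure (ℕ → Bool) := fun m =>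
    m.map he.measurable.aemeasurable
  have hFm : Measurable F :=
    Measurable.subtype_mk ((Measure.measurable_map _ he.measurable).comp measurable_subtype_coe)
  let R : Set (ProbabilityMeasure (ℕ → Bool)) := {m | (m : Measure (ℕ → Bool)) (range e) = 1}
  have hR : MeasurableSet R :=
    ((Measure.measurable_coe he.measurableSet_range).comp measurable_subtype_coe)
      (measurableSet_singleton 1)
  have hprob : ∀ m : R, IsProbabilityMeasure ((m : Measure (ℕ → Bool)).comap e) := fun m => ⟨by
    rw [he.comap_apply, image_univ]; exact m.2⟩
  let G : R → ProbabilityMeasure T := fun m => ⟨(m : Measure (ℕ → Bool)).comap e, hprob m⟩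
  have hGm : Measurable G := by
    refine Measurable.subtype_mk (Measure.measurable_of_measurable_coe _ fun s hs => ?_)
    simp_rw [he.comap_apply]
    exact (Measure.measurable_coe (he.measurableSet_image.2 hs)).comp
      (measurable_subtype_coe.comp measurable_subtype_coe)
  have hFR : ∀ m, F m ∈ R := fun m => by
    have : IsProbabilityMeasure (m : Measure T) := m.2
    change ((m : Measure T).map e) (range e) = 1
    rw [he.map_apply, preimage_range, measure_univ]
  have hGF : ∀ m, G ⟨F m, hFR m⟩ = m := fun m => by
    apply Subtype.ext
    exact he.comap_map (m : Measure T)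
  have hFG : ∀ m : R, F (G m) = m := fun m => by
    apply Subtype.ext
    change ((m : Measure (ℕ → Bool)).comap e).map e = (m : Measure (ℕ → Bool))
    have : IsProbabilityMeasure (m : Measure (ℕ → Bool)) := m.1.2
    rw [he.map_comap, Measure.restrict_eq_self_of_ae_mem]
    have := (prob_compl_eq_zero_iff he.measurableSet_range).2 m.2
    exact this
  have hrange : range F = R := Subset.antisymm (by rintro _ ⟨m, rfl⟩; exact hFR m)
    fun m hm => ⟨G ⟨m, hm⟩, hFG ⟨m, hm⟩⟩
  have hemb : MeasurableEmbedding (fun m => (⟨F m, hFR m⟩ : R)) :=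
    MeasurableEmbedding.of_measurable_inverse hFm.subtype_mk
      (by
        have : range (fun m => (⟨F m, hFR m⟩ : R)) = univ :=
          range_eq_univ.2 fun m => ⟨G m, Subtype.ext (hFG m)⟩
        rw [this]; exact MeasurableSet.univ) hGm hGF
  have := hR.standardBorel
  exact standardBorel_of_measurableEmbedding hemb

end StandardBorel
end Dendro

namespace Dendro

/-! ### Relative ergodicity for measurable fields with countable fibers -/

section Fields

open Set

/-- Measurable cocycle actions of `Γ` over `(Ω, μ)` on a measurable space `T`. -/
structure FiberAction (Γ Ω : Type u) [Group Γ] [MeasurableSpace Ω] [MulAction Γ Ω] (μ : Measure Ω)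
    (T : Type u) [MeasurableSpace T] where
  /-- The action on the fibers. -/
  act : Γ → Ω → T → T
  measurable_act : ∀ γ, Measurable fun p : Ω × T => act γ p.1 p.2
  act_one : ∀ᵐ s ∂μ, ∀ t, act 1 s t = t
  act_mul : ∀ γ₁ γ₂, ∀ᵐ s ∂μ, ∀ t, act (γ₁ * γ₂) s t = act γ₁ (γ₂ • s) (act γ₂ s t)

variable {Γ Ω : Type u} [Group Γ] [MeasurableSpace Ω] [MulAction Γ Ω] [MeasurableConstSMul Γ Ω]
  {μ : Measure Ω} [IsProbabilityMeasure μ] [SMulInvariantMeasure Γ Ω μ]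
  {T : Type u} [MeasurableSpace T]

namespace FiberAction

/-- The skew product transformations. -/
def skew (τ : FiberAction Γ Ω μ T) (γ : Γ) (p : Ω × T) : Ω × T := (γ • p.1, τ.act γ p.1 p.2)

theorem measurable_skew (τ : FiberAction Γ Ω μ T) (γ : Γ) : Measurable (τ.skew γ) :=
  (measurable_fst.const_smul γ).prodMk (τ.measurable_act γ)

/-- Probability measures on `Ω × T` projecting to `μ`. -/
def MargProb (_τ : FiberAction Γ Ω μ T) : Type u :=
  {m : ProbabilityMeasure (Ω × T) // (m : Measure (Ω × T)).fst = μ}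

variable {τ : FiberAction Γ Ω μ T}

/-- The measure underlying an element of `MargProb`. -/
def MargProb.toMeasure (m : MargProb τ) : Measure (Ω × T) := (m.1 : Measure (Ω × T))

instance (m : MargProb τ) : IsProbabilityMeasure m.toMeasure := m.1.2

theorem MargProb.fst_eq (m : MargProb τ) : m.toMeasure.fst = μ := m.2

/-- Constructor for `MargProb`. -/
def MargProb.mk (τ : FiberAction Γ Ω μ T) (m : Measure (Ω × T)) (hm : m.fst = μ) : MargProb τ :=
  ⟨⟨m, ⟨by rw [← Measure.fst_univ, hm, measure_univ]⟩⟩, hm⟩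

theorem MargProb.ext {m m' : MargProb τ} (h : m.toMeasure = m'.toMeasure) : m = m' :=
  Subtype.ext (Subtype.ext h)

instance : MeasurableSpace (MargProb τ) := inferInstanceAs (MeasurableSpace (Subtype _))

theorem MargProb.measurable_toMeasure : Measurable (MargProb.toMeasure (τ := τ)) :=
  measurable_subtype_coe.comp measurable_subtype_coe

theorem MargProb.measurable_mk {Y : Type*} [MeasurableSpace Y] {m : Y → Measure (Ω × T)}
    (hm : Measurable m) (h : ∀ y, (m y).fst = μ) : Measurable fun y => MargProb.mk τ (m y) (h y) :=
  Measurable.subtype_mk (Measurable.subtype_mk hm)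

instance [StandardBorelSpace Ω] [StandardBorelSpace T] : StandardBorelSpace (MargProb τ) := by
  refine MeasurableSet.standardBorel (α := ProbabilityMeasure (Ω × T))
    (s := {m | (m : Measure (Ω × T)).fst = μ}) ?_
  obtain ⟨A, hA, hgen⟩ := exists_countable_setAlgebra Ω
  have hAm : ∀ n, MeasurableSet (A n) := fun n => by
    rw [hgen]; exact MeasurableSpace.measurableSet_generateFrom (mem_range_self n)
  have : {m : ProbabilityMeasure (Ω × T) | (m : Measure (Ω × T)).fst = μ} =
      ⋂ n, {m : ProbabilityMeasure (Ω × T) | (m : Measure (Ω × T)).fst (A n) = μ (A n)} := by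
    ext m
    simp only [mem_ofPred_eq, mem_iInter]
    refine ⟨fun h n => by rw [h], fun h => ?_⟩
    have : IsProbabilityMeasure (m : Measure (Ω × T)) := m.2
    refine ext_of_generate_finite (range A) hgen
      (fun s hs t ht _ => hA.inter_mem hs ht) ?_ (by simp)
    rintro _ ⟨n, rfl⟩
    exact h n
  rw [this]
  refine MeasurableSet.iInter fun n => ?_
  have hm : Measurable fun m : ProbabilityMeasure (Ω × T) => (m : Measure (Ω × T)).fst (A n) :=
    (Measure.measurable_coe (hAm n)).comp
      ((Measure.measurable_map _ measurable_fst).comp measurable_subtype_coe)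
  exact hm (measurableSet_singleton _)

theorem MargProb.ae_of_ae (m : MargProb τ) {p : Ω → Prop} (h : ∀ᵐ s ∂μ, p s) :
    ∀ᵐ q ∂m.toMeasure, p q.1 := by
  rw [← m.fst_eq] at h
  exact ae_of_ae_map measurable_fst.aemeasurable h

theorem fst_map_skew (γ : Γ) (m : MargProb τ) : (m.toMeasure.map (τ.skew γ)).fst = μ := by
  rw [Measure.fst, Measure.map_map measurable_fst (τ.measurable_skew γ)]
  have : Prod.fst ∘ τ.skew γ = (fun s => γ • s) ∘ Prod.fst := rfl
  rw [this, ← Measure.map_map (measurable_const_smul γ) measurable_fst]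
  change (m.toMeasure.fst).map _ = μ
  rw [m.fst_eq]
  exact (measurePreserving_smul γ μ).map_eq

/-- The cocycle identities hold for almost every `s` only, but a measure with marginal `μ` does not
see the exceptional sets. The result is a genuine action, as metric ergodicity requires. -/
noncomputable instance : MulAction Γ (MargProb τ) where
  smul γ m := MargProb.mk τ (m.toMeasure.map (τ.skew γ)) (fst_map_skew γ m)
  one_smul m := by
    apply MargProb.ext
    change m.toMeasure.map (τ.skew 1) = m.toMeasure
    conv_rhs => rw [← Measure.map_id (μ := m.toMeasure)]
    refine Measure.map_congr ?_
    filter_upwards [m.ae_of_ae τ.act_one] with p hp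
    simp [skew, hp]
  mul_smul γ₁ γ₂ m := by
    apply MargProb.ext
    change m.toMeasure.map (τ.skew (γ₁ * γ₂)) = (m.toMeasure.map (τ.skew γ₂)).map (τ.skew γ₁)
    rw [Measure.map_map (τ.measurable_skew _) (τ.measurable_skew _)]
    refine Measure.map_congr ?_
    filter_upwards [m.ae_of_ae (τ.act_mul γ₁ γ₂)] with p hp
    simp [skew, hp, mul_smul]

theorem MargProb.toMeasure_smul (γ : Γ) (m : MargProb τ) :
    (γ • m).toMeasure = m.toMeasure.map (τ.skew γ) := rfl

instance : MeasurableConstSMul Γ (MargProb τ) where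
  measurable_const_smul γ := MargProb.measurable_mk
    ((Measure.measurable_map _ (τ.measurable_skew γ)).comp MargProb.measurable_toMeasure) _

/-- Total variation distance. -/
noncomputable def MargProb.tv (m m' : MargProb τ) : ℝ :=
  ⨆ A : {A : Set (Ω × T) // MeasurableSet A}, |m.toMeasure.real A - m'.toMeasure.real A|

theorem abs_real_sub_le_one {S : Type*} [MeasurableSpace S] (m m' : Measure S)
    [IsProbabilityMeasure m] [IsProbabilityMeasure m'] (A : Set S) :
    |m.real A - m'.real A| ≤ 1 := by
  have h1 : m.real A ≤ 1 := measureReal_le_one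
  have h2 : m'.real A ≤ 1 := measureReal_le_one
  have h3 : 0 ≤ m.real A := measureReal_nonneg
  have h4 : 0 ≤ m'.real A := measureReal_nonneg
  rw [abs_le]; constructor <;> linarith

theorem MargProb.le_tv (m m' : MargProb τ) {A : Set (Ω × T)} (hA : MeasurableSet A) :
    |m.toMeasure.real A - m'.toMeasure.real A| ≤ m.tv m' :=
  le_ciSup (f := fun A : {A : Set (Ω × T) // MeasurableSet A} =>
    |m.toMeasure.real A - m'.toMeasure.real A|)
    ⟨1, by rintro _ ⟨A, rfl⟩; exact abs_real_sub_le_one _ _ _⟩ ⟨A, hA⟩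

theorem MargProb.tv_le {m m' : MargProb τ} {r : ℝ}
    (h : ∀ A : Set (Ω × T), MeasurableSet A → |m.toMeasure.real A - m'.toMeasure.real A| ≤ r) :
    m.tv m' ≤ r := by
  have : Nonempty {A : Set (Ω × T) // MeasurableSet A} := ⟨⟨∅, MeasurableSet.empty⟩⟩
  exact ciSup_le fun A => h A A.2

theorem MargProb.tv_nonneg (m m' : MargProb τ) : 0 ≤ m.tv m' :=
  (abs_nonneg _).trans (m.le_tv m' MeasurableSet.empty)

theorem MargProb.tv_eq_zero_iff (m m' : MargProb τ) : m.tv m' = 0 ↔ m = m' := by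
  constructor
  · intro h
    apply MargProb.ext
    ext A hA
    have := m.le_tv m' hA
    rw [h] at this
    have := sub_eq_zero.1 (abs_nonpos_iff.1 this)
    exact (measureReal_eq_measureReal_iff).1 this
  · rintro rfl
    exact le_antisymm (MargProb.tv_le fun A _ => by simp) (MargProb.tv_nonneg _ _)

theorem MargProb.tv_symm (m m' : MargProb τ) : m.tv m' = m'.tv m := by
  simp only [MargProb.tv, abs_sub_comm]

theorem MargProb.tv_triangle (m m' m'' : MargProb τ) : m.tv m'' ≤ m.tv m' + m'.tv m'' :=
  MargProb.tv_le fun _ hA =>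
    (abs_sub_le _ _ _).trans (add_le_add (m.le_tv m' hA) (m'.le_tv m'' hA))

theorem MargProb.tv_smul_le (γ : Γ) (m m' : MargProb τ) : (γ • m).tv (γ • m') ≤ m.tv m' := by
  refine MargProb.tv_le fun A hA => ?_
  simp only [MargProb.toMeasure_smul, Measure.real, Measure.map_apply (τ.measurable_skew γ) hA]
  exact m.le_tv m' (τ.measurable_skew γ hA)

theorem MargProb.tv_smul (γ : Γ) (m m' : MargProb τ) : (γ • m).tv (γ • m') = m.tv m' := by
  refine le_antisymm (MargProb.tv_smul_le γ m m') ?_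
  simpa using MargProb.tv_smul_le γ⁻¹ (γ • m) (γ • m')

/-- A countable generating algebra is dense for the measure `m + m'`, so the supremum may be taken
over it. -/
theorem MargProb.measurable_tv [StandardBorelSpace Ω] [StandardBorelSpace T] :
    Measurable fun p : MargProb τ × MargProb τ => p.1.tv p.2 := by
  obtain ⟨A, hA, hgen⟩ := exists_countable_setAlgebra (Ω × T)
  have hAm : ∀ n, MeasurableSet (A n) := fun n => by
    rw [hgen]; exact MeasurableSpace.measurableSet_generateFrom (mem_range_self n)
  have heq : (fun p : MargProb τ × MargProb τ => p.1.tv p.2) = fun p =>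
      ⨆ n, |p.1.toMeasure.real (A n) - p.2.toMeasure.real (A n)| := by
    ext ⟨m, m'⟩
    have hbdd : BddAbove (range fun n => |m.toMeasure.real (A n) - m'.toMeasure.real (A n)|) :=
      ⟨1, by rintro _ ⟨n, rfl⟩; exact abs_real_sub_le_one _ _ _⟩
    refine le_antisymm (MargProb.tv_le fun S hS => ?_) (ciSup_le fun n => m.le_tv m' (hAm n))
    refine le_of_forall_pos_le_add fun ε hε => ?_
    have hd := Measure.MeasureDense.of_generateFrom_isSetAlgebra_finite
      (m.toMeasure + m'.toMeasure) hA hgen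
    obtain ⟨_, ⟨n, rfl⟩, hn⟩ := hd.approx S hS (measure_ne_top _ _) (ε / 2) (half_pos hε)
    have key : ∀ q : Measure (Ω × T), IsFiniteMeasure q → q ≤ m.toMeasure + m'.toMeasure →
        |q.real S - q.real (A n)| ≤ ε / 2 := by
      intro q _ hq
      refine (abs_measureReal_sub_le_measureReal_symmDiff hS.nullMeasurableSet
        (hAm n).nullMeasurableSet).trans ?_
      exact ENNReal.toReal_le_of_le_ofReal (half_pos hε).le ((hq _).trans hn.le)
    have h1 := key m.toMeasure inferInstance (Measure.le_add_right le_rfl)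
    have h2 := key m'.toMeasure inferInstance (Measure.le_add_left le_rfl)
    have h3 := le_ciSup hbdd n
    rw [abs_le] at h1 h2 ⊢
    have h4 := abs_le.1 h3
    constructor <;> linarith [h1.1, h1.2, h2.1, h2.2, h4.1, h4.2]
  rw [heq]
  refine Measurable.iSup fun n => ?_
  refine Measurable.abs (Measurable.sub ?_ ?_)
  · exact ENNReal.measurable_toReal.comp ((Measure.measurable_coe (hAm n)).comp
      (MargProb.measurable_toMeasure.comp measurable_fst))
  · exact ENNReal.measurable_toReal.comp ((Measure.measurable_coe (hAm n)).comp
      (MargProb.measurable_toMeasure.comp measurable_snd))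

/-! ### Total variation along projections with countable fibers -/

section Projection

variable {Z W : Type u} [MeasurableSpace Z] [MeasurableSpace W] {τZ : FiberAction Γ Ω μ Z}
  {τW : FiberAction Γ Ω μ W}

theorem fst_map_prodMap {π : W → Z} (hπ : Measurable π) (m : MargProb τW) :
    (m.toMeasure.map (Prod.map id π)).fst = μ := by
  rw [Measure.fst, Measure.map_map measurable_fst (measurable_id.prodMap hπ)]
  exact m.fst_eq

/-- The projection induced by a measurable map. -/
noncomputable def MargProb.proj (τZ : FiberAction Γ Ω μ Z) {π : W → Z} (hπ : Measurable π)
    (m : MargProb τW) : MargProb τZ :=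
  MargProb.mk τZ (m.toMeasure.map (Prod.map id π)) (fst_map_prodMap hπ m)

/-- Total variation is not separable in general. Here `(s, π w, c w)` determines `(s, w)`, and all
measures over `v` become absolutely continuous with respect to the product of `v` and counting
measure. Their densities lie in a separable `L¹` space whose distance dominates total variation. -/
theorem MargProb.separable_fiber [StandardBorelSpace Ω] [StandardBorelSpace W]
    [StandardBorelSpace Z] {π : W → Z} (hπ : Measurable π) {c : W → ℕ} (hc : Measurable c)
    (hinj : ∀ w w', π w = π w' → c w = c w' → w = w') (v : MargProb τZ) :
    ∃ S : Set (MargProb τW), S.Countable ∧ S ⊆ MargProb.proj τZ hπ ⁻¹' {v} ∧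
      ∀ m ∈ MargProb.proj τZ hπ ⁻¹' {v}, ∀ ε > 0, ∃ m' ∈ S, m.tv m' < ε := by
  let j : Ω × W → (Ω × Z) × ℕ := fun p => ((p.1, π p.2), c p.2)
  have hj : MeasurableEmbedding j := by
    refine Measurable.measurableEmbedding ?_ ?_
    · exact (measurable_fst.prodMk (hπ.comp measurable_snd)).prodMk (hc.comp measurable_snd)
    · rintro ⟨s, w⟩ ⟨s', w'⟩ h
      simp only [j, Prod.mk.injEq] at h
      exact Prod.ext h.1.1 (hinj _ _ h.1.2 h.2)
  let ρ : Measure ((Ω × Z) × ℕ) := v.toMeasure.prod Measure.count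
  have hac : ∀ m : MargProb τW, MargProb.proj τZ hπ m = v → m.toMeasure.map j ≪ ρ := by
    intro m hm
    refine Measure.AbsolutelyContinuous.mk fun N hN hN0 => ?_
    -- Counting measure charges every point, so almost all slices of `N` are empty.
    rw [Measure.measure_prod_null hN] at hN0
    have hv : v.toMeasure = m.toMeasure.map (Prod.map id π) := by rw [← hm]; rfl
    rw [hv] at hN0
    rw [hj.map_apply]
    refine measure_eq_zero_iff_ae_notMem.2 ?_
    filter_upwards [ae_of_ae_map (measurable_id.prodMap hπ).aemeasurable hN0] with p hp hpN
    have : c p.2 ∈ (Prod.mk (Prod.map id π p) ⁻¹' N : Set ℕ) := hpN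
    rw [Measure.count_eq_zero_iff.1 hp] at this
    exact this
  let h : MargProb τW → ((Ω × Z) × ℕ) → ℝ := fun m x => ((m.toMeasure.map j).rnDeriv ρ x).toReal
  have hint : ∀ m, Integrable (h m) ρ := fun m => Measure.integrable_toReal_rnDeriv
  let L : MargProb τW → Lp ℝ 1 ρ := fun m => (hint m).toL1 (h m)
  have hL : ∀ m m' : MargProb τW, MargProb.proj τZ hπ m = v → MargProb.proj τZ hπ m' = v →
      m.tv m' ≤ dist (L m) (L m') := by
    intro m m' hm hm'
    refine MargProb.tv_le fun A hA => ?_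
    have hreal : ∀ q : MargProb τW, MargProb.proj τZ hπ q = v →
        q.toMeasure.real A = ∫ x in j '' A, h q x ∂ρ := by
      intro q hq
      have hp : IsProbabilityMeasure (q.toMeasure.map j) :=
        Measure.isProbabilityMeasure_map hj.measurable.aemeasurable
      rw [Measure.setIntegral_toReal_rnDeriv (hac q hq), Measure.real, Measure.real, hj.map_apply,
        hj.injective.preimage_image]
    rw [hreal m hm, hreal m' hm', ← integral_sub (hint m).integrableOn (hint m').integrableOn,
      dist_eq_norm, ← Integrable.toL1_sub, L1.norm_of_fun_eq_integral_norm]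
    rw [← Real.norm_eq_abs]
    refine (norm_integral_le_integral_norm _).trans ?_
    exact setIntegral_le_integral ((hint m).sub (hint m')).norm
      (Filter.Eventually.of_forall fun x => norm_nonneg _)
  let R := MargProb.proj (τW := τW) τZ hπ ⁻¹' {v}
  have : Fact ((1 : ENNReal) ≠ ⊤) := ⟨ENNReal.one_ne_top⟩
  obtain ⟨D, hDR, hDc, hD⟩ := (IsSeparable.of_separableSpace (L '' R)).exists_countable_dense_subset
  have hch : ∀ x : D, ∃ m ∈ R, L m = x := fun x => hDR x.2
  choose r hrR hrL using hch
  have := hDc.to_subtype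
  refine ⟨range r, countable_range r, by rintro _ ⟨x, rfl⟩; exact hrR x, fun m hm ε hε => ?_⟩
  obtain ⟨x, hxD, hx⟩ := Metric.mem_closure_iff.1 (hD ⟨m, hm, rfl⟩) ε hε
  exact ⟨r ⟨x, hxD⟩, ⟨_, rfl⟩, (hL m _ hm (hrR _)).trans_lt (by rwa [hrL])⟩

theorem MargProb.isFiberwiseIsometric [StandardBorelSpace Ω] [StandardBorelSpace W]
    [StandardBorelSpace Z] {π : W → Z} (hπ : Measurable π) {c : W → ℕ} (hc : Measurable c)
    (hinj : ∀ w w', π w = π w' → c w = c w' → w = w')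
    (hequiv : ∀ γ, ∀ᵐ s ∂μ, ∀ w, π (τW.act γ s w) = τZ.act γ s (π w)) :
    IsFiberwiseIsometric Γ (MargProb.proj (τW := τW) τZ hπ) MargProb.tv where
  measurable := MargProb.measurable_tv.comp measurable_subtype_coe
  nonneg _ _ _ := MargProb.tv_nonneg _ _
  eq_zero_iff _ _ _ := MargProb.tv_eq_zero_iff _ _
  symm _ _ _ := MargProb.tv_symm _ _
  triangle _ _ _ _ _ := MargProb.tv_triangle _ _ _
  separable := MargProb.separable_fiber hπ hc hinj
  measurable_proj := MargProb.measurable_mk ((Measure.measurable_map _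
    (measurable_id.prodMap hπ)).comp MargProb.measurable_toMeasure) _
  equivariant_proj γ m := by
    apply MargProb.ext
    change (m.toMeasure.map (τW.skew γ)).map (Prod.map id π) =
      (m.toMeasure.map (Prod.map id π)).map (τZ.skew γ)
    rw [Measure.map_map (measurable_id.prodMap hπ) (τW.measurable_skew γ),
      Measure.map_map (τZ.measurable_skew γ) (measurable_id.prodMap hπ)]
    refine Measure.map_congr ?_
    filter_upwards [m.ae_of_ae (hequiv γ)] with p hp
    simp [skew, hp]
  isometric γ m m' _ := MargProb.tv_smul γ m m'

end Projection

/-! ### Measures carried by graphs -/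

theorem measurable_graphMap {f : Ω → T} (hf : Measurable f) : Measurable fun s => (s, f s) :=
  measurable_id.prodMk hf

/-- The measure carried by the graph of a measurable map. -/
noncomputable def graph (τ : FiberAction Γ Ω μ T) {f : Ω → T} (hf : Measurable f) : MargProb τ :=
  MargProb.mk τ (μ.map fun s => (s, f s)) (by
    rw [Measure.fst, Measure.map_map measurable_fst (measurable_graphMap hf)]
    exact Measure.map_id)

theorem ae_eq_of_graph_eq [StandardBorelSpace T] {f g : Ω → T} (hf : Measurable f)
    (hg : Measurable g) (h : τ.graph hf = τ.graph hg) : ∀ᵐ s ∂μ, f s = g s := by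
  have hm := congrArg MargProb.toMeasure h
  change μ.map (fun s => (s, f s)) = μ.map (fun s => (s, g s)) at hm
  have hset : MeasurableSet {p : Ω × T | p.2 = g p.1} :=
    measurableSet_eq_fun measurable_snd (hg.comp measurable_fst)
  have h1 : ∀ᵐ p ∂(μ.map (fun s => (s, g s))), p.2 = g p.1 :=
    (ae_map_iff (measurable_graphMap hg).aemeasurable hset).2 (by simp)
  rw [← hm] at h1
  exact (ae_map_iff (measurable_graphMap hf).aemeasurable hset).1 h1

theorem smul_graph (γ : Γ) {f g : Ω → T} (hf : Measurable f) (hg : Measurable g)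
    (h : ∀ᵐ s ∂μ, g (γ • s) = τ.act γ s (f s)) : γ • τ.graph hf = τ.graph hg := by
  apply MargProb.ext
  change (μ.map fun s => (s, f s)).map (τ.skew γ) = μ.map fun s => (s, g s)
  rw [Measure.map_map (τ.measurable_skew γ) (measurable_graphMap hf)]
  conv_rhs => rw [← (measurePreserving_smul γ μ).map_eq]
  rw [Measure.map_map (measurable_graphMap hg) (measurable_const_smul γ)]
  refine Measure.map_congr ?_
  filter_upwards [h] with s hs
  simp [skew, hs]

theorem measurable_graph {Y : Type*} [MeasurableSpace Y] {f : Y × Ω → T} (hf : Measurable f) :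
    Measurable fun y => τ.graph (f := fun s => f (y, s)) (hf.comp measurable_prodMk_left) := by
  refine MargProb.measurable_mk (Measure.measurable_of_measurable_coe _ fun A hA => ?_) _
  have hm : Measurable fun p : Y × Ω => (p.2, f p) := measurable_snd.prodMk hf
  have : (fun y => (μ.map fun s => (s, f (y, s))) A) =
      fun y => μ (Prod.mk y ⁻¹' ((fun p : Y × Ω => (p.2, f p)) ⁻¹' A)) := by
    ext y
    rw [Measure.map_apply (measurable_graphMap (f := fun s => f (y, s))
      (hf.comp measurable_prodMk_left)) hA]
    rfl
  rw [this]
  exact measurable_measure_prodMk_left (hm hA)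

/-- Passing to graph measures turns the fields `f` and `g` into maps to `Γ`-spaces, so relative
metric ergodicity applies with the total variation metric. Only the factorization of the graph of `f
(y, ·)` through `q` is retained. -/
theorem graph_factors [StandardBorelSpace Ω] {Y Z₀ Z W : Type u} [MeasurableSpace Y]
    [MeasurableSpace Z₀] [MulAction Γ Y] [MulAction Γ Z₀] {η : Measure Y} {ζ : Measure Z₀}
    [SFinite η] [SFinite ζ] {q : Y → Z₀} (hq : IsRelativelyMetricallyErgodic Γ η ζ q)
    [MeasurableSpace Z] [MeasurableSpace W] [StandardBorelSpace Z] [StandardBorelSpace W]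
    (τZ : FiberAction Γ Ω μ Z) (τW : FiberAction Γ Ω μ W) {π : W → Z} (hπ : Measurable π)
    {c : W → ℕ} (hc : Measurable c) (hinj : ∀ w w', π w = π w' → c w = c w' → w = w')
    (hequiv : ∀ γ, ∀ᵐ s ∂μ, ∀ w, π (τW.act γ s w) = τZ.act γ s (π w))
    {f : Y × Ω → W} (hf : Measurable f)
    (hfe : ∀ γ : Γ, ∀ᵐ y ∂η, ∀ᵐ s ∂μ, f (γ • y, γ • s) = τW.act γ s (f (y, s)))
    {g : Z₀ × Ω → Z} (hg : Measurable g)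
    (hge : ∀ γ : Γ, ∀ᵐ z ∂ζ, ∀ᵐ s ∂μ, g (γ • z, γ • s) = τZ.act γ s (g (z, s)))
    (hfg : ∀ᵐ y ∂η, ∀ᵐ s ∂μ, π (f (y, s)) = g (q y, s)) :
    ∃ ψ : Z₀ → MargProb τW, ∀ᵐ y ∂η,
      ψ (q y) = τW.graph (f := fun s => f (y, s)) (hf.comp measurable_prodMk_left) := by
  obtain ⟨ψ, -, -, hψ, -⟩ := hq (MargProb τW) (MargProb τZ) (MargProb.proj τZ hπ) MargProb.tv
    (fun y => τW.graph (f := fun s => f (y, s)) (hf.comp measurable_prodMk_left))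
    (fun z => τZ.graph (f := fun s => g (z, s)) (hg.comp measurable_prodMk_left))
    (MargProb.isFiberwiseIsometric hπ hc hinj hequiv) (measurable_graph hf)
    (fun γ => by
      filter_upwards [hfe γ] with y hy
      exact (smul_graph γ _ _ hy).symm)
    (measurable_graph hg)
    (fun γ => by
      filter_upwards [hge γ] with y hy
      exact (smul_graph γ _ _ hy).symm)
    (by
      filter_upwards [hfg] with y hy
      apply MargProb.ext
      change (μ.map fun s => (s, f (y, s))).map (Prod.map id π) = μ.map fun s => (s, g (q y, s))
      rw [Measure.map_map (measurable_id.prodMap hπ)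
        (measurable_graphMap (f := fun s => f (y, s)) (hf.comp measurable_prodMk_left))]
      refine Measure.map_congr ?_
      filter_upwards [hy] with s hs
      simp [hs])
  exact ⟨ψ, hψ⟩

end FiberAction

end Fields
end Dendro

namespace Dendro

/-! ### Ergodicity of the products of a boundary with `Ω` -/

section Ergodicity

open Set

variable {Γ Ω B : Type u} [Group Γ] [Countable Γ]
  [MeasurableSpace Ω] [StandardBorelSpace Ω] [MulAction Γ Ω] [MeasurableConstSMul Γ Ω]
  {μ : Measure Ω} [IsProbabilityMeasure μ] [ErgodicSMul Γ Ω μ]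
  [MeasurableSpace B] [StandardBorelSpace B] [MulAction Γ B] [MeasurableConstSMul Γ B]
  {ν : Measure B} [SigmaFinite ν] [NeZero ν]

theorem ae_smul_iff {Y : Type*} [MeasurableSpace Y] [MulAction Γ Y] {η : Measure Y}
    (hη : ∀ γ : Γ, Measure.QuasiMeasurePreserving (fun y : Y => γ • y) η η) (γ : Γ)
    {p : Y → Prop} : (∀ᵐ y ∂η, p (γ • y)) ↔ ∀ᵐ y ∂η, p y := by
  refine ⟨fun h => ?_, fun h => (hη γ).ae h⟩
  filter_upwards [(hη γ⁻¹).ae h] with y hy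
  simpa using hy

theorem ae_prod_swap {Y Z : Type*} [MeasurableSpace Y] [MeasurableSpace Z] {η : Measure Y}
    {ζ : Measure Z} [SFinite η] [SFinite ζ] {p : Y × Z → Prop} (h : ∀ᵐ w ∂(η.prod ζ), p w) :
    ∀ᵐ w ∂(ζ.prod η), p w.swap :=
  Measure.measurePreserving_swap.quasiMeasurePreserving.ae h

theorem quasiMeasurePreserving_smul_omega (γ : Γ) :
    Measure.QuasiMeasurePreserving (fun s : Ω => γ • s) μ μ :=
  (measurePreserving_smul γ μ).quasiMeasurePreserving

theorem quasiMeasurePreserving_smul_prod {Y Z : Type*} [MeasurableSpace Y] [MulAction Γ Y]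
    [MeasurableSpace Z] [MulAction Γ Z] {η : Measure Y} {ζ : Measure Z} [SFinite η] [SFinite ζ]
    (hη : ∀ γ : Γ, Measure.QuasiMeasurePreserving (fun y : Y => γ • y) η η)
    (hζ : ∀ γ : Γ, Measure.QuasiMeasurePreserving (fun z : Z => γ • z) ζ ζ) (γ : Γ) :
    Measure.QuasiMeasurePreserving (fun y : Y × Z => γ • y) (η.prod ζ) (η.prod ζ) := by
  refine ⟨((hη γ).measurable.comp measurable_fst).prodMk
    ((hζ γ).measurable.comp measurable_snd), ?_⟩
  have : (fun y : Y × Z => γ • y) = Prod.map (fun y : Y => γ • y) (fun z : Z => γ • z) := rfl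
  rw [this, ← Measure.map_prod_map η ζ (hη γ).measurable (hζ γ).measurable]
  exact (hη γ).absolutelyContinuous.prod (hζ γ).absolutelyContinuous

/-- The trivial action on the fibers. -/
def trivialAction (Γ : Type u) [Group Γ] [MulAction Γ Ω] (μ : Measure Ω) (T : Type u)
    [MeasurableSpace T] : FiberAction Γ Ω μ T where
  act _ _ t := t
  measurable_act _ := measurable_snd
  act_one := by simp
  act_mul := by simp

/-- The indicator of `A` is a field with two values, so by `graph_factors` its slices depend only on
the first boundary coordinate, and also only on the second, hence on neither. What remains is an
invariant subset of `Ω`. -/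
theorem ergodic_prod (hB : IsBoundary Γ ν) {A : Set ((B × B) × Ω)} (hA : MeasurableSet A)
    (hinv : ∀ γ : Γ, ∀ᵐ y ∂(ν.prod ν), ∀ᵐ s ∂μ, ((γ • y, γ • s) ∈ A ↔ (y, s) ∈ A)) :
    (∀ᵐ y ∂(ν.prod ν), ∀ᵐ s ∂μ, (y, s) ∈ A) ∨ (∀ᵐ y ∂(ν.prod ν), ∀ᵐ s ∂μ, (y, s) ∉ A) := by
  classical
  let f : (B × B) × Ω → ULift.{u} Bool := fun w => ⟨decide (w ∈ A)⟩
  have hfA : ∀ w w', f w = f w' ↔ (w ∈ A ↔ w' ∈ A) := fun w w' => by simp [f]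
  have hf : Measurable f := by
    refine measurable_up.comp (measurable_to_bool ?_)
    convert! hA using 1
    ext w; simp
  let τ := trivialAction Γ μ (ULift.{u} Bool)
  let c : ULift.{u} Bool → ℕ := fun b => b.down.toNat
  have hc : Measurable c := (measurable_of_countable Bool.toNat).comp measurable_down
  have hfac : ∀ q : B × B → B, IsRelativelyMetricallyErgodic Γ (ν.prod ν) ν q →
      ∃ ψ : B → τ.MargProb, ∀ᵐ y ∂(ν.prod ν),
      ψ (q y) = τ.graph (f := fun s => f (y, s)) (hf.comp measurable_prodMk_left) := by
    intro q hq
    refine FiberAction.graph_factors hq (trivialAction Γ μ PUnit.{u + 1}) τ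
      (π := fun _ => PUnit.unit) measurable_const hc ?_ (by simp) hf ?_
      (g := fun _ => PUnit.unit) measurable_const (by simp) (by simp)
    · rintro ⟨w⟩ ⟨w'⟩ - h
      cases w <;> cases w' <;> simp_all [c]
    · intro γ
      filter_upwards [hinv γ] with y hy
      filter_upwards [hy] with s hs
      exact (hfA _ _).2 hs
  obtain ⟨ψ₁, h₁⟩ := hfac Prod.fst hB.ergodic_fst
  obtain ⟨ψ₂, h₂⟩ := hfac Prod.snd hB.ergodic_snd
  have h₁₂ : ∀ᵐ b' ∂ν, ∀ᵐ b ∂ν, ψ₁ b = ψ₂ b' := by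
    have h : ∀ᵐ y ∂(ν.prod ν), ψ₁ y.1 = ψ₂ y.2 := by
      filter_upwards [h₁, h₂] with y h h'
      rw [h, h']
    have h' : ∀ᵐ y ∂(ν.prod ν), ψ₁ y.2 = ψ₂ y.1 := ae_prod_swap h
    exact Measure.ae_ae_of_ae_prod h'
  obtain ⟨b₀, hb₀⟩ := h₁₂.exists
  have hconst : ∀ᵐ y ∂(ν.prod ν), ψ₂ b₀ = τ.graph (f := fun s => f (y, s))
      (hf.comp measurable_prodMk_left) := by
    filter_upwards [h₁, Measure.quasiMeasurePreserving_fst.ae hb₀] with y h h'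
    rw [← h, h']
  have hne : NeZero (ν.prod ν) := ⟨fun h => by
    have := congrArg (fun m : Measure (B × B) => m univ) h
    simp only [← univ_prod_univ, Measure.prod_prod] at this
    simp [NeZero.ne ν] at this⟩
  obtain ⟨y₀, hy₀⟩ := hconst.exists
  have hae : ∀ᵐ y ∂(ν.prod ν), ∀ᵐ s ∂μ, ((y, s) ∈ A ↔ (y₀, s) ∈ A) := by
    filter_upwards [hconst] with y hy
    have := FiberAction.ae_eq_of_graph_eq _ _ (hy.symm.trans hy₀)
    filter_upwards [this] with s hs
    exact (hfA _ _).1 hs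
  let S : Set Ω := {s | (y₀, s) ∈ A}
  have hS : MeasurableSet S := measurable_prodMk_left hA
  -- A point `y` is taken such that both `y` and `γ • y` have almost the same slice as `y₀`;
  -- invariance of `A` at `y` then gives that of `S`.
  have hSinv : ∀ γ : Γ, (γ • ·) ⁻¹' S =ᵐ[μ] S := by
    intro γ
    obtain ⟨y, hy, hy', hy''⟩ := ((hinv γ).and (hae.and
      ((quasiMeasurePreserving_smul_prod hB.quasiInvariant hB.quasiInvariant γ).ae hae))).exists
    rw [Filter.eventuallyEq_set]
    filter_upwards [hy, hy', (quasiMeasurePreserving_smul_omega γ).ae hy''] with s h h' h''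
    exact h''.symm.trans (h.trans h')
  have hconstS := ErgodicSMul.aeconst_of_forall_preimage_smul_ae_eq hS hSinv
  rw [Filter.eventuallyConst_set] at hconstS
  rcases hconstS with h | h
  · left
    filter_upwards [hae] with y hy
    filter_upwards [hy, h] with s h h'
    exact h.2 h'
  · right
    filter_upwards [hae] with y hy
    filter_upwards [hy, h] with s h h' h''
    exact h' (h.1 h'')

theorem ae_omega_ae_boundary {p : B × Ω → Prop} (h : ∀ᵐ w ∂(ν.prod μ), p w) :
    ∀ᵐ s ∂μ, ∀ᵐ b ∂ν, p (b, s) :=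
  Measure.ae_ae_of_ae_prod (ae_prod_swap h)

end Ergodicity

/-! ### Labelling the components of the complement of a compact set -/

section Labels

open Set

attribute [local instance] borelCL borelHomeo

variable {X : Type u} [TopologicalSpace X] [CompactSpace X] [T2Space X] [SecondCountableTopology X]
  [PointSeparated X] [ConnectedSpace X]

variable (X) in
/-- A point of each member of the net. -/
noncomputable def netPt (n : ℕ) : X := (net_nonempty (X := X) n).choose

theorem netPt_mem (n : ℕ) : netPt X n ∈ net X n := (net_nonempty (X := X) n).choose_spec

/-- The label of the component of the complement of `K` which contains `L`. -/
noncomputable def label (K L : Set X) : ℕ := sInf {n | SameSide K {netPt X n} L}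

/-- The connecting continuum may be taken in the net, which makes the condition a countable union of
measurable ones. -/
theorem sameSide_netPt_iff {K L : Set X} (hK : IsClosed K) {n : ℕ} :
    SameSide K {netPt X n} L ↔ ∃ i, netPt X n ∈ net X i ∧ L ⊆ net X i ∧ Disjoint K (net X i) := by
  constructor
  · rintro ⟨D, hD, h1, h2, h3⟩
    obtain ⟨i, hi, hi'⟩ := exists_net hD ⟨_, h1 rfl⟩ hK.isOpen_compl
      (fun a ha => fun haK => Set.disjoint_left.1 h3 haK ha)
    exact ⟨i, hi (h1 rfl), h2.trans hi, Set.disjoint_left.2 fun a ha ha' => hi' ha' ha⟩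
  · rintro ⟨i, h1, h2, h3⟩
    exact ⟨net X i, isSubcontinuum_net i, singleton_subset_iff.2 h1, h2, h3⟩

theorem sameSide_label {K L : Set X} (hK : IsClosed K) (hL : IsSubcontinuum L)
    (hne : L.Nonempty) (h : Disjoint K L) : SameSide K {netPt X (label K L)} L := by
  obtain ⟨i, hi, hi'⟩ := exists_net hL hne hK.isOpen_compl
    (fun a ha => fun haK => Set.disjoint_left.1 h haK ha)
  have : {n | SameSide K {netPt X n} L}.Nonempty :=
    ⟨i, (sameSide_netPt_iff hK).2 ⟨i, netPt_mem i, hi,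
      Set.disjoint_left.2 fun a ha ha' => hi' ha' ha⟩⟩
  exact Nat.sInf_mem this

theorem label_congr {K L L' : Set X} (h : SameSide K L L') (hL : L.Nonempty) (hL' : L'.Nonempty) :
    label K L = label K L' := by
  unfold label
  congr 1
  ext n
  exact ⟨fun hn => hn.trans hL h, fun hn => hn.trans hL' h.symm⟩

theorem measurable_label {Y : Type*} [MeasurableSpace Y] {K L : Y → NonemptyCompacts X}
    (hK : Measurable K) (hL : Measurable L) :
    Measurable fun y => label (K y : Set X) (L y : Set X) := by
  classical
  have hset : ∀ n, MeasurableSet {y | SameSide (K y : Set X) {netPt X n} (L y)} := by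
    intro n
    have : {y | SameSide (K y : Set X) {netPt X n} (L y)} = ⋃ i, ⋃ _ : netPt X n ∈ net X i,
        {y | (L y : Set X) ⊆ net X i} ∩ {y | ((K y : Set X) ∩ net X i).Nonempty}ᶜ := by
      ext y
      simp only [mem_ofPred_eq, sameSide_netPt_iff (K y).isCompact.isClosed, mem_iUnion,
        mem_inter_iff, mem_compl_iff, not_nonempty_iff_eq_empty, disjoint_iff_inter_eq_empty,
        exists_prop]
    rw [this]
    refine MeasurableSet.iUnion fun i => MeasurableSet.iUnion fun _ => ?_
    exact (measurableSet_subset hL (isSubcontinuum_net i).isClosed).inter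
      (measurableSet_inter_nonempty hK (isSubcontinuum_net i).isClosed).compl
  refine measurable_to_countable' fun n => ?_
  -- The last piece accounts for the value `sInf ∅ = 0`, taken when no sample point is on the side
  -- of `L y`.
  have : (fun y => label (K y : Set X) (L y : Set X)) ⁻¹' {n} =
      ({y | SameSide (K y : Set X) {netPt X n} (L y)} ∩
        ⋂ m ∈ Iio n, {y | SameSide (K y : Set X) {netPt X m} (L y)}ᶜ) ∪
      ((⋂ m, {y | SameSide (K y : Set X) {netPt X m} (L y)}ᶜ) ∩ {_y | n = 0}) := by
    ext y
    simp only [mem_preimage, mem_singleton_iff, mem_union, mem_inter_iff, mem_ofPred_eq,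
      mem_iInter, mem_compl_iff, mem_Iio]
    rcases eq_empty_or_nonempty {n | SameSide (K y : Set X) {netPt X n} (L y)} with he | hne
    · have hall : ∀ m, ¬ SameSide (K y : Set X) {netPt X m} (L y) := fun m hm => by
        have : m ∈ ({n | SameSide (K y : Set X) {netPt X n} (L y)} : Set ℕ) := hm
        rw [he] at this; exact this
      simp [label, hall, eq_comm]
    · have hex : ¬ ∀ m, ¬ SameSide (K y : Set X) {netPt X m} (L y) := fun h => by
        obtain ⟨m, hm⟩ := hne; exact h m hm
      simp only [hex, false_and, or_false]
      constructor
      · rintro rfl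
        exact ⟨Nat.sInf_mem hne, fun m hm => Nat.notMem_of_lt_sInf hm⟩
      · rintro ⟨h1, h2⟩
        refine le_antisymm (Nat.sInf_le h1) ?_
        by_contra hlt
        exact h2 _ (not_le.1 hlt) (Nat.sInf_mem hne)
  rw [this]
  refine ((hset n).inter (MeasurableSet.biInter (to_countable _) fun m _ => (hset m).compl)).union
    ((MeasurableSet.iInter fun m => (hset m).compl).inter (MeasurableSet.const _))

variable (X) in
/-- Compact sets together with a label of a component of the complement. -/
def Labelled : Type u :=
  {p : NonemptyCompacts X × ℕ // netPt X p.2 ∉ (p.1 : Set X) ∧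
    label (p.1 : Set X) {netPt X p.2} = p.2}

instance : MeasurableSpace (Labelled X) := inferInstanceAs (MeasurableSpace (Subtype _))

instance : StandardBorelSpace (Labelled X) := by
  refine MeasurableSet.standardBorel (α := NonemptyCompacts X × ℕ) (s := {p | netPt X p.2 ∉
    (p.1 : Set X) ∧ label (p.1 : Set X) {netPt X p.2} = p.2}) ?_
  have hpt : Measurable fun p : NonemptyCompacts X × ℕ => ({netPt X p.2} : NonemptyCompacts X) :=
    (measurable_of_countable fun n : ℕ => ({netPt X n} : NonemptyCompacts X)).comp measurable_snd
  have h1 : MeasurableSet {p : NonemptyCompacts X × ℕ | netPt X p.2 ∉ (p.1 : Set X)} := by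
    convert! measurableSet_disjoint measurable_fst hpt using 1
    ext p; simp
  have h2 := measurable_label (X := X) measurable_fst hpt
  exact h1.inter (measurableSet_eq_fun h2 measurable_snd)

theorem netPt_label_spec {K : Set X} (hK : IsClosed K) {L : Set X} (hL : IsSubcontinuum L)
    (hne : L.Nonempty) (h : Disjoint K L) :
    netPt X (label K L) ∉ K ∧ label K {netPt X (label K L)} = label K L := by
  have hs := sameSide_label hK hL hne h
  refine ⟨fun hmem => ?_, label_congr hs (singleton_nonempty _) hne⟩
  obtain ⟨D, -, h1, -, h3⟩ := hs
  exact Set.disjoint_left.1 h3 hmem (h1 rfl)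

/-- The label of the component of the complement of `K` which contains `L`. -/
noncomputable def Labelled.mk (K L : NonemptyCompacts X) (hL : IsSubcontinuum (L : Set X))
    (h : Disjoint (K : Set X) L) : Labelled X :=
  ⟨(K, label (K : Set X) L), netPt_label_spec K.isCompact.isClosed hL L.nonempty h⟩

theorem disjoint_singleton_image {K : Set X} {x : X} (hx : x ∉ K) (g : X ≃ₜ X) :
    Disjoint (g '' K) {g x} := by
  rw [Set.disjoint_singleton_right]
  rintro ⟨y, hy, hyx⟩
  exact hx (g.injective hyx ▸ hy)

/-- The action of homeomorphisms on labelled compact sets. -/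
noncomputable def Labelled.map (g : X ≃ₜ X) (w : Labelled X) : Labelled X :=
  Labelled.mk (mapCL g w.1.1) {g (netPt X w.1.2)}
    (by simpa using isSubcontinuum_singleton (g (netPt X w.1.2)))
    (by simpa using disjoint_singleton_image w.2.1 g)

/-- Homeomorphisms preserve components, so the sample point stored in a label may be replaced by any
continuum in the same component. -/
theorem Labelled.map_mk (g : X ≃ₜ X) (K L : NonemptyCompacts X) (hL : IsSubcontinuum (L : Set X))
    (h : Disjoint (K : Set X) L) (hL' : IsSubcontinuum (mapCL g L : Set X))
    (h' : Disjoint (mapCL g K : Set X) (mapCL g L : Set X)) :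
    Labelled.map g (Labelled.mk K L hL h) = Labelled.mk (mapCL g K) (mapCL g L) hL' h' := by
  apply Subtype.ext
  refine Prod.ext rfl ?_
  change label (g '' (K : Set X))
    (({g (netPt X (label (K : Set X) L))} : NonemptyCompacts X) : Set X)
    = label (g '' (K : Set X)) (g '' (L : Set X))
  have hs := (sameSide_label K.isCompact.isClosed hL L.nonempty h).image g
  rw [image_singleton] at hs
  simpa using label_congr hs (singleton_nonempty _) (L.nonempty.image g)

theorem Labelled.eq_mk (w : Labelled X) : w = Labelled.mk w.1.1 {netPt X w.1.2}
    (by simpa using isSubcontinuum_singleton (netPt X w.1.2)) (by simpa using w.2.1) := by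
  apply Subtype.ext
  refine Prod.ext rfl ?_
  change w.1.2 = label (w.1.1 : Set X) (({netPt X w.1.2} : NonemptyCompacts X) : Set X)
  simpa using w.2.2.symm

theorem Labelled.mk_congr {K K' L L' : NonemptyCompacts X} {hL : IsSubcontinuum (L : Set X)}
    {h : Disjoint (K : Set X) L} {hL' : IsSubcontinuum (L' : Set X)}
    {h' : Disjoint (K' : Set X) L'} (hKK : K = K') (hLL : L = L') :
    Labelled.mk K L hL h = Labelled.mk K' L' hL' h' := by
  subst hKK hLL; rfl

theorem Labelled.map_one (w : Labelled X) : Labelled.map 1 w = w := by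
  conv_rhs => rw [w.eq_mk]
  exact Labelled.mk_congr (mapCL_one _) (by simp)

theorem Labelled.map_mul (g h : X ≃ₜ X) (w : Labelled X) :
    Labelled.map (g * h) w = Labelled.map g (Labelled.map h w) := by
  have hd : Disjoint (mapCL g (mapCL h w.1.1) : Set X)
      (mapCL g {h (netPt X w.1.2)} : NonemptyCompacts X) := by
    simp only [coe_mapCL, NonemptyCompacts.coe_singleton]
    exact (disjoint_image_iff g.injective).2 (disjoint_singleton_image w.2.1 h)
  have hs : IsSubcontinuum (mapCL g {h (netPt X w.1.2)} : Set X) := by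
    simpa using isSubcontinuum_singleton (g (h (netPt X w.1.2)))
  refine Eq.trans ?_ (Labelled.map_mk g _ _ _ _ hs hd).symm
  exact Labelled.mk_congr (mapCL_mul _ _ _) (by rw [mapCL_singleton]; rfl)

theorem Labelled.measurable_mk {Y : Type*} [MeasurableSpace Y] {K L : Y → NonemptyCompacts X}
    (hK : Measurable K) (hL : Measurable L) (hLs : ∀ y, IsSubcontinuum (L y : Set X))
    (h : ∀ y, Disjoint (K y : Set X) (L y)) :
    Measurable fun y => Labelled.mk (K y) (L y) (hLs y) (h y) :=
  Measurable.subtype_mk (hK.prodMk (measurable_label hK hL))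

end Labels
end Dendro

namespace Dendro

/-! ### Equivariant families of subcontinua over a boundary -/

section Families

open Set

attribute [local instance] borelCL borelHomeo

variable {Γ Ω B X : Type u} [Group Γ] [Countable Γ]
  [MeasurableSpace Ω] [StandardBorelSpace Ω] [MulAction Γ Ω] [MeasurableConstSMul Γ Ω]
  {μ : Measure Ω} [IsProbabilityMeasure μ] [ErgodicSMul Γ Ω μ]
  [MeasurableSpace B] [StandardBorelSpace B] [MulAction Γ B] [MeasurableConstSMul Γ B]
  {ν : Measure B} [SigmaFinite ν] [NeZero ν]
  [TopologicalSpace X] [CompactSpace X] [T2Space X] [SecondCountableTopology X]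
  [PointSeparated X] [ConnectedSpace X] {σ : Γ → Ω → (X ≃ₜ X)}

/-- Equivariant families of subcontinua over `B × Ω`. -/
structure IsBoundaryFamily (ν : Measure B) (μ : Measure Ω) (σ : Γ → Ω → (X ≃ₜ X))
    (K : B × Ω → NonemptyCompacts X) : Prop where
  measurable : Measurable K
  equivariant : ∀ γ : Γ, ∀ᵐ w ∂(ν.prod μ), K (γ • w) = mapCL (σ γ w.2) (K w)
  isSubcontinuum : ∀ w, IsSubcontinuum (K w : Set X)

theorem IsVirtualDendroMorphism.ae_one (hσ : IsVirtualDendroMorphism μ σ) :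
    ∀ᵐ s ∂μ, σ 1 s = 1 := by
  filter_upwards [hσ.cocycle 1 1] with s hs
  simpa using hs

/-- The action of a virtual dendro-morphism on the hyperspace. -/
def actCL (hσ : IsVirtualDendroMorphism μ σ) : FiberAction Γ Ω μ (NonemptyCompacts X) where
  act γ s K := mapCL (σ γ s) K
  measurable_act γ := measurable_mapCL ((hσ.measurable γ).comp measurable_fst) measurable_snd
  act_one := by
    filter_upwards [hσ.ae_one] with s hs K
    rw [hs, mapCL_one]
  act_mul γ₁ γ₂ := by
    filter_upwards [hσ.cocycle γ₁ γ₂] with s hs K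
    rw [hs, mapCL_mul]

/-- The action of a virtual dendro-morphism on labelled compact sets. -/
noncomputable def actLabelled (hσ : IsVirtualDendroMorphism μ σ) :
    FiberAction Γ Ω μ (Labelled X) where
  act γ s w := Labelled.map (σ γ s) w
  measurable_act γ := by
    have hg : Measurable fun p : Ω × Labelled X => σ γ p.1 := (hσ.measurable γ).comp measurable_fst
    have hv : Measurable fun p : Ω × Labelled X => p.2.1 :=
      measurable_subtype_coe.comp measurable_snd
    refine Labelled.measurable_mk (measurable_mapCL hg (measurable_fst.comp hv)) ?_ _ _
    have : Measurable fun p : Ω × Labelled X =>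
        mapCL (σ γ p.1) ({netPt X p.2.1.2} : NonemptyCompacts X) :=
      measurable_mapCL hg ((measurable_of_countable fun n : ℕ =>
        ({netPt X n} : NonemptyCompacts X)).comp (measurable_snd.comp hv))
    simpa only [mapCL_singleton] using this
  act_one := by
    filter_upwards [hσ.ae_one] with s hs w
    rw [hs, Labelled.map_one]
  act_mul γ₁ γ₂ := by
    filter_upwards [hσ.cocycle γ₁ γ₂] with s hs w
    rw [hs, Labelled.map_mul]

variable {K L : B × Ω → NonemptyCompacts X}

theorem IsBoundaryFamily.ae_pair (hK : IsBoundaryFamily ν μ σ K)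
    (hL : IsBoundaryFamily ν μ σ L) (γ : Γ) : ∀ᵐ y ∂(ν.prod ν), ∀ᵐ s ∂μ,
      K (γ • y.1, γ • s) = mapCL (σ γ s) (K (y.1, s)) ∧
      L (γ • y.2, γ • s) = mapCL (σ γ s) (L (y.2, s)) := by
  filter_upwards [
    Measure.quasiMeasurePreserving_fst.ae (Measure.ae_ae_of_ae_prod (hK.equivariant γ)),
    Measure.quasiMeasurePreserving_snd.ae (Measure.ae_ae_of_ae_prod (hL.equivariant γ))] with y h h'
  filter_upwards [h, h'] with s h h'
  exact ⟨h, h'⟩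

theorem measurable_pair_fst {K : B × Ω → NonemptyCompacts X} (hK : Measurable K) :
    Measurable fun w : (B × B) × Ω => K (w.1.1, w.2) := hK.comp (by fun_prop)

theorem measurable_pair_snd {K : B × Ω → NonemptyCompacts X} (hK : Measurable K) :
    Measurable fun w : (B × B) × Ω => K (w.1.2, w.2) := hK.comp (by fun_prop)

theorem disjoint_mapCL_iff (g : X ≃ₜ X) (K L : NonemptyCompacts X) :
    Disjoint (mapCL g K : Set X) (mapCL g L : Set X) ↔ Disjoint (K : Set X) (L : Set X) := by
  simp [disjoint_image_iff g.injective]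

/-- Disjointness is invariant under the diagonal action, so ergodicity decides it. The arguments on
Furstenberg maps split along this alternative. -/
theorem disjoint_or_not (hB : IsBoundary Γ ν) (hK : IsBoundaryFamily ν μ σ K)
    (hL : IsBoundaryFamily ν μ σ L) :
    (∀ᵐ y ∂(ν.prod ν), ∀ᵐ s ∂μ, Disjoint (K (y.1, s) : Set X) (L (y.2, s))) ∨
    (∀ᵐ y ∂(ν.prod ν), ∀ᵐ s ∂μ, ¬ Disjoint (K (y.1, s) : Set X) (L (y.2, s))) := by
  refine ergodic_prod (A := {w : (B × B) × Ω | Disjoint (K (w.1.1, w.2) : Set X) (L (w.1.2, w.2))})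
    hB (measurableSet_disjoint (measurable_pair_fst hK.measurable)
    (measurable_pair_snd hL.measurable)) fun γ => ?_
  filter_upwards [hK.ae_pair hL γ] with y hy
  filter_upwards [hy] with s hs
  simp only [Prod.smul_fst, Prod.smul_snd, hs.1, hs.2, disjoint_mapCL_iff]

/-- The label of the component of the complement of `K (b, s)` containing `L (b', s)` takes
countably many values over `K (b, s)`, which depends on `b` only. By `graph_factors` for the first
projection, the label does not depend on `b'` either. -/
theorem ae_sameSide (hB : IsBoundary Γ ν) (hσ : IsVirtualDendroMorphism μ σ)
    (hK : IsBoundaryFamily ν μ σ K) (hL : IsBoundaryFamily ν μ σ L)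
    (hdisj : ∀ᵐ y ∂(ν.prod ν), ∀ᵐ s ∂μ, Disjoint (K (y.1, s) : Set X) (L (y.2, s))) :
    ∀ᵐ b ∂ν, ∀ᵐ s ∂μ, ∃ L₀ : NonemptyCompacts X, IsSubcontinuum (L₀ : Set X) ∧
      Disjoint (K (b, s) : Set X) L₀ ∧ ∀ᵐ b' ∂ν, SameSide (K (b, s) : Set X) L₀ (L (b', s)) := by
  classical
  let A : Set ((B × B) × Ω) := {w | Disjoint (K (w.1.1, w.2) : Set X) (L (w.1.2, w.2))}
  have hA : MeasurableSet A := measurableSet_disjoint (measurable_pair_fst hK.measurable)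
    (measurable_pair_snd hL.measurable)
  obtain ⟨w₀⟩ : Nonempty (Labelled X) := by
    obtain ⟨b, hb⟩ := (Measure.ae_ae_of_ae_prod hdisj).exists
    obtain ⟨b', hb'⟩ := hb.exists
    obtain ⟨s, hs⟩ := hb'.exists
    exact ⟨Labelled.mk _ _ (hL.isSubcontinuum _) hs⟩
  -- The value `w₀` is a filler outside `A`, which is conull by `hdisj`.
  let f : (B × B) × Ω → Labelled X := fun w => if h : w ∈ A then
    Labelled.mk (K (w.1.1, w.2)) (L (w.1.2, w.2)) (hL.isSubcontinuum _) h else w₀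
  have hfA : ∀ w (h : Disjoint (K (w.1.1, w.2) : Set X) (L (w.1.2, w.2))),
      f w = Labelled.mk (K (w.1.1, w.2)) (L (w.1.2, w.2)) (hL.isSubcontinuum _) h :=
    fun w h => dif_pos h
  have hf : Measurable f := by
    refine Measurable.dite (f := fun w : A => Labelled.mk (K (w.1.1.1, w.1.2)) (L (w.1.1.2, w.1.2))
      (hL.isSubcontinuum _) w.2) (g := fun _ => w₀) ?_ measurable_const hA
    exact Labelled.measurable_mk ((measurable_pair_fst hK.measurable).comp measurable_subtype_coe)
      ((measurable_pair_snd hL.measurable).comp measurable_subtype_coe) _ _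
  obtain ⟨ψ, hψ⟩ := FiberAction.graph_factors hB.ergodic_fst (actCL hσ) (actLabelled hσ)
    (π := fun w => w.1.1) (measurable_fst.comp measurable_subtype_coe)
    (c := fun w => w.1.2) (measurable_snd.comp measurable_subtype_coe)
    (fun w w' h h' => Subtype.ext (Prod.ext h h'))
    (fun γ => Filter.Eventually.of_forall fun s w => rfl) hf
    (fun γ => by
      filter_upwards [hK.ae_pair hL γ, hdisj] with y hy hd
      filter_upwards [hy, hd] with s hs hd
      have hd' : Disjoint (mapCL (σ γ s) (K (y.1, s)) : Set X) (mapCL (σ γ s) (L (y.2, s))) :=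
        (disjoint_mapCL_iff _ _ _).2 hd
      have hd'' : Disjoint (K (γ • y.1, γ • s) : Set X) (L (γ • y.2, γ • s)) := by
        rw [hs.1, hs.2]; exact hd'
      rw [hfA (y, s) hd, hfA (γ • y, γ • s) hd'']
      refine Eq.trans ?_ (Labelled.map_mk _ _ _ _ _
        (by rw [← hs.2]; exact hL.isSubcontinuum _) hd').symm
      exact Labelled.mk_congr hs.1 hs.2) hK.measurable
    (fun γ => Measure.ae_ae_of_ae_prod (hK.equivariant γ)) (by
      filter_upwards [hdisj] with y hy
      filter_upwards [hy] with s hs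
      rw [hfA (y, s) hs]; rfl)
  filter_upwards [Measure.ae_ae_of_ae_prod hψ, Measure.ae_ae_of_ae_prod hdisj] with b hb hbd
  -- One generic `b₀` is fixed, and `L (b₀, s)` serves as the reference continuum `L₀`.
  obtain ⟨b₀, hb₀, hb₀d⟩ := (hb.and hbd).exists
  have hm : MeasurableSet {p : B × Ω | f ((b, p.1), p.2) = f ((b, b₀), p.2) ∧
      ((b, p.1), p.2) ∈ A} := by
    refine (measurableSet_eq_fun (hf.comp (by fun_prop)) (hf.comp (by fun_prop))).inter ?_
    exact (show Measurable fun p : B × Ω => ((b, p.1), p.2) by fun_prop) hA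
  have h1 : ∀ᵐ b' ∂ν, ∀ᵐ s ∂μ, f ((b, b'), s) = f ((b, b₀), s) ∧ ((b, b'), s) ∈ A := by
    filter_upwards [hb, hbd] with b' hb' hbd'
    filter_upwards [FiberAction.ae_eq_of_graph_eq _ _ (hb'.symm.trans hb₀), hbd'] with s h h'
    exact ⟨h, h'⟩
  have h2 := ae_omega_ae_boundary ((Measure.ae_prod_mem_iff_ae_ae_mem hm).2 h1)
  filter_upwards [h2, hb₀d] with s hs hsd
  refine ⟨L (b₀, s), hL.isSubcontinuum _, hsd, ?_⟩
  filter_upwards [hs] with b' hb'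
  have heq := (hfA ((b, b'), s) hb'.2).symm.trans (hb'.1.trans (hfA ((b, b₀), s) hsd))
  have heq' : label (K (b, s) : Set X) (L (b', s)) = label (K (b, s) : Set X) (L (b₀, s)) :=
    congrArg (fun w : Labelled X => w.1.2) heq
  have hs1 := sameSide_label (K (b, s)).isCompact.isClosed (hL.isSubcontinuum (b', s))
    (L (b', s)).nonempty hb'.2
  have hs2 := sameSide_label (K (b, s)).isCompact.isClosed (hL.isSubcontinuum (b₀, s))
    (L (b₀, s)).nonempty hsd
  rw [heq'] at hs1
  exact hs2.symm.trans (singleton_nonempty _) hs1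

end Families
end Dendro

namespace Dendro

/-! ### Equivariant cores -/

section Cores

open Set

attribute [local instance] borelCL borelHomeo

variable {Γ X : Type u} [Group Γ] [Countable Γ]
  [TopologicalSpace X] [CompactSpace X] [T2Space X] [SecondCountableTopology X]
  [PointSeparated X] [ConnectedSpace X]

theorem measurableSet_ae {Y Z : Type*} [MeasurableSpace Y] [MeasurableSpace Z] {ζ : Measure Z}
    [SFinite ζ] {S : Set (Y × Z)} (hS : MeasurableSet S) :
    MeasurableSet {y | ∀ᵐ z ∂ζ, (y, z) ∈ S} := by
  have : {y | ∀ᵐ z ∂ζ, (y, z) ∈ S} = (fun y => ζ (Prod.mk y ⁻¹' Sᶜ)) ⁻¹' {0} := rfl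
  rw [this]
  exact measurable_measure_prodMk_left hS.compl (measurableSet_singleton 0)

theorem exists_core_family {Y : Type*} [MeasurableSpace Y] [MulAction Γ Y] {η : Measure Y}
    (hη : ∀ γ : Γ, Measure.QuasiMeasurePreserving (fun y : Y => γ • y) η η)
    {c : Γ → Y → (X ≃ₜ X)} {P : Y → Set X → Prop} (hmono : ∀ y D E, D ⊆ E → P y D → P y E)
    (hne : ∀ᵐ y ∂η, ¬ P y ∅ ∧ (core (P y)).Nonempty)
    (hmeas : ∀ n, MeasurableSet {y | P y (net X n)})
    (heq : ∀ γ : Γ, ∀ᵐ y ∂η, ∀ D, IsSubcontinuum D → (P y D ↔ P (γ • y) (c γ y '' D))) :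
    ∃ κ : Y → NonemptyCompacts X, Measurable κ ∧ (∀ y, IsSubcontinuum (κ y : Set X)) ∧
      (∀ᵐ y ∂η, (κ y : Set X) = core (P y)) ∧
      ∀ γ : Γ, ∀ᵐ y ∂η, κ (γ • y) = mapCL (c γ y) (κ y) := by
  obtain ⟨T, hT, hTm, hT0⟩ := exists_measurable_superset_of_null hne
  have hG : ∀ y, y ∉ T → ¬ P y ∅ ∧ (core (P y)).Nonempty := fun y hy => by
    by_contra h
    exact hy (hT h)
  have hGae : ∀ᵐ y ∂η, y ∉ T := measure_eq_zero_iff_ae_notMem.1 hT0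
  -- Over the exceptional null set `T` the property `P'` never holds, so its core is the whole space
  -- and in particular non-empty.
  let P' : Y → Set X → Prop := fun y D => y ∉ T ∧ P y D
  have hP' : ∀ y, y ∉ T → core (P' y) = core (P y) := fun y hy => by
    congr 1
    ext D
    exact and_iff_right hy
  have hne' : ∀ y, (core (P' y)).Nonempty := fun y => by
    by_cases hy : y ∈ T
    · have : core (P' y) = univ := by
        refine eq_univ_of_forall fun x D hD => absurd hy hD.2.1
      rw [this]; exact univ_nonempty
    · rw [hP' y hy]; exact (hG y hy).2
  have hκ : ∀ᵐ y ∂η, (coreCL (P' y) (hne' y) : Set X) = core (P y) := by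
    filter_upwards [hGae] with y hy using hP' y hy
  refine ⟨fun y => coreCL (P' y) (hne' y), ?_, fun y => isSubcontinuum_core _, hκ, fun γ => ?_⟩
  · refine measurable_of_eq_core (P := P') (fun y D E h h' => ⟨h'.1, hmono y D E h h'.2⟩)
      (fun y h => (hG y h.1).1 h.2) (fun n => hTm.compl.inter (hmeas n)) fun y => rfl
  · filter_upwards [hκ, (hη γ).ae hκ, heq γ] with y h1 h2 h3
    apply SetLike.coe_injective
    rw [coe_mapCL, h1, h2]
    exact (image_core _ h3).symm

end Cores

/-! ### The minimal family of subdendrites -/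

section Minimal

open Set

attribute [local instance] borelCL borelHomeo

variable {Γ Ω X : Type u} [Group Γ] [Countable Γ]
  [MeasurableSpace Ω] [StandardBorelSpace Ω] [MulAction Γ Ω] [MeasurableConstSMul Γ Ω]
  {μ : Measure Ω} [IsProbabilityMeasure μ] [ErgodicSMul Γ Ω μ]
  [TopologicalSpace X] [CompactSpace X] [T2Space X] [SecondCountableTopology X]
  [PointSeparated X] [ConnectedSpace X] {σ : Γ → Ω → (X ≃ₜ X)}

theorem IsSubdendriteFamily.isSubcontinuum {N : Ω → NonemptyCompacts X}
    (hN : IsSubdendriteFamily μ σ N) (s : Ω) : IsSubcontinuum (N s : Set X) :=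
  ⟨(N s).isCompact.isClosed, (hN.connected s).isPreconnected⟩

theorem IsEquivariantFamily.ae_eq_mapCL {N : Ω → NonemptyCompacts X}
    (hN : IsEquivariantFamily μ σ N) (γ : Γ) : ∀ᵐ s ∂μ, N (γ • s) = mapCL (σ γ s) (N s) := by
  filter_upwards [hN.equivariant γ] with s hs
  exact SetLike.coe_injective hs

theorem exists_subdendriteFamily {P : Ω → Set X → Prop} (hmono : ∀ s D E, D ⊆ E → P s D → P s E)
    (hne : ∀ᵐ s ∂μ, ¬ P s ∅ ∧ (core (P s)).Nonempty)
    (hmeas : ∀ n, MeasurableSet {s | P s (net X n)})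
    (heq : ∀ γ : Γ, ∀ᵐ s ∂μ, ∀ D, IsSubcontinuum D → (P s D ↔ P (γ • s) (σ γ s '' D))) :
    ∃ κ : Ω → NonemptyCompacts X, IsSubdendriteFamily μ σ κ ∧
      ∀ᵐ s ∂μ, (κ s : Set X) = core (P s) := by
  obtain ⟨κ, h1, h2, h3, h4⟩ := exists_core_family quasiMeasurePreserving_smul_omega hmono hne
    hmeas heq
  refine ⟨κ, ⟨⟨h1, fun γ => ?_⟩, fun s => ⟨(κ s).nonempty, (h2 s).isPreconnected⟩⟩, h3⟩
  filter_upwards [h4 γ] with s hs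
  rw [hs]; rfl

theorem exists_modification {N : Ω → NonemptyCompacts X} (hN : IsEquivariantFamily μ σ N)
    {p : NonemptyCompacts X → Prop} (h : ∀ᵐ s ∂μ, p (N s)) {K₀ : NonemptyCompacts X} (h₀ : p K₀) :
    ∃ N' : Ω → NonemptyCompacts X, IsEquivariantFamily μ σ N' ∧ (∀ s, p (N' s)) ∧ N' =ᵐ[μ] N := by
  classical
  obtain ⟨T, hT, hTm, hT0⟩ := exists_measurable_superset_of_null h
  have hGae : ∀ᵐ s ∂μ, s ∉ T := measure_eq_zero_iff_ae_notMem.1 hT0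
  have hae : ∀ᵐ s ∂μ, (if s ∈ T then K₀ else N s) = N s := by
    filter_upwards [hGae] with s hs
    rw [if_neg hs]
  refine ⟨fun s => if s ∈ T then K₀ else N s, ⟨?_, fun γ => ?_⟩, fun s => ?_, hae⟩
  · exact Measurable.ite hTm measurable_const hN.measurable
  · filter_upwards [hae, (quasiMeasurePreserving_smul_omega γ).ae hae,
      hN.equivariant γ] with s h1 h2 h3
    rw [h1, h2, h3]
  · by_cases hs : s ∈ T
    · simpa [hs] using h₀
    · simp only [hs, if_false]
      by_contra h
      exact hs (hT h)

theorem isElementary_of_ae_pair {N : Ω → NonemptyCompacts X} (hN : IsEquivariantFamily μ σ N)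
    (h : ∀ᵐ s ∂μ, ∃ x y : X, (N s : Set X) = {x, y}) : IsElementary μ σ := by
  obtain ⟨x₀⟩ := (inferInstance : Nonempty X)
  obtain ⟨N', h1, h2, -⟩ := exists_modification (p := fun K => ∃ x y : X, (K : Set X) = {x, y}) hN h
    (K₀ := {x₀}) ⟨x₀, x₀, by simp⟩
  exact ⟨N', h1, h2⟩

/-- Since an arc determines its end points, these depend measurably and equivariantly on the arc. -/
theorem isElementary_of_ae_hull {N : Ω → NonemptyCompacts X} (hN : IsEquivariantFamily μ σ N)
    (h : ∀ᵐ s ∂μ, ∃ x y : X, (N s : Set X) = hull {x, y}) : IsElementary μ σ := by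
  obtain ⟨x₀⟩ := (inferInstance : Nonempty X)
  obtain ⟨N', h1, h2, -⟩ := exists_modification
    (p := fun K => ∃ x y : X, (K : Set X) = hull {x, y}) hN h (K₀ := {x₀}) ⟨x₀, x₀, by
      simp only [NonemptyCompacts.coe_singleton, pair_eq_singleton]
      exact Subset.antisymm (subset_hull _) (hull_subset (isSubcontinuum_singleton _) subset_rfl)⟩
  obtain ⟨κ, hκ, hκ2, hκM⟩ := exists_measurable_pair h1.measurable h2
  refine ⟨κ, ⟨hκ, fun γ => ?_⟩, hκ2⟩
  filter_upwards [h1.equivariant γ] with s hs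
  obtain ⟨a, b, hab⟩ := hκ2 s
  obtain ⟨a', b', hab'⟩ := hκ2 (γ • s)
  rw [hκM, hκM, image_hull, hab, hab', image_pair] at hs
  rw [hab, hab', image_pair]
  exact pair_eq_of_hull_eq hs

theorem image_subset_image_iff' (g : X ≃ₜ X) {A D : Set X} : g '' A ⊆ g '' D ↔ A ⊆ D :=
  image_subset_image_iff g.injective

theorem image_inter_nonempty_iff (g : X ≃ₜ X) {A D : Set X} :
    (g '' A ∩ g '' D).Nonempty ↔ (A ∩ D).Nonempty := by
  rw [← image_inter g.injective, image_nonempty]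

theorem gatePred_mono {K L : Set X} {D E : Set X} (h : D ⊆ E) (hD : GatePred K L D) :
    GatePred K L E :=
  hD.imp (fun h' => h'.trans h) fun h' => ⟨h'.1.mono (inter_subset_inter_left _ h), h'.2.trans h⟩

theorem not_gatePred_empty {K L : Set X} (hK : K.Nonempty) : ¬ GatePred K L ∅ := by
  rintro (h | ⟨h, -⟩)
  · exact hK.ne_empty (subset_empty_iff.1 h)
  · simp at h

/-- The set of `s` where the two members are disjoint is invariant, hence null or conull. If it were
conull, the gate of `N' s` in `N s` would be an equivariant point. -/
theorem ae_inter_nonempty (hne : ¬ IsElementary μ σ) {N N' : Ω → NonemptyCompacts X}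
    (hN : IsSubdendriteFamily μ σ N) (hN' : IsSubdendriteFamily μ σ N') :
    ∀ᵐ s ∂μ, ((N s : Set X) ∩ N' s).Nonempty := by
  have hA : MeasurableSet {s | Disjoint (N s : Set X) (N' s)} :=
    measurableSet_disjoint hN.measurable hN'.measurable
  have hc := ErgodicSMul.aeconst_of_forall_preimage_smul_ae_eq (G := Γ) (μ := μ) hA fun γ => by
    rw [Filter.eventuallyEq_set]
    filter_upwards [hN.ae_eq_mapCL γ, hN'.ae_eq_mapCL γ] with s h h'
    simp only [mem_preimage, mem_ofPred_eq, h, h', disjoint_mapCL_iff]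
  rw [Filter.eventuallyConst_set] at hc
  rcases hc with h | h
  · exfalso
    have hg : ∀ᵐ s ∂μ, ∃ q, core (GatePred (N s : Set X) (N' s)) = {q} := by
      filter_upwards [h] with s hs
      obtain ⟨q, -, hq⟩ := exists_gate (hN.isSubcontinuum s) (hN'.isSubcontinuum s) (N s).nonempty
        (N' s).nonempty hs
      exact ⟨q, hq⟩
    obtain ⟨κ, hκ, hκc⟩ := exists_subdendriteFamily (μ := μ) (σ := σ)
      (P := fun s => GatePred (N s : Set X) (N' s))
      (fun s D E h => gatePred_mono h) (by
        filter_upwards [hg] with s ⟨q, hq⟩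
        exact ⟨not_gatePred_empty (N s).nonempty, by simp [hq]⟩)
      (fun n => by
        refine (measurableSet_subset hN.measurable (isSubcontinuum_net n).isClosed).union ?_
        have : MeasurableSet {s | (net X n ∩ (N s : Set X)).Nonempty} := by
          simpa only [inter_comm (net X n)] using
            measurableSet_inter_nonempty hN.measurable (isSubcontinuum_net n).isClosed
        exact this.inter (measurableSet_subset hN'.measurable (isSubcontinuum_net n).isClosed))
      (fun γ => by
        filter_upwards [hN.equivariant γ, hN'.equivariant γ] with s h h' D hD
        simp only [GatePred, h, h', image_subset_image_iff', image_inter_nonempty_iff])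
    refine hne (isElementary_of_ae_pair hκ.toIsEquivariantFamily ?_)
    filter_upwards [hg, hκc] with s ⟨q, hq⟩ hs
    exact ⟨q, q, by rw [hs, hq, pair_eq_singleton]⟩
  · filter_upwards [h] with s hs
    exact not_disjoint_iff_nonempty_inter.1 hs

/-- The family is the intersection of the `N i`, written as the core of the property of containing
some `N i s`; it is non-empty by pairwise intersection and Helly. -/
theorem exists_countable_inter_family (hne : ¬ IsElementary μ σ) {ι : Type*} [Countable ι]
    [Nonempty ι] {N : ι → Ω → NonemptyCompacts X} (hN : ∀ i, IsSubdendriteFamily μ σ (N i)) :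
    ∃ κ : Ω → NonemptyCompacts X, IsSubdendriteFamily μ σ κ ∧
      ∀ᵐ s ∂μ, ∀ i, (κ s : Set X) ⊆ N i s := by
  obtain ⟨κ, hκ, hκc⟩ := exists_subdendriteFamily (μ := μ) (σ := σ)
    (P := fun s D => ∃ i, (N i s : Set X) ⊆ D)
    (fun s D E h ⟨i, hi⟩ => ⟨i, hi.trans h⟩) (by
      have : ∀ᵐ s ∂μ, ∀ i j, ((N i s : Set X) ∩ N j s).Nonempty := by
        rw [ae_all_iff]; intro i
        rw [ae_all_iff]; intro j
        exact ae_inter_nonempty hne (hN i) (hN j)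
      filter_upwards [this] with s hs
      refine ⟨fun ⟨i, hi⟩ => (N i s).nonempty.ne_empty (subset_empty_iff.1 hi),
        core_nonempty ?_⟩
      rintro D E hD hE ⟨i, hi⟩ ⟨j, hj⟩
      exact (hs i j).mono (inter_subset_inter hi hj))
    (fun n => by
      have : {s | ∃ i, (N i s : Set X) ⊆ net X n} = ⋃ i, {s | (N i s : Set X) ⊆ net X n} := by
        ext; simp
      rw [this]
      exact MeasurableSet.iUnion fun i =>
        measurableSet_subset (hN i).measurable (isSubcontinuum_net n).isClosed)
    (fun γ => by
      have : ∀ᵐ s ∂μ, ∀ i, (N i (γ • s) : Set X) = σ γ s '' (N i s : Set X) :=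
        ae_all_iff.2 fun i => (hN i).equivariant γ
      filter_upwards [this] with s hs D hD
      simp only [hs, image_subset_image_iff'])
  refine ⟨κ, hκ, ?_⟩
  filter_upwards [hκc] with s hs i
  rw [hs]
  exact core_subset ((hN i).isSubcontinuum s) ⟨i, subset_rfl⟩

theorem subset_of_forall_net {A D : Set X} (hD : IsSubcontinuum D) (hne : D.Nonempty)
    (h : ∀ n, D ⊆ net X n → A ⊆ net X n) : A ⊆ D := by
  intro x hx
  by_contra hxD
  obtain ⟨n, hn, hn'⟩ := exists_net hD hne (isOpen_compl_singleton (x := x))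
    (subset_compl_singleton_iff.2 hxD)
  exact hn' (h n hn hx) rfl

/-- Exhaustion: for each member of the net, the measure of the set of `s` with `N s` inside it is
maximized along a sequence of families. The intersection `M` of these countably many families
attains all the suprema. Intersecting `M` with another family `N'` cannot increase them, so almost
everywhere the same members of the net contain the intersection and `M`. -/
theorem exists_minimalFamily (hne : ¬ IsElementary μ σ) :
    ∃ M : Ω → NonemptyCompacts X, IsMinimalFamily μ σ M := by
  let F := {N : Ω → NonemptyCompacts X // IsSubdendriteFamily μ σ N}
  have : Nonempty F := by
    refine ⟨fun _ => ⊤, ⟨⟨measurable_const, fun γ => ?_⟩, fun s => ?_⟩⟩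
    · exact Filter.Eventually.of_forall fun s => by simp [(σ γ s).surjective.range_eq]
    · simpa using isConnected_univ
  let S : ℕ → F → Set Ω := fun n N => {s | (N.1 s : Set X) ⊆ net X n}
  have hS : ∀ n N, MeasurableSet (S n N) := fun n N =>
    measurableSet_subset N.2.measurable (isSubcontinuum_net n).isClosed
  have hseq : ∀ n, ∃ N : ℕ → F, Filter.Tendsto (fun k => μ (S n (N k))) Filter.atTop
      (nhds (⨆ N, μ (S n N))) := by
    intro n
    obtain ⟨u, -, hu, hu'⟩ := exists_seq_tendsto_sSup (S := range fun N => μ (S n N))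
      (range_nonempty _) (OrderTop.bddAbove _)
    choose N hN using hu'
    exact ⟨N, by simpa only [hN, sSup_range] using hu⟩
  choose N hN using hseq
  obtain ⟨M, hM, hMN⟩ := exists_countable_inter_family hne (N := fun i : ℕ × ℕ => (N i.1 i.2).1)
    fun i => (N i.1 i.2).2
  have hmax : ∀ n (N' : F), μ (S n N') ≤ μ (S n ⟨M, hM⟩) := by
    intro n N'
    refine (le_iSup (fun N => μ (S n N)) N').trans (le_of_tendsto' (hN n) fun k => ?_)
    refine measure_mono_ae ?_
    filter_upwards [hMN] with s hs hs'
    exact (hs (n, k)).trans hs'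
  refine ⟨M, hM, fun N' hN' => ?_⟩
  obtain ⟨κ, hκ, hκN⟩ := exists_countable_inter_family hne (N := fun b : Bool => cond b M N')
    (by rintro (_ | _) <;> assumption)
  have heq : ∀ n, S n ⟨M, hM⟩ =ᵐ[μ] S n ⟨κ, hκ⟩ := fun n => by
    refine ae_eq_of_ae_subset_of_measure_ge ?_ (hmax n _) (hS n _).nullMeasurableSet
      (measure_ne_top _ _)
    filter_upwards [hκN] with s hs hs'
    exact (hs true).trans hs'
  filter_upwards [hκN, ae_all_iff.2 fun n => (Filter.eventuallyEq_set.1 (heq n))] with s h1 h2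
  exact (subset_of_forall_net (hκ.isSubcontinuum s) (κ s).nonempty fun n hn =>
    (h2 n).2 hn).trans (h1 false)

theorem IsMinimalFamily.ae_eq {M N : Ω → NonemptyCompacts X} (hM : IsMinimalFamily μ σ M)
    (hN : IsMinimalFamily μ σ N) : N =ᵐ[μ] M := by
  filter_upwards [hM.minimal N hN.toIsSubdendriteFamily,
    hN.minimal M hM.toIsSubdendriteFamily] with s h h'
  exact SetLike.coe_injective (h'.antisymm h)

end Minimal
end Dendro

namespace Dendro

/-! ### Boundary families and the minimal family -/

section BoundaryMinimal

open Set

attribute [local instance] borelCL borelHomeo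

variable {Γ Ω B X : Type u} [Group Γ] [Countable Γ]
  [MeasurableSpace Ω] [StandardBorelSpace Ω] [MulAction Γ Ω] [MeasurableConstSMul Γ Ω]
  {μ : Measure Ω} [IsProbabilityMeasure μ] [ErgodicSMul Γ Ω μ]
  [MeasurableSpace B] [StandardBorelSpace B] [MulAction Γ B] [MeasurableConstSMul Γ B]
  {ν : Measure B} [SigmaFinite ν] [NeZero ν]
  [TopologicalSpace X] [CompactSpace X] [T2Space X] [SecondCountableTopology X]
  [PointSeparated X] [ConnectedSpace X] {σ : Γ → Ω → (X ≃ₜ X)}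
  {M : Ω → NonemptyCompacts X} {K L : B × Ω → NonemptyCompacts X}

theorem ae_prod_of_ae_omega {S : Set (B × Ω)} (hS : MeasurableSet S)
    (h : ∀ᵐ s ∂μ, ∀ᵐ b ∂ν, (b, s) ∈ S) : ∀ᵐ w ∂(ν.prod μ), w ∈ S :=
  ae_prod_swap ((Measure.ae_prod_mem_iff_ae_ae_mem (measurable_swap hS)).2 h)

theorem IsBoundaryFamily.measurableSet_ae_subset (hL : IsBoundaryFamily ν μ σ L) {D : Set X}
    (hD : IsClosed D) : MeasurableSet {s | ∀ᵐ b ∂ν, (L (b, s) : Set X) ⊆ D} :=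
  measurableSet_ae (S := {p : Ω × B | (L (p.2, p.1) : Set X) ⊆ D})
    (measurableSet_subset (hL.measurable.comp measurable_swap) hD)

/-- The exceptional null set does not depend on `D`. The parameter `p`, used with `id` and with
`Not`, covers both "for almost every `b`" and "for a set of `b` of positive measure". -/
theorem IsBoundaryFamily.ae_subset_iff (hB : IsBoundary Γ ν) (hL : IsBoundaryFamily ν μ σ L)
    (p : Prop → Prop) (γ : Γ) : ∀ᵐ s ∂μ, ∀ D : Set X, (∀ᵐ b ∂ν, p ((L (b, s) : Set X) ⊆ D)) ↔
      ∀ᵐ b ∂ν, p ((L (b, γ • s) : Set X) ⊆ σ γ s '' D) := by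
  filter_upwards [ae_omega_ae_boundary (hL.equivariant γ)] with s hs D
  rw [← ae_smul_iff hB.quasiInvariant γ (p := fun b => p ((L (b, γ • s) : Set X) ⊆ σ γ s '' D))]
  refine Filter.eventually_congr ?_
  filter_upwards [hs] with b hb
  have hb' : L (γ • b, γ • s) = mapCL (σ γ s) (L (b, s)) := hb
  rw [hb', coe_mapCL, image_subset_image_iff']

theorem not_ae_subset_empty (L : B → NonemptyCompacts X) :
    ¬ ∀ᵐ b ∂ν, (L b : Set X) ⊆ ∅ := fun h => by
  obtain ⟨b, hb⟩ := h.exists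
  exact (L b).nonempty.ne_empty (subset_empty_iff.1 hb)

/-- The smallest subcontinuum containing almost all `L (b, s)` is an equivariant family of
subdendrites, to which minimality applies. -/
theorem IsMinimalFamily.subset_of_ae_subset (hB : IsBoundary Γ ν) (hM : IsMinimalFamily μ σ M)
    (hL : IsBoundaryFamily ν μ σ L) :
    ∀ᵐ s ∂μ, ∀ D : Set X, IsSubcontinuum D → (∀ᵐ b ∂ν, (L (b, s) : Set X) ⊆ D) →
      (M s : Set X) ⊆ D := by
  obtain ⟨κ, hκ, hκc⟩ := exists_subdendriteFamily (μ := μ) (σ := σ)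
    (P := fun s D => ∀ᵐ b ∂ν, (L (b, s) : Set X) ⊆ D)
    (fun s D E h h' => h'.mono fun b hb => hb.trans h)
    (Filter.Eventually.of_forall fun s => ⟨not_ae_subset_empty _,
      core_nonempty fun D E _ _ h h' => by
      obtain ⟨b, hb, hb'⟩ := (h.and h').exists
      exact (L (b, s)).nonempty.mono (subset_inter hb hb')⟩)
    (fun n => hL.measurableSet_ae_subset (isSubcontinuum_net n).isClosed)
    (fun γ => by
      filter_upwards [hL.ae_subset_iff hB id γ] with s hs D _ using hs D)
  filter_upwards [hκc, hM.minimal κ hκ] with s h1 h2 D hD hDL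
  rw [h1] at h2
  exact h2.trans (core_subset hD hDL)

theorem measurableSet_subset_family {Y : Type*} [MeasurableSpace Y] {K L : Y → NonemptyCompacts X}
    (hK : Measurable K) (hL : Measurable L) (hLs : ∀ y, IsSubcontinuum (L y : Set X)) :
    MeasurableSet {y | (K y : Set X) ⊆ L y} := by
  have : {y | (K y : Set X) ⊆ L y} =
      ⋂ n, ({y | (L y : Set X) ⊆ net X n}ᶜ ∪ {y | (K y : Set X) ⊆ net X n}) := by
    ext y
    simp only [mem_ofPred_eq, mem_iInter, mem_union, mem_compl_iff, ← imp_iff_not_or]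
    exact ⟨fun h n hn => h.trans hn, fun h => subset_of_forall_net (hLs y) (L y).nonempty h⟩
  rw [this]
  exact MeasurableSet.iInter fun n =>
    (measurableSet_subset hL (isSubcontinuum_net n).isClosed).compl.union
      (measurableSet_subset hK (isSubcontinuum_net n).isClosed)

/-- Two subcontinua, each containing `L (b, s)` for a set of `b` of positive measure, must meet, so
by Helly all of them have a common point. Their intersection is an equivariant family and contains
`M s`. Testing on the net then gives `M s ⊆ L (b, s)` for almost every `b`. -/
theorem IsMinimalFamily.subset_of_ae_inter (hB : IsBoundary Γ ν) (hM : IsMinimalFamily μ σ M)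
    (hL : IsBoundaryFamily ν μ σ L)
    (h : ∀ᵐ y ∂(ν.prod ν), ∀ᵐ s ∂μ, ¬ Disjoint (L (y.1, s) : Set X) (L (y.2, s))) :
    ∀ᵐ w ∂(ν.prod μ), (M w.2 : Set X) ⊆ L w := by
  have hmeas : MeasurableSet {w : (B × B) × Ω |
      ¬ Disjoint (L (w.1.1, w.2) : Set X) (L (w.1.2, w.2))} :=
    (measurableSet_disjoint (measurable_pair_fst hL.measurable)
      (measurable_pair_snd hL.measurable)).compl
  have h1 : ∀ᵐ s ∂μ, ∀ᵐ b ∂ν, ∀ᵐ b' ∂ν, ¬ Disjoint (L (b, s) : Set X) (L (b', s)) := by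
    have := Measure.ae_ae_of_ae_prod (ae_prod_swap ((Measure.ae_prod_mem_iff_ae_ae_mem hmeas).2 h))
    filter_upwards [this] with s hs using Measure.ae_ae_of_ae_prod hs
  obtain ⟨κ, hκ, hκc⟩ := exists_subdendriteFamily (μ := μ) (σ := σ)
    (P := fun s D => ¬ ∀ᵐ b ∂ν, ¬ (L (b, s) : Set X) ⊆ D)
    (fun s D E h h' h'' => h' (h''.mono fun b hb hb' => hb (hb'.trans h)))
    (by
      filter_upwards [h1] with s hs
      refine ⟨fun h => h (Filter.Eventually.of_forall fun b hb =>
        (L (b, s)).nonempty.ne_empty (subset_empty_iff.1 hb)),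
        core_nonempty fun D E _ _ hD hE => ?_⟩
      have hD' : ∃ᶠ b in ae ν, (L (b, s) : Set X) ⊆ D := hD
      have hE' : ∃ᶠ b in ae ν, (L (b, s) : Set X) ⊆ E := hE
      obtain ⟨b, hb, hb'⟩ := (hD'.and_eventually hs).exists
      obtain ⟨b', hb'', hb'''⟩ := (hE'.and_eventually hb').exists
      exact (not_disjoint_iff_nonempty_inter.1 hb''').mono (inter_subset_inter hb hb''))
    (fun n => (measurableSet_ae (S := {p : Ω × B | ¬ (L (p.2, p.1) : Set X) ⊆ net X n})
      (measurableSet_subset (hL.measurable.comp measurable_swap)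
        (isSubcontinuum_net n).isClosed).compl).compl)
    (fun γ => by
      filter_upwards [hL.ae_subset_iff hB Not γ] with s hs D _ using not_congr (hs D))
  refine ae_prod_of_ae_omega (S := {w | (M w.2 : Set X) ⊆ L w})
    (measurableSet_subset_family (hM.measurable.comp measurable_snd) hL.measurable
      hL.isSubcontinuum) ?_
  filter_upwards [hκc, hM.minimal κ hκ] with s h2 h3
  have h4 : ∀ᵐ b ∂ν, ∀ n, (L (b, s) : Set X) ⊆ net X n → (M s : Set X) ⊆ net X n := by
    rw [ae_all_iff]
    intro n
    by_cases hn : ∀ᵐ b ∂ν, ¬ (L (b, s) : Set X) ⊆ net X n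
    · filter_upwards [hn] with b hb hb' using absurd hb' hb
    · refine Filter.Eventually.of_forall fun b _ => ?_
      rw [h2] at h3
      exact h3.trans (core_subset (isSubcontinuum_net n) hn)
  filter_upwards [h4] with b hb
  exact subset_of_forall_net (hL.isSubcontinuum _) (L (b, s)).nonempty hb

/-- Fubini needs a measurable set to pass from iterated null sets to the product. The existence of
`L₀` is therefore rephrased as equality of the labels for almost all pairs `b'`, `b''`. -/
theorem ae_prod_sameSide (hB : IsBoundary Γ ν) (hσ : IsVirtualDendroMorphism μ σ)
    (hK : IsBoundaryFamily ν μ σ K) (hL : IsBoundaryFamily ν μ σ L)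
    (hdisj : ∀ᵐ y ∂(ν.prod ν), ∀ᵐ s ∂μ, Disjoint (K (y.1, s) : Set X) (L (y.2, s))) :
    ∀ᵐ w ∂(ν.prod μ), ∃ L₀ : NonemptyCompacts X, IsSubcontinuum (L₀ : Set X) ∧
      Disjoint (K w : Set X) L₀ ∧ ∀ᵐ b' ∂ν, SameSide (K w : Set X) L₀ (L (b', w.2)) := by
  let S : Set (((B × Ω) × B) × B) := {p | Disjoint (K p.1.1 : Set X) (L (p.1.2, p.1.1.2)) ∧
    label (K p.1.1 : Set X) (L (p.1.2, p.1.1.2)) = label (K p.1.1 : Set X) (L (p.2, p.1.1.2))}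
  have hK' : Measurable fun p : ((B × Ω) × B) × B => K p.1.1 := hK.measurable.comp (by fun_prop)
  have hL' : Measurable fun p : ((B × Ω) × B) × B => L (p.1.2, p.1.1.2) :=
    hL.measurable.comp (by fun_prop)
  have hL'' : Measurable fun p : ((B × Ω) × B) × B => L (p.2, p.1.1.2) :=
    hL.measurable.comp (by fun_prop)
  have hS : MeasurableSet S := (measurableSet_disjoint hK' hL').inter
    (measurableSet_eq_fun (measurable_label hK' hL') (measurable_label hK' hL''))
  have hS2 : MeasurableSet {w : B × Ω | ∀ᵐ b' ∂ν, (w, b') ∈ {p : (B × Ω) × B |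
      ∀ᵐ b'' ∂ν, (p, b'') ∈ S}} := measurableSet_ae (measurableSet_ae hS)
  have hae : ∀ᵐ w ∂(ν.prod μ), w ∈ {w : B × Ω | ∀ᵐ b' ∂ν, (w, b') ∈ {p : (B × Ω) × B |
      ∀ᵐ b'' ∂ν, (p, b'') ∈ S}} := by
    rw [Measure.ae_prod_mem_iff_ae_ae_mem hS2]
    filter_upwards [ae_sameSide hB hσ hK hL hdisj] with b hb
    filter_upwards [hb] with s hs
    obtain ⟨L₀, -, -, hs⟩ := hs
    filter_upwards [hs] with b' h1
    filter_upwards [hs] with b'' h2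
    obtain ⟨D, -, -, hD, hKD⟩ := id h1
    refine ⟨hKD.mono_right hD, ?_⟩
    have hL₀ : (L₀ : Set X).Nonempty := L₀.nonempty
    exact (label_congr h1 hL₀ (L _).nonempty).symm.trans (label_congr h2 hL₀ (L _).nonempty)
  have hdisj' : ∀ᵐ w ∂(ν.prod μ), ∀ᵐ b' ∂ν, Disjoint (K w : Set X) (L (b', w.2)) := by
    filter_upwards [hae] with w hw
    filter_upwards [hw] with b' hb'
    exact hb'.exists.choose_spec.1
  filter_upwards [hae, hdisj'] with w hw hd
  obtain ⟨b', h1, h2⟩ := (Filter.Eventually.and hw hd).exists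
  refine ⟨L (b', w.2), hL.isSubcontinuum _, h2, ?_⟩
  filter_upwards [h1, hd] with b'' h3 h4
  have hs1 := sameSide_label (K w).isCompact.isClosed (hL.isSubcontinuum (b', w.2))
    (L (b', w.2)).nonempty h2
  have hs2 := sameSide_label (K w).isCompact.isClosed (hL.isSubcontinuum (b'', w.2))
    (L (b'', w.2)).nonempty h4
  have h5 : label (K w : Set X) (L (b', w.2)) = label (K w : Set X) (L (b'', w.2)) := h3.2
  rw [← h5] at hs2
  exact hs1.symm.trans (singleton_nonempty _) hs2

/-- The condition whose core is the gate of `K` towards almost all the sets `L b`. -/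
def AeGatePred (ν : Measure B) (K : Set X) (L : B → Set X) (D : Set X) : Prop :=
  K ⊆ D ∨ ((D ∩ K).Nonempty ∧ ∀ᵐ b ∂ν, L b ⊆ D)

theorem hull_gate_subset {K L : Set X} {q : X}
    (hg : core (GatePred K L) = {q}) : K ∩ hull (insert q L) ⊆ {q} := by
  rw [← hg]
  rintro y ⟨hyK, hy⟩ D ⟨hD, hD' | ⟨h1, h2⟩⟩
  · exact hD' hyK
  · refine hull_subset hD (insert_subset ?_ h2) hy
    have : q ∈ core (GatePred K L) := hg ▸ rfl
    exact this D ⟨hD, Or.inr ⟨h1, h2⟩⟩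

/-- Almost all `L (b, s)` lie in one component of the complement of `K w`. Its closure `C` is a
subcontinuum, so it contains `M s` by `subset_of_ae_subset`. All these `L (b, s)` have the same gate
`q`, and `q` is the only possible point of `K w ∩ C`. -/
theorem IsMinimalFamily.exists_gate_closure (hB : IsBoundary Γ ν)
    (hσ : IsVirtualDendroMorphism μ σ) (hM : IsMinimalFamily μ σ M)
    (hK : IsBoundaryFamily ν μ σ K) (hL : IsBoundaryFamily ν μ σ L)
    (hdisj : ∀ᵐ y ∂(ν.prod ν), ∀ᵐ s ∂μ, Disjoint (K (y.1, s) : Set X) (L (y.2, s))) :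
    ∀ᵐ w ∂(ν.prod μ), ∃ (C : Set X) (q x : X), (M w.2 : Set X) ⊆ C ∧ (K w : Set X) ∩ C ⊆ {q} ∧
      (∀ y ∈ C, y ∉ (K w : Set X) → SameSide (K w : Set X) {x} {y}) ∧
      core (AeGatePred ν (K w : Set X) fun b => (L (b, w.2) : Set X)) = {q} := by
  filter_upwards [ae_prod_sameSide hB hσ hK hL hdisj,
    Measure.quasiMeasurePreserving_snd.ae (hM.subset_of_ae_subset hB hL)]
    with w ⟨L₀, hL₀, hd, hs⟩ hw
  obtain ⟨x, hx⟩ := L₀.nonempty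
  have hxK : x ∉ (K w : Set X) := fun h => disjoint_left.1 hd h hx
  obtain ⟨C, q, hqK, hC, hKC, hg, hCL, hCs⟩ := exists_side_closure (hK.isSubcontinuum w)
    (K w).nonempty hxK
  have hxL₀ : SameSide (K w : Set X) {x} L₀ := ⟨L₀, hL₀, singleton_subset_iff.2 hx, subset_rfl, hd⟩
  have hs' : ∀ᵐ b ∂ν, SameSide (K w : Set X) {x} (L (b, w.2)) := by
    filter_upwards [hs] with b hb using hxL₀.trans ⟨x, hx⟩ hb
  have hLC : ∀ᵐ b ∂ν, (L (b, w.2) : Set X) ⊆ C := by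
    filter_upwards [hs'] with b hb using hCL _ hb
  refine ⟨C, q, x, hw C hC hLC, hKC, hCs, ?_⟩
  have hxC : x ∈ C := hCL _ hxL₀ hx
  -- It has not been shown that `C` reaches `K w`; the hull of `{q, x}` connects it to the gate
  -- without adding other points of `K w`.
  have hC' : IsSubcontinuum (C ∪ hull (insert q {x})) :=
    hC.union (isSubcontinuum_hull _) ⟨x, hxC, subset_hull _ (by simp)⟩
  apply Subset.antisymm
  · intro y hy
    have h1 : y ∈ (K w : Set X) := hy _ ⟨hK.isSubcontinuum w, Or.inl subset_rfl⟩
    have h2 : y ∈ C ∪ hull (insert q {x}) := hy _ ⟨hC', Or.inr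
      ⟨⟨q, Or.inr (subset_hull _ (by simp)), hqK⟩, hLC.mono fun b hb => hb.trans subset_union_left⟩⟩
    rcases h2 with h2 | h2
    · exact hKC ⟨h1, h2⟩
    · exact hull_gate_subset hg ⟨h1, h2⟩
  · rw [singleton_subset_iff]
    rintro D ⟨hD, hD' | ⟨h1, h2⟩⟩
    · exact hD' hqK
    · obtain ⟨b, hb, hb'⟩ := (h2.and hs').exists
      have : q ∈ core (GatePred (K w : Set X) (L (b, w.2))) := by
        rw [← hb'.core_gate_eq (hK.isSubcontinuum w) (isSubcontinuum_singleton x)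
          (hL.isSubcontinuum _) (K w).nonempty (singleton_nonempty x) (L _).nonempty, hg]
        rfl
      exact this D ⟨hD, Or.inr ⟨h1, hb⟩⟩

end BoundaryMinimal
end Dendro

namespace Dendro

/-! ### Furstenberg maps -/

section Furstenberg

open Set

attribute [local instance] borelCL borelHomeo

variable {Γ Ω B X : Type u} [Group Γ] [Countable Γ]
  [MeasurableSpace Ω] [StandardBorelSpace Ω] [MulAction Γ Ω] [MeasurableConstSMul Γ Ω]
  {μ : Measure Ω} [IsProbabilityMeasure μ] [ErgodicSMul Γ Ω μ]
  [MeasurableSpace B] [StandardBorelSpace B] [MulAction Γ B] [MeasurableConstSMul Γ B]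
  {ν : Measure B} [SigmaFinite ν] [NeZero ν]
  [TopologicalSpace X] [CompactSpace X] [T2Space X] [SecondCountableTopology X]
  [PointSeparated X] [ConnectedSpace X] {σ : Γ → Ω → (X ≃ₜ X)}
  [MeasurableSpace X] [BorelSpace X]
  {M : Ω → NonemptyCompacts X} {φ ψ : B × Ω → X}

theorem IsSubdendriteFamily.isBoundaryFamily (hM : IsSubdendriteFamily μ σ M) :
    IsBoundaryFamily ν μ σ fun w => M w.2 where
  measurable := hM.measurable.comp measurable_snd
  equivariant γ := Measure.quasiMeasurePreserving_snd.ae (hM.ae_eq_mapCL γ)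
  isSubcontinuum w := hM.isSubcontinuum w.2

theorem IsFurstenbergMap.isBoundaryFamily (hφ : IsFurstenbergMap ν μ σ φ) :
    IsBoundaryFamily ν μ σ fun w => {φ w} where
  measurable := measurable_singletonCL.2 hφ.measurable
  equivariant γ := by
    filter_upwards [hφ.equivariant γ] with w hw
    rw [mapCL_singleton, ← hw]; rfl
  isSubcontinuum w := by simpa using isSubcontinuum_singleton (φ w)

theorem measurable_hull_pair {Y : Type*} [MeasurableSpace Y] {f g : Y → X} (hf : Measurable f)
    (hg : Measurable g) : Measurable fun y => hullCL ({f y} ⊔ {g y} : NonemptyCompacts X) := by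
  have hc : Continuous fun p : X × X => ({p.1} ⊔ {p.2} : NonemptyCompacts X) :=
    (NonemptyCompacts.continuous_singleton.comp continuous_fst).sup
      (NonemptyCompacts.continuous_singleton.comp continuous_snd)
  exact measurable_hullCL.comp (hc.measurable.comp (hf.prodMk hg))

theorem coe_hull_pair (x y : X) :
    (hullCL ({x} ⊔ {y} : NonemptyCompacts X) : Set X) = hull {x, y} := by
  rw [coe_hullCL, NonemptyCompacts.coe_sup, NonemptyCompacts.coe_singleton,
    NonemptyCompacts.coe_singleton]
  rfl

theorem IsFurstenbergMap.isBoundaryFamily_hull (hφ : IsFurstenbergMap ν μ σ φ)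
    (hψ : IsFurstenbergMap ν μ σ ψ) :
    IsBoundaryFamily ν μ σ fun w => hullCL ({φ w} ⊔ {ψ w} : NonemptyCompacts X) where
  measurable := measurable_hull_pair hφ.measurable hψ.measurable
  equivariant γ := by
    filter_upwards [hφ.equivariant γ, hψ.equivariant γ] with w h1 h2
    apply SetLike.coe_injective
    have h1' : φ (γ • w) = σ γ w.2 (φ w) := h1
    have h2' : ψ (γ • w) = σ γ w.2 (ψ w) := h2
    rw [coe_mapCL, coe_hull_pair, coe_hull_pair, image_hull, image_pair, h1', h2']
  isSubcontinuum w := isSubcontinuum_hull _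

theorem ae_omega_of_ae_prod {p : Ω → Prop} (h : ∀ᵐ w ∂(ν.prod μ), p w.2) : ∀ᵐ s ∂μ, p s := by
  obtain ⟨b, hb⟩ := (Measure.ae_ae_of_ae_prod h).exists
  exact hb

theorem IsMinimalFamily.not_ae_subset_singleton (hne : ¬ IsElementary μ σ)
    (hM : IsMinimalFamily μ σ M) : ¬ ∀ᵐ s ∂μ, ∃ q, (M s : Set X) ⊆ {q} := by
  intro h
  refine hne (isElementary_of_ae_pair hM.toIsEquivariantFamily ?_)
  filter_upwards [h] with s ⟨q, hq⟩
  refine ⟨q, q, ?_⟩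
  rw [pair_eq_singleton]
  exact (M s).nonempty.subset_singleton_iff.1 hq

/-- Being a single point is an invariant condition on `M s`, so ergodicity upgrades "not almost
always" to "almost never". -/
theorem IsMinimalFamily.ae_not_subset_singleton (hne : ¬ IsElementary μ σ)
    (hM : IsMinimalFamily μ σ M) : ∀ᵐ s ∂μ, ∀ q, ¬ (M s : Set X) ⊆ {q} := by
  have hset : {s | ∃ q, (M s : Set X) ⊆ {q}} =
      M ⁻¹' range fun x : X => ({x} : NonemptyCompacts X) := by
    ext s
    simp only [mem_ofPred_eq, mem_preimage, mem_range, (M s).nonempty.subset_singleton_iff]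
    refine exists_congr fun q => ?_
    rw [eq_comm, ← NonemptyCompacts.coe_singleton, SetLike.coe_set_eq]
  have hA : MeasurableSet {s | ∃ q, (M s : Set X) ⊆ {q}} := by
    rw [hset]
    exact hM.measurable (NonemptyCompacts.isClosedEmbedding_singleton
      (α := X)).isClosed_range.measurableSet
  have hc := ErgodicSMul.aeconst_of_forall_preimage_smul_ae_eq (G := Γ) (μ := μ) hA fun γ => by
    rw [Filter.eventuallyEq_set]
    filter_upwards [hM.equivariant γ] with s h
    simp only [mem_preimage, mem_ofPred_eq, h]
    constructor
    · rintro ⟨q, hq⟩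
      refine ⟨(σ γ s).symm q, fun x hx => ?_⟩
      have := hq (mem_image_of_mem _ hx)
      simp only [mem_singleton_iff] at this ⊢
      rw [← this, Homeomorph.symm_apply_apply]
    · rintro ⟨q, hq⟩
      exact ⟨σ γ s q, (image_mono hq).trans (by simp)⟩
  rw [Filter.eventuallyConst_set] at hc
  rcases hc with h | h
  · exact absurd h (hM.not_ae_subset_singleton hne)
  · filter_upwards [h] with s hs q hq using hs ⟨q, hq⟩

/-- If `M s` and `φ (b, s)` were disjoint, the closure `C` would contain `M s` and meet it in at
most one point, reducing `M s` to a point. -/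
theorem IsFurstenbergMap.ae_mem (hB : IsBoundary Γ ν) (hσ : IsVirtualDendroMorphism μ σ)
    (hne : ¬ IsElementary μ σ) (hM : IsMinimalFamily μ σ M) (hφ : IsFurstenbergMap ν μ σ φ) :
    ∀ᵐ w ∂(ν.prod μ), φ w ∈ (M w.2 : Set X) := by
  have hK := hM.isBoundaryFamily (ν := ν)
  rcases disjoint_or_not hB hK hφ.isBoundaryFamily with h | h
  · refine absurd ?_ (hM.not_ae_subset_singleton hne)
    apply ae_omega_of_ae_prod (ν := ν)
    filter_upwards [hM.exists_gate_closure hB hσ hK hφ.isBoundaryFamily h] with w hw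
    obtain ⟨C, q, -, hMC, hKC, -⟩ := hw
    exact ⟨q, fun y hy => hKC ⟨hy, hMC hy⟩⟩
  · refine ae_prod_of_ae_omega (S := {w | φ w ∈ (M w.2 : Set X)}) ?_ ?_
    · convert! (measurableSet_disjoint hφ.isBoundaryFamily.measurable hK.measurable).compl using 1
      ext w; simp
    · have hmeas : MeasurableSet {w : (B × B) × Ω |
          ¬ Disjoint (M w.2 : Set X) ({φ (w.1.2, w.2)} : NonemptyCompacts X)} :=
        (measurableSet_disjoint (hM.measurable.comp measurable_snd)
          (measurable_pair_snd hφ.isBoundaryFamily.measurable)).compl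
      have := Measure.ae_ae_of_ae_prod
        (ae_prod_swap ((Measure.ae_prod_mem_iff_ae_ae_mem hmeas).2 h))
      filter_upwards [this] with s hs
      obtain ⟨b, hb⟩ := (Measure.ae_ae_of_ae_prod hs).exists
      filter_upwards [hb] with b' hb'
      simpa using hb'

/-- If the values `φ (b, s)` and `φ (b', s)` coincided, `M s` would be contained in a point. So they
differ, and all points of `M s` other than `φ (b, s)` lie in one component of the complement of `φ
(b, s)`. -/
theorem IsFurstenbergMap.ae_mem_ends (hB : IsBoundary Γ ν) (hσ : IsVirtualDendroMorphism μ σ)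
    (hne : ¬ IsElementary μ σ) (hM : IsMinimalFamily μ σ M) (hφ : IsFurstenbergMap ν μ σ φ) :
    ∀ᵐ w ∂(ν.prod μ), φ w ∈ ends (M w.2 : Set X) := by
  have hK := hφ.isBoundaryFamily
  rcases disjoint_or_not hB hK hK with h | h
  · filter_upwards [hM.exists_gate_closure hB hσ hK hK h, hφ.ae_mem hB hσ hne hM,
      Measure.quasiMeasurePreserving_snd.ae (hM.ae_not_subset_singleton hne)] with w hw hmem hns
    obtain ⟨C, q, x, hMC, -, hCs, -⟩ := hw
    simp only [NonemptyCompacts.coe_singleton] at hCs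
    refine mem_ends_of_sameSide (hM.isSubcontinuum _) hmem ?_ fun y hy z hz hyp hzp => ?_
    · by_contra hemp
      rw [not_nonempty_iff_eq_empty, sdiff_eq_empty] at hemp
      exact hns _ hemp
    · exact (hCs y (hMC hy) hyp).symm.trans (singleton_nonempty _) (hCs z (hMC hz) hzp)
  · refine absurd ?_ (hM.not_ae_subset_singleton hne)
    apply ae_omega_of_ae_prod (ν := ν)
    filter_upwards [hM.subset_of_ae_inter hB hK h] with w hw
    exact ⟨φ w, by simpa using hw⟩

/-- The alternative is applied to the arcs from `φ` to `ψ`. If they meet, `M s` lies in such an arc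
and contains its end points, so it equals the arc and `σ` is elementary. If they are disjoint, both
end points lie in `M s ⊆ C` and are equal to the gate. -/
theorem IsFurstenbergMap.ae_eq (hB : IsBoundary Γ ν) (hσ : IsVirtualDendroMorphism μ σ)
    (hne : ¬ IsElementary μ σ) (hM : IsMinimalFamily μ σ M) (hφ : IsFurstenbergMap ν μ σ φ)
    (hψ : IsFurstenbergMap ν μ σ ψ) : ψ =ᵐ[ν.prod μ] φ := by
  have hK := hφ.isBoundaryFamily_hull hψ
  rcases disjoint_or_not hB hK hK with h | h
  · filter_upwards [hM.exists_gate_closure hB hσ hK hK h, hφ.ae_mem hB hσ hne hM,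
      hψ.ae_mem hB hσ hne hM] with w hw h1 h2
    obtain ⟨C, q, -, hMC, hKC, -⟩ := hw
    rw [coe_hull_pair] at hKC
    have h3 : φ w = q := hKC ⟨subset_hull _ (by simp), hMC h1⟩
    have h4 : ψ w = q := hKC ⟨subset_hull _ (by simp), hMC h2⟩
    rw [h3, h4]
  · refine absurd (isElementary_of_ae_hull hM.toIsEquivariantFamily ?_) hne
    apply ae_omega_of_ae_prod (ν := ν)
    filter_upwards [hM.subset_of_ae_inter hB hK h, hφ.ae_mem hB hσ hne hM,
      hψ.ae_mem hB hσ hne hM] with w hw h1 h2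
    rw [coe_hull_pair] at hw
    exact ⟨φ w, ψ w, hw.antisymm (hull_subset (hM.isSubcontinuum _) (pair_subset h1 h2))⟩

theorem IsFurstenbergMap.congr (hB : IsBoundary Γ ν) (hφ : IsFurstenbergMap ν μ σ φ)
    (hψ : Measurable ψ) (h : ψ =ᵐ[ν.prod μ] φ) : IsFurstenbergMap ν μ σ ψ where
  measurable := hψ
  equivariant γ := by
    filter_upwards [hφ.equivariant γ, h, (quasiMeasurePreserving_smul_prod hB.quasiInvariant
      quasiMeasurePreserving_smul_omega γ).ae h] with w h1 h2 h3
    exact h3.trans (h1.trans (by rw [h2]))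

theorem IsFurstenbergMap.exists_slices_ends (hB : IsBoundary Γ ν)
    (hσ : IsVirtualDendroMorphism μ σ) (hne : ¬ IsElementary μ σ) (hM : IsMinimalFamily μ σ M)
    (hφ : IsFurstenbergMap ν μ σ φ) : ∃ ψ : B × Ω → X, IsFurstenbergMap ν μ σ ψ ∧
      ∀ᵐ s ∂μ, ∀ b : B, ψ (b, s) ∈ ends (M s : Set X) := by
  classical
  obtain ⟨T, hT, hTm, hT0⟩ := exists_measurable_superset_of_null (hφ.ae_mem_ends hB hσ hne hM)
  have hTae : ∀ᵐ w ∂(ν.prod μ), w ∉ T := measure_eq_zero_iff_ae_notMem.1 hT0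
  have hends : ∀ w, w ∉ T → φ w ∈ ends (M w.2 : Set X) := fun w hw => by
    by_contra h
    exact hw (hT h)
  obtain ⟨b₀, hb₀⟩ := (Measure.ae_ae_of_ae_prod hTae).exists
  -- On the null set `T` the value is borrowed from one generic `b₀`, so for almost every `s` the
  -- whole slice, not only almost all of it, takes values in the ends.
  refine ⟨fun w => if w ∈ T then φ (b₀, w.2) else φ w, hφ.congr hB ?_ ?_, ?_⟩
  · exact Measurable.ite hTm (hφ.measurable.comp (by fun_prop)) hφ.measurable
  · filter_upwards [hTae] with w hw
    rw [if_neg hw]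
  · filter_upwards [hb₀] with s hs b
    by_cases h : (b, s) ∈ T
    · simpa [h] using hends _ hs
    · simpa [h] using hends _ h

/-! ### Furstenberg maps from equivariant families of probability measures -/

theorem core_nonempty_of_half {m : Measure X} [IsProbabilityMeasure m] :
    (core fun D : Set X => 1 / 2 < m D).Nonempty := by
  refine core_nonempty fun D E hD hE h h' => ?_
  by_contra hemp
  have hd : Disjoint D E := disjoint_iff_inter_eq_empty.2 (not_nonempty_iff_eq_empty.1 hemp)
  have h1 : m (D ∪ E) = m D + m E := measure_union hd hE.isClosed.measurableSet
  have h2 : m (D ∪ E) ≤ 1 := prob_le_one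
  rw [h1] at h2
  have h3 : (1 / 2 : ENNReal) + 1 / 2 < m D + m E := ENNReal.add_lt_add h h'
  rw [ENNReal.add_halves] at h3
  exact absurd h2 (not_le.2 h3)

/-- A branch point `p` of `D` between `x`, `y` and `z` can be cut off from each of them. The three
halves away from `p` have mass at least `1/2` and are pairwise disjoint, since the union of two
meeting ones would be a continuum containing `p`. -/
theorem exists_eq_hull_pair_of_subset_core {m : Measure X} [IsProbabilityMeasure m] {D : Set X}
    (hD : IsSubcontinuum D) (hne : D.Nonempty) (h : D ⊆ core fun E : Set X => 1 / 2 < m E) :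
    ∃ x y, D = hull {x, y} := by
  refine exists_eq_hull_pair hD hne fun x hx y hy z hz p hxy hyz hxz => ?_
  by_contra hp
  simp only [not_or] at hp
  have key : ∀ a ∈ D, p ≠ a → ∃ E : Set X, IsSubcontinuum E ∧ a ∈ E ∧ p ∉ E ∧ 1 / 2 ≤ m E := by
    intro a ha hpa
    obtain ⟨c, U, V, hU, hV, hd, huv, hpU, haV⟩ := PointSeparated.separated p a hpa
    have huv' : V ∪ U = {c}ᶜ := by rw [union_comm, huv]
    have hcU : c ∉ U := fun hc => by
      have : c ∈ ({c} : Set X)ᶜ := huv ▸ Or.inl hc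
      exact this rfl
    have hcV : c ∉ V := fun hc => by
      have : c ∈ ({c} : Set X)ᶜ := huv ▸ Or.inr hc
      exact this rfl
    have hEV := isSubcontinuum_insert_cut hV hU hd.symm huv'
    have hEU := isSubcontinuum_insert_cut hU hV hd huv
    refine ⟨insert c V, hEV, Or.inr haV, ?_, ?_⟩
    · rintro (rfl | h')
      · exact hcU hpU
      · exact disjoint_left.1 hd hpU h'
    -- The half containing `p` misses the point `a` of the core, so its mass cannot exceed `1/2`.
    · have h1 : m (insert c U) ≤ 1 / 2 := by
        by_contra hlt
        rcases h ha _ ⟨hEU, not_le.1 hlt⟩ with rfl | h'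
        · exact hcV haV
        · exact disjoint_left.1 hd h' haV
      have h2 : (1 : ENNReal) ≤ 1 / 2 + m (insert c V) := by
        calc (1 : ENNReal) = m univ := measure_univ.symm
          _ ≤ m (insert c U ∪ insert c V) := measure_mono fun y _ => by
              by_cases hy : y = c
              · exact Or.inl (Or.inl hy)
              · have : y ∈ U ∪ V := huv ▸ hy
                exact this.imp Or.inr Or.inr
          _ ≤ m (insert c U) + m (insert c V) := measure_union_le _ _
          _ ≤ 1 / 2 + m (insert c V) := by gcongr
      have h3 : (1 / 2 : ENNReal) + 1 / 2 ≤ 1 / 2 + m (insert c V) := by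
        rwa [ENNReal.add_halves]
      exact (ENNReal.add_le_add_iff_left (by simp)).1 h3
  obtain ⟨E₁, h11, h12, h13, h14⟩ := key x hx hp.1
  obtain ⟨E₂, h21, h22, h23, h24⟩ := key y hy hp.2.1
  obtain ⟨E₃, h31, h32, h33, h34⟩ := key z hz hp.2.2
  have hdisj : ∀ {E F : Set X} {a b : X}, IsSubcontinuum E → IsSubcontinuum F → a ∈ E → b ∈ F →
      p ∉ E → p ∉ F → p ∈ hull {a, b} → Disjoint E F := by
    intro E F a b hE hF ha hb hpE hpF hp
    rw [disjoint_iff_inter_eq_empty, ← not_nonempty_iff_eq_empty]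
    intro hEF
    rcases hull_subset (hE.union hF hEF) (pair_subset (Or.inl ha) (Or.inr hb)) hp with h' | h'
    · exact hpE h'
    · exact hpF h'
  have d12 := hdisj h11 h21 h12 h22 h13 h23 hxy
  have d23 := hdisj h21 h31 h22 h32 h23 h33 hyz
  have d13 := hdisj h11 h31 h12 h32 h13 h33 hxz
  have hsum : m (E₁ ∪ E₂ ∪ E₃) = m E₁ + m E₂ + m E₃ := by
    rw [measure_union (disjoint_union_left.2 ⟨d13, d23⟩) h31.isClosed.measurableSet,
      measure_union d12 h21.isClosed.measurableSet]
  have h1 : m E₁ + m E₂ + m E₃ ≤ 1 := hsum ▸ prob_le_one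
  have h2 : (1 : ENNReal) + 1 / 2 ≤ m E₁ + m E₂ + m E₃ := by
    have := add_le_add (add_le_add h14 h24) h34
    rwa [ENNReal.add_halves] at this
  have h3 := h2.trans h1
  have h4 : (1 : ENNReal) + 1 / 2 ≤ 1 + 0 := by simpa using h3
  have h5 := (ENNReal.add_le_add_iff_left (by simp)).1 h4
  simp at h5

theorem exists_boundaryFamily {P : B × Ω → Set X → Prop} (hB : IsBoundary Γ ν)
    (hmono : ∀ w D E, D ⊆ E → P w D → P w E)
    (hne : ∀ᵐ w ∂(ν.prod μ), ¬ P w ∅ ∧ (core (P w)).Nonempty)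
    (hmeas : ∀ n, MeasurableSet {w | P w (net X n)})
    (heq : ∀ γ : Γ, ∀ᵐ w ∂(ν.prod μ), ∀ D, IsSubcontinuum D →
      (P w D ↔ P (γ • w) (σ γ w.2 '' D))) :
    ∃ κ : B × Ω → NonemptyCompacts X, IsBoundaryFamily ν μ σ κ ∧
      ∀ᵐ w ∂(ν.prod μ), (κ w : Set X) = core (P w) := by
  obtain ⟨κ, h1, h2, h3, h4⟩ := exists_core_family (c := fun γ w => σ γ w.2)
    (quasiMeasurePreserving_smul_prod hB.quasiInvariant quasiMeasurePreserving_smul_omega)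
    hmono hne hmeas heq
  exact ⟨κ, ⟨h1, h4, h2⟩, h3⟩

theorem IsBoundaryFamily.exists_furstenbergMap {κ : B × Ω → NonemptyCompacts X}
    (hB : IsBoundary Γ ν) (hκ : IsBoundaryFamily ν μ σ κ)
    (h : ∀ᵐ w ∂(ν.prod μ), ∃ q, (κ w : Set X) = {q}) :
    ∃ φ : B × Ω → X, IsFurstenbergMap ν μ σ φ := by
  classical
  obtain ⟨T, hT, hTm, hT0⟩ := exists_measurable_superset_of_null h
  have hTae : ∀ᵐ w ∂(ν.prod μ), w ∉ T := measure_eq_zero_iff_ae_notMem.1 hT0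
  obtain ⟨x₀⟩ := (inferInstance : Nonempty X)
  have hq : ∀ w, ∃ q : X, (if w ∈ T then {x₀} else κ w) = ({q} : NonemptyCompacts X) := fun w => by
    by_cases hw : w ∈ T
    · exact ⟨x₀, by simp [hw]⟩
    · have : ∃ q, (κ w : Set X) = {q} := by
        by_contra h'
        exact hw (hT h')
      obtain ⟨q, hq⟩ := this
      refine ⟨q, ?_⟩
      rw [if_neg hw]
      exact SetLike.coe_injective (by simpa using hq)
  choose φ hφ using hq
  have hφκ : ∀ᵐ w ∂(ν.prod μ), κ w = {φ w} := by
    filter_upwards [hTae] with w hw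
    rw [← hφ w, if_neg hw]
  refine ⟨φ, ⟨?_, fun γ => ?_⟩⟩
  · rw [← measurable_singletonCL]
    simp only [← hφ]
    exact Measurable.ite hTm measurable_const hκ.measurable
  · filter_upwards [hφκ, (quasiMeasurePreserving_smul_prod hB.quasiInvariant
      quasiMeasurePreserving_smul_omega γ).ae hφκ, hκ.equivariant γ] with w h1 h2 h3
    rw [h1, h2, mapCL_singleton] at h3
    exact NonemptyCompacts.isClosedEmbedding_singleton.injective h3

/-- The core `J w` of the sets of mass greater than `1/2` is non-empty, two such sets always
meeting. If the sets `J` are disjoint, their gates towards one another form the Furstenberg map. If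
they meet, `M s ⊆ J w` is an arc or a point, against non-elementarity. -/
theorem exists_furstenbergMap_of_measure (hB : IsBoundary Γ ν) (hσ : IsVirtualDendroMorphism μ σ)
    (hne : ¬ IsElementary μ σ) (hM : IsMinimalFamily μ σ M) {m : B × Ω → Measure X}
    (hm : Measurable m) (hprob : ∀ w, IsProbabilityMeasure (m w))
    (heq : ∀ γ : Γ, ∀ᵐ w ∂(ν.prod μ), m (γ • w) = (m w).map (σ γ w.2)) :
    ∃ φ : B × Ω → X, IsFurstenbergMap ν μ σ φ := by
  obtain ⟨J, hJ, hJc⟩ := exists_boundaryFamily (σ := σ) (μ := μ) hB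
    (P := fun w D => 1 / 2 < m w D)
    (fun w D E h h' => h'.trans_le (measure_mono h))
    (Filter.Eventually.of_forall fun w => ⟨by simp, core_nonempty_of_half⟩)
    (fun n => measurableSet_lt measurable_const
      ((Measure.measurable_coe (isSubcontinuum_net n).isClosed.measurableSet).comp hm))
    (fun γ => by
      filter_upwards [heq γ] with w hw D hD
      rw [hw, Measure.map_apply (σ γ w.2).continuous.measurable
        (hD.image _).isClosed.measurableSet, preimage_image_eq _ (σ γ w.2).injective])
  rcases disjoint_or_not hB hJ hJ with h | h
  · have hgate := hM.exists_gate_closure hB hσ hJ hJ h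
    obtain ⟨κ, hκ, hκc⟩ := exists_boundaryFamily (σ := σ) (μ := μ) hB
      (P := fun w D => AeGatePred ν (J w : Set X) (fun b => (J (b, w.2) : Set X)) D)
      (fun w D E h h' => h'.imp (fun h' => h'.trans h) fun h' =>
        ⟨h'.1.mono (inter_subset_inter_left _ h), h'.2.mono fun b hb => hb.trans h⟩)
      (by
        filter_upwards [hgate] with w hw
        obtain ⟨C, q, -, -, -, -, hq⟩ := hw
        refine ⟨?_, by simp [hq]⟩
        rintro (h' | ⟨h', -⟩)
        · exact (J w).nonempty.ne_empty (subset_empty_iff.1 h')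
        · simp at h')
      (fun n => by
        refine (measurableSet_subset hJ.measurable (isSubcontinuum_net n).isClosed).union ?_
        have h1 : MeasurableSet {w | (net X n ∩ (J w : Set X)).Nonempty} := by
          simpa only [inter_comm (net X n)] using
            measurableSet_inter_nonempty hJ.measurable (isSubcontinuum_net n).isClosed
        exact h1.inter (measurable_snd
          (hJ.measurableSet_ae_subset (isSubcontinuum_net (X := X) n).isClosed)))
      (fun γ => by
        filter_upwards [hJ.equivariant γ,
          Measure.quasiMeasurePreserving_snd.ae (hJ.ae_subset_iff hB id γ)] with w h1 h2 D hD
        have h2' := h2 D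
        simp only [id_eq] at h2'
        simp only [AeGatePred, h1, coe_mapCL, image_subset_image_iff', image_inter_nonempty_iff,
          Prod.smul_snd, h2'])
    refine hκ.exists_furstenbergMap hB ?_
    filter_upwards [hκc, hgate] with w h1 h2
    obtain ⟨C, q, -, -, -, -, hq⟩ := h2
    exact ⟨q, h1.trans hq⟩
  · refine absurd (isElementary_of_ae_hull hM.toIsEquivariantFamily ?_) hne
    apply ae_omega_of_ae_prod (ν := ν)
    filter_upwards [hM.subset_of_ae_inter hB hJ h, hJc] with w h1 h2
    rw [h2] at h1
    exact exists_eq_hull_pair_of_subset_core (hM.isSubcontinuum _) (M w.2).nonempty h1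

end Furstenberg
end Dendro

namespace Dendro

/-! ### The action on integrable families of continuous functions -/

section Transport

open Set

attribute [local instance] borelCL borelHomeo topHomeo

variable {Γ Ω X : Type u} [Group Γ] [Countable Γ]
  [MeasurableSpace Ω] [StandardBorelSpace Ω] [MulAction Γ Ω] [MeasurableConstSMul Γ Ω]
  {μ : Measure Ω} [IsProbabilityMeasure μ] [ErgodicSMul Γ Ω μ]
  [TopologicalSpace X] [CompactSpace X] [T2Space X] [SecondCountableTopology X]
  [PointSeparated X] [ConnectedSpace X] {σ : Γ → Ω → (X ≃ₜ X)}

/-- The transport of a family of continuous functions by a group element. -/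
def transport (σ : Γ → Ω → (X ≃ₜ X)) (γ : Γ) (F : Ω → C(X, ℝ)) (s : Ω) : C(X, ℝ) :=
  (F (γ⁻¹ • s)).comp (σ γ⁻¹ s : C(X, X))

theorem transport_apply (γ : Γ) (F : Ω → C(X, ℝ)) (s : Ω) (x : X) :
    transport σ γ F s x = F (γ⁻¹ • s) (σ γ⁻¹ s x) := rfl

theorem norm_transport (γ : Γ) (F : Ω → C(X, ℝ)) (s : Ω) :
    ‖transport σ γ F s‖ = ‖F (γ⁻¹ • s)‖ := by
  apply le_antisymm
  · rw [ContinuousMap.norm_le _ (norm_nonneg _)]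
    intro x
    rw [transport_apply]
    exact (F (γ⁻¹ • s)).norm_coe_le_norm _
  · rw [ContinuousMap.norm_le _ (norm_nonneg _)]
    intro x
    obtain ⟨y, rfl⟩ := (σ γ⁻¹ s).surjective x
    rw [← transport_apply]
    exact (transport σ γ F s).norm_coe_le_norm y

theorem transport_congr {F G : Ω → C(X, ℝ)} (h : F =ᵐ[μ] G) (γ : Γ) :
    transport σ γ F =ᵐ[μ] transport σ γ G := by
  filter_upwards [(quasiMeasurePreserving_smul_omega γ⁻¹).ae h] with s hs
  simp only [transport, hs]

theorem aestronglyMeasurable_transport (hσ : IsVirtualDendroMorphism μ σ) (γ : Γ)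
    {F : Ω → C(X, ℝ)} (hF : AEStronglyMeasurable F μ) :
    AEStronglyMeasurable (transport σ γ F) μ := by
  let := metrizableSpaceMetric X
  let : MeasurableSpace C(X, X) := borel _
  have : BorelSpace C(X, X) := ⟨rfl⟩
  have h1 : StronglyMeasurable fun s => (σ γ⁻¹ s : C(X, X)) := by
    refine Measurable.stronglyMeasurable ?_
    have hc : Continuous fun g : X ≃ₜ X => (g : C(X, X)) := continuous_induced_dom
    have := borelSpace_homeo (X := X)
    exact hc.measurable.comp (hσ.measurable γ⁻¹)
  exact ContinuousMap.continuous_comp'.comp_aestronglyMeasurable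
    (h1.aestronglyMeasurable.prodMk
      (hF.comp_quasiMeasurePreserving (quasiMeasurePreserving_smul_omega γ⁻¹)))

theorem eLpNorm_transport (γ : Γ) {F : Ω → C(X, ℝ)} (hF : AEStronglyMeasurable F μ) :
    eLpNorm (transport σ γ F) 1 μ = eLpNorm F 1 μ := by
  rw [eLpNorm_congr_norm_ae (g := F ∘ (γ⁻¹ • ·))
    (Filter.Eventually.of_forall fun s => norm_transport γ F s)]
  exact eLpNorm_comp_measurePreserving hF (measurePreserving_smul γ⁻¹ μ)

theorem memLp_transport (hσ : IsVirtualDendroMorphism μ σ) (γ : Γ) {F : Ω → C(X, ℝ)}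
    (hF : MemLp F 1 μ) : MemLp (transport σ γ F) 1 μ :=
  ⟨aestronglyMeasurable_transport hσ γ hF.1, by rw [eLpNorm_transport γ hF.1]; exact hF.2⟩

/-- The transport of integrable families. -/
noncomputable def transportLp (hσ : IsVirtualDendroMorphism μ σ) (γ : Γ) (F : Lp C(X, ℝ) 1 μ) :
    Lp C(X, ℝ) 1 μ := (memLp_transport hσ γ (Lp.memLp F)).toLp _

theorem coeFn_transportLp (hσ : IsVirtualDendroMorphism μ σ) (γ : Γ) (F : Lp C(X, ℝ) 1 μ) :
    transportLp hσ γ F =ᵐ[μ] transport σ γ F := MemLp.coeFn_toLp _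

theorem transportLp_toLp (hσ : IsVirtualDendroMorphism μ σ) (γ : Γ) {F : Ω → C(X, ℝ)}
    (hF : MemLp F 1 μ) : transportLp hσ γ (hF.toLp F) = (memLp_transport hσ γ hF).toLp _ :=
  (MemLp.toLp_eq_toLp_iff _ _).2 (transport_congr hF.coeFn_toLp γ)

theorem transportLp_add (hσ : IsVirtualDendroMorphism μ σ) (γ : Γ) (F G : Lp C(X, ℝ) 1 μ) :
    transportLp hσ γ (F + G) = transportLp hσ γ F + transportLp hσ γ G := by
  apply Lp.ext
  filter_upwards [coeFn_transportLp hσ γ (F + G), coeFn_transportLp hσ γ F,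
    coeFn_transportLp hσ γ G, Lp.coeFn_add (transportLp hσ γ F) (transportLp hσ γ G),
    transport_congr (σ := σ) (Lp.coeFn_add F G) γ] with s h1 h2 h3 h4 h5
  rw [h1, h4, h5, Pi.add_apply, h2, h3]
  rfl

theorem transportLp_smul (hσ : IsVirtualDendroMorphism μ σ) (γ : Γ) (c : ℝ)
    (F : Lp C(X, ℝ) 1 μ) : transportLp hσ γ (c • F) = c • transportLp hσ γ F := by
  apply Lp.ext
  filter_upwards [coeFn_transportLp hσ γ (c • F), coeFn_transportLp hσ γ F,
    Lp.coeFn_smul c (transportLp hσ γ F), transport_congr (σ := σ) (Lp.coeFn_smul c F) γ]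
    with s h1 h2 h3 h4
  rw [h1, h3, h4, Pi.smul_apply, h2]
  rfl

theorem norm_transportLp (hσ : IsVirtualDendroMorphism μ σ) (γ : Γ) (F : Lp C(X, ℝ) 1 μ) :
    ‖transportLp hσ γ F‖ = ‖F‖ := by
  rw [transportLp, Lp.norm_toLp, eLpNorm_transport γ (Lp.aestronglyMeasurable F), Lp.norm_def]

theorem transportLp_mul (hσ : IsVirtualDendroMorphism μ σ) (γ₁ γ₂ : Γ) (F : Lp C(X, ℝ) 1 μ) :
    transportLp hσ (γ₁ * γ₂) F = transportLp hσ γ₁ (transportLp hσ γ₂ F) := by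
  apply Lp.ext
  filter_upwards [coeFn_transportLp hσ (γ₁ * γ₂) F,
    coeFn_transportLp hσ γ₁ (transportLp hσ γ₂ F),
    transport_congr (σ := σ) (coeFn_transportLp hσ γ₂ F) γ₁, hσ.cocycle γ₂⁻¹ γ₁⁻¹]
    with s h1 h2 h3 h4
  rw [h1, h2, h3]
  ext x
  simp only [transport_apply, mul_inv_rev, mul_smul, h4]
  rfl

theorem transportLp_one (hσ : IsVirtualDendroMorphism μ σ) (F : Lp C(X, ℝ) 1 μ) :
    transportLp hσ 1 F = F := by
  apply Lp.ext
  filter_upwards [coeFn_transportLp hσ 1 F, hσ.ae_one] with s h1 h2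
  rw [h1]
  ext x
  simp only [transport_apply, inv_one, one_smul, h2]
  rfl

/-- The isometric action on integrable families of continuous functions. -/
noncomputable def transportIsometry (hσ : IsVirtualDendroMorphism μ σ) (γ : Γ) :
    Lp C(X, ℝ) 1 μ ≃ₗᵢ[ℝ] Lp C(X, ℝ) 1 μ where
  toFun := transportLp hσ γ
  invFun := transportLp hσ γ⁻¹
  map_add' := transportLp_add hσ γ
  map_smul' := transportLp_smul hσ γ
  left_inv F := by rw [← transportLp_mul, inv_mul_cancel, transportLp_one]
  right_inv F := by rw [← transportLp_mul, mul_inv_cancel, transportLp_one]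
  norm_map' := norm_transportLp hσ γ

theorem transportIsometry_apply (hσ : IsVirtualDendroMorphism μ σ) (γ : Γ)
    (F : Lp C(X, ℝ) 1 μ) : transportIsometry hσ γ F = transportLp hσ γ F := rfl

/-- The constant family `1`. -/
noncomputable def oneLp (μ : Measure Ω) [IsProbabilityMeasure μ] (X : Type u) [TopologicalSpace X]
    [CompactSpace X] : Lp C(X, ℝ) 1 μ := (memLp_const (1 : C(X, ℝ))).toLp _

theorem transportLp_oneLp (hσ : IsVirtualDendroMorphism μ σ) (γ : Γ) :
    transportLp hσ γ (oneLp μ X) = oneLp μ X := by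
  rw [oneLp, transportLp_toLp]
  rfl

theorem norm_oneLp : ‖oneLp μ X‖ = 1 := by
  rw [oneLp, Lp.norm_toLp, eLpNorm_const _ one_ne_zero (IsProbabilityMeasure.ne_zero μ)]
  simp

/-- The states on the space of integrable families of continuous functions. -/
def states (μ : Measure Ω) [IsProbabilityMeasure μ] (X : Type u) [TopologicalSpace X]
    [CompactSpace X] : Set (WeakDual ℝ (Lp C(X, ℝ) 1 μ)) :=
  {ξ | (∀ e, |ξ e| ≤ ‖e‖) ∧ ξ (oneLp μ X) = 1}

theorem states_nonempty : (states μ X).Nonempty := by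
  have h1 : oneLp μ X ≠ 0 := by
    rw [← norm_ne_zero_iff, norm_oneLp]; exact one_ne_zero
  obtain ⟨g, hg, hg'⟩ := exists_dual_vector ℝ (oneLp μ X) (norm_ne_zero_iff.2 h1)
  refine ⟨StrongDual.toWeakDual g, fun e => ?_, ?_⟩
  · have := g.le_opNorm e
    rwa [hg, one_mul] at this
  · rw [norm_oneLp] at hg'
    simpa using hg'

theorem isClosed_states : IsClosed (states μ X) := by
  have : states μ X = (⋂ e, {ξ | |ξ e| ≤ ‖e‖}) ∩ {ξ | ξ (oneLp μ X) = 1} := by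
    ext; simp [states]
  rw [this]
  refine (isClosed_iInter fun e => ?_).inter ?_
  · exact isClosed_le (WeakDual.eval_continuous e).abs continuous_const
  · exact isClosed_eq (WeakDual.eval_continuous _) continuous_const

theorem isCompact_states : IsCompact (states μ X) := by
  refine (WeakDual.isCompact_closedBall 0 1).of_isClosed_subset isClosed_states fun ξ hξ => ?_
  simp only [mem_preimage, mem_closedBall_zero_iff]
  exact ContinuousLinearMap.opNorm_le_bound _ zero_le_one fun e => by
    rw [one_mul]; exact hξ.1 e

theorem convex_states : Convex ℝ (states μ X) := by
  intro ξ hξ ξ' hξ' a b ha hb hab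
  refine ⟨fun e => ?_, ?_⟩
  · change |a * ξ e + b * ξ' e| ≤ ‖e‖
    calc |a * ξ e + b * ξ' e| ≤ |a * ξ e| + |b * ξ' e| := abs_add_le _ _
      _ = a * |ξ e| + b * |ξ' e| := by rw [abs_mul, abs_mul, abs_of_nonneg ha, abs_of_nonneg hb]
      _ ≤ a * ‖e‖ + b * ‖e‖ := by gcongr; exacts [hξ.1 e, hξ'.1 e]
      _ = ‖e‖ := by rw [← add_mul, hab, one_mul]
  · change a * ξ _ + b * ξ' _ = 1
    rw [hξ.2, hξ'.2, mul_one, mul_one, hab]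

variable {B : Type u} [MeasurableSpace B] [StandardBorelSpace B] [MulAction Γ B]
  [MeasurableConstSMul Γ B] {ν : Measure B} [SigmaFinite ν] [NeZero ν]

/-- The dependence on `Ω` is absorbed into the Banach space `L¹(Ω, C(X))`, on which `Γ` acts by
isometries. Amenability is thus needed only for a cocycle and a field of compact convex sets that
are constant in `b`. -/
theorem exists_equivariant_states (hB : IsBoundary Γ ν)
    (hσ : IsVirtualDendroMorphism μ σ) :
    ∃ ξ : B → WeakDual ℝ (Lp C(X, ℝ) 1 μ), (∀ e, Measurable fun b => ξ b e) ∧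
      (∀ b, ξ b ∈ states μ X) ∧
      ∀ γ : Γ, ∀ᵐ b ∂ν, ∀ e, ξ (γ • b) (transportLp hσ γ e) = ξ b e := by
  classical
  have : Fact ((1 : ENNReal) ≠ ⊤) := ⟨ENNReal.one_ne_top⟩
  have : SeparableSpace (Lp C(X, ℝ) 1 μ) := inferInstance
  let : MeasurableSpace (WeakDual ℝ (Lp C(X, ℝ) 1 μ)) := borel _
  have : BorelSpace (WeakDual ℝ (Lp C(X, ℝ) 1 μ)) := ⟨rfl⟩
  obtain ⟨ξ, hξ, hξA, hξe⟩ := hB.amenable (Lp C(X, ℝ) 1 μ) (fun γ _ => transportIsometry hσ γ)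
    (fun _ => states μ X) (fun γ e => measurable_const)
    (fun γ₁ γ₂ => Filter.Eventually.of_forall fun b => by
      ext1 F
      exact transportLp_mul hσ γ₁ γ₂ F)
    (fun b => ⟨states_nonempty, isCompact_states, convex_states, fun f hf => hf.1⟩)
    (measurable_snd isClosed_states.measurableSet)
    (fun γ => Filter.Eventually.of_forall fun b f g hfg => by
      refine and_congr ⟨fun h e => ?_, fun h e => ?_⟩ ?_
      · obtain ⟨e, rfl⟩ := (transportIsometry hσ γ).surjective e
        rw [hfg, LinearIsometryEquiv.norm_map]
        exact h e
      · rw [← hfg, ← (transportIsometry hσ γ).norm_map]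
        exact h _
      · rw [← hfg, transportIsometry_apply, transportLp_oneLp])
  obtain ⟨ξ₀, hξ₀⟩ := states_nonempty (μ := μ) (X := X)
  have hT : MeasurableSet {b | ξ b ∈ states μ X} := hξ isClosed_states.measurableSet
  -- The values outside the states, taken on a null set, are replaced by a fixed state so that every
  -- `b` can be represented by a measure.
  let ξ' : B → WeakDual ℝ (Lp C(X, ℝ) 1 μ) := fun b => if ξ b ∈ states μ X then ξ b else ξ₀
  have hae : ∀ᵐ b ∂ν, ξ' b = ξ b := by
    filter_upwards [hξA] with b hb using if_pos hb
  refine ⟨ξ', fun e => ?_, fun b => ?_, fun γ => ?_⟩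
  · have : Measurable ξ' := Measurable.ite hT hξ measurable_const
    exact (WeakDual.eval_continuous e).measurable.comp this
  · by_cases hb : ξ b ∈ states μ X
    · simp [ξ', hb]
    · simpa [ξ', hb] using hξ₀
  · filter_upwards [hξe γ, hae, (hB.quasiInvariant γ).ae hae] with b h1 h2 h3 e
    rw [h2, h3]
    exact h1 e

end Transport
end Dendro

namespace Dendro

/-! ### Representation of states by measures -/

section Representation

open Set

variable {Ω X : Type u} [MeasurableSpace Ω] [StandardBorelSpace Ω]
  {μ : Measure Ω} [IsProbabilityMeasure μ]
  [TopologicalSpace X] [CompactSpace X] [T2Space X] [SecondCountableTopology X]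

theorem toL1_one : (integrable_const (1 : C(X, ℝ))).toL1 _ = oneLp μ X := rfl

theorem abs_state_le {ξ : WeakDual ℝ (Lp C(X, ℝ) 1 μ)} (hξ : ξ ∈ states μ X) {F : Ω → C(X, ℝ)}
    (hF : Integrable F μ) : |ξ (hF.toL1 F)| ≤ ∫ s, ‖F s‖ ∂μ := by
  rw [← L1.norm_of_fun_eq_integral_norm hF]
  exact hξ.1 _

/-- Evaluating a state on `c - F` turns the norm bound into a one-sided estimate. Positivity of
states and the identification of their marginal both come from it. -/
theorem state_const_sub {ξ : WeakDual ℝ (Lp C(X, ℝ) 1 μ)} (hξ : ξ ∈ states μ X)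
    {F : Ω → C(X, ℝ)} (hF : Integrable F μ) (c : ℝ) :
    c - ξ (hF.toL1 F) ≤ ∫ s, ‖c • (1 : C(X, ℝ)) - F s‖ ∂μ := by
  have h1 := (integrable_const (μ := μ) (1 : C(X, ℝ)))
  have h := abs_state_le hξ ((h1.smul c).sub hF)
  rw [Integrable.toL1_sub _ _ (h1.smul c) hF, Integrable.toL1_smul' _ h1, toL1_one, map_sub,
    map_smul, hξ.2, smul_eq_mul, mul_one] at h
  exact (le_abs_self _).trans h

theorem state_nonneg {ξ : WeakDual ℝ (Lp C(X, ℝ) 1 μ)} (hξ : ξ ∈ states μ X)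
    {F : Ω → C(X, ℝ)} (hF : Integrable F μ) {c : ℝ} (hc : 0 ≤ c) (h0 : ∀ s x, 0 ≤ F s x)
    (h1 : ∀ s x, F s x ≤ c) : 0 ≤ ξ (hF.toL1 F) := by
  have h2 : ∫ s, ‖c • (1 : C(X, ℝ)) - F s‖ ∂μ ≤ c := by
    have h3 : ∀ s, ‖c • (1 : C(X, ℝ)) - F s‖ ≤ c := fun s => by
      rw [ContinuousMap.norm_le _ hc]
      intro x
      have := h0 s x
      have := h1 s x
      simp only [ContinuousMap.sub_apply, ContinuousMap.smul_apply, ContinuousMap.one_apply,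
        smul_eq_mul, mul_one, Real.norm_eq_abs]
      rw [abs_le]; constructor <;> linarith
    have := integral_mono_of_nonneg (μ := μ) (Filter.Eventually.of_forall fun s => norm_nonneg _)
      (integrable_const c) (Filter.Eventually.of_forall h3)
    simpa using this
  have := state_const_sub hξ hF c
  linarith

variable {e : Ω → (ℕ → Bool)}

theorem integrable_comp_continuous (he : Measurable e) {Y : Type*} [NormedAddCommGroup Y]
    [SecondCountableTopology Y] (g : C(ℕ → Bool, Y)) : Integrable (fun s => g (e s)) μ := by
  let : MeasurableSpace Y := borel _
  have : BorelSpace Y := ⟨rfl⟩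
  refine (integrable_const ‖g‖).mono' (g.continuous.measurable.comp he).aestronglyMeasurable
    (Filter.Eventually.of_forall fun s => g.norm_coe_le_norm _)

/-- The functional on continuous functions on a compact model of `Ω × X` given by a state. -/
noncomputable def stateFunctional (he : Measurable e) (ξ : WeakDual ℝ (Lp C(X, ℝ) 1 μ)) :
    C((ℕ → Bool) × X, ℝ) →ₗ[ℝ] ℝ where
  toFun f := ξ ((integrable_comp_continuous he f.curry).toL1 _)
  map_add' f g := by
    rw [← map_add, ← Integrable.toL1_add]; rfl
  map_smul' c f := by
    rw [← map_smul, ← Integrable.toL1_smul]; rfl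

theorem stateFunctional_apply (he : Measurable e) (ξ : WeakDual ℝ (Lp C(X, ℝ) 1 μ))
    (f : C((ℕ → Bool) × X, ℝ)) : stateFunctional he ξ f =
      ξ ((integrable_comp_continuous he f.curry).toL1 fun s => f.curry (e s)) := rfl

theorem stateFunctional_nonneg (he : Measurable e) {ξ : WeakDual ℝ (Lp C(X, ℝ) 1 μ)}
    (hξ : ξ ∈ states μ X) (f : C((ℕ → Bool) × X, ℝ)) (hf : ∀ z, 0 ≤ f z) :
    0 ≤ stateFunctional he ξ f :=
  state_nonneg hξ _ (norm_nonneg f) (fun _ _ => hf _)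
    fun _ _ => (le_abs_self _).trans (f.norm_coe_le_norm _)

/-- The inclusion of the functions with compact support, on a compact space. -/
def compactSupportToMap (Z : Type*) [TopologicalSpace Z] :
    CompactlySupportedContinuousMap Z ℝ →ₗ[ℝ] C(Z, ℝ) where
  toFun f := f.toContinuousMap
  map_add' _ _ := rfl
  map_smul' _ _ := rfl

theorem exists_measure_of_positive {Z : Type*} [TopologicalSpace Z] [CompactSpace Z] [T2Space Z]
    [MeasurableSpace Z] [BorelSpace Z] (Λ : C(Z, ℝ) →ₗ[ℝ] ℝ)
    (hΛ : ∀ f : C(Z, ℝ), (∀ z, 0 ≤ f z) → 0 ≤ Λ f) (h1 : Λ 1 = 1) :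
    ∃ ρ : Measure Z, IsProbabilityMeasure ρ ∧ ∀ f : C(Z, ℝ), ∫ z, f z ∂ρ = Λ f := by
  let Λ' : CompactlySupportedContinuousMap Z ℝ →ₚ[ℝ] ℝ :=
    PositiveLinearMap.mk₀ (Λ ∘ₗ compactSupportToMap Z) fun f hf => hΛ _ fun z => hf z
  have hint : ∀ f : C(Z, ℝ), ∫ z, f z ∂(RealRMK.rieszMeasure Λ') = Λ f := fun f =>
    RealRMK.integral_rieszMeasure Λ' (CompactlySupportedContinuousMap.continuousMapEquiv f)
  refine ⟨RealRMK.rieszMeasure Λ', ⟨?_⟩, hint⟩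
  have h2 := hint 1
  simp only [ContinuousMap.one_apply, integral_const, smul_eq_mul, mul_one, h1] at h2
  rw [measureReal_def] at h2
  rw [← ENNReal.ofReal_toReal (measure_ne_top (RealRMK.rieszMeasure Λ') univ), h2,
    ENNReal.ofReal_one]

/-- When `k` depends on `s` alone and `|k| ≤ c`, the norm of `c ± k` at `s` is exactly `c ± k (e
s)`. The two signs give the two inequalities. -/
theorem integral_fst_eq (he : Measurable e) {ξ : WeakDual ℝ (Lp C(X, ℝ) 1 μ)}
    (hξ : ξ ∈ states μ X) (k : C(ℕ → Bool, ℝ)) :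
    stateFunctional he ξ (k.comp ContinuousMap.fst) = ∫ s, k (e s) ∂μ := by
  have hki := integrable_comp_continuous (μ := μ) he k
  have key : ∀ c : ℝ, (∀ z, |k z| ≤ c) → ∀ ε : ℝ, |ε| = 1 →
      c + ε * stateFunctional he ξ (k.comp ContinuousMap.fst) ≤ c + ε * ∫ s, k (e s) ∂μ := by
    intro c hc ε hε
    have h := state_const_sub hξ (integrable_comp_continuous he
      ((-ε) • (k.comp ContinuousMap.fst : C((ℕ → Bool) × X, ℝ))).curry) c
    rw [← stateFunctional_apply, map_smul] at h
    have hnorm : ∀ s, ‖c • (1 : C(X, ℝ)) -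
        ((-ε) • (k.comp ContinuousMap.fst : C((ℕ → Bool) × X, ℝ))).curry (e s)‖ ≤
        c + ε * k (e s) := by
      intro s
      have h1 : |ε * k (e s)| ≤ c := by rw [abs_mul, hε, one_mul]; exact hc _
      have h2 := (abs_le.1 h1).1
      rw [ContinuousMap.norm_le _ (by linarith)]
      intro x
      simp only [ContinuousMap.sub_apply, ContinuousMap.smul_apply, ContinuousMap.one_apply,
        smul_eq_mul, mul_one, Real.norm_eq_abs, ContinuousMap.curry_apply, neg_mul,
        ContinuousMap.comp_apply, ContinuousMap.fst_apply, sub_neg_eq_add]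
      rw [abs_of_nonneg (by linarith)]
    have hint : Integrable (fun s => c + ε * k (e s)) μ :=
      (integrable_const c).add (hki.const_mul ε)
    have h3 := integral_mono_of_nonneg (μ := μ)
      (Filter.Eventually.of_forall fun s => norm_nonneg _) hint (Filter.Eventually.of_forall hnorm)
    have h4 : ∫ s, (c + ε * k (e s)) ∂μ = c + ε * ∫ s, k (e s) ∂μ := by
      rw [integral_add (integrable_const c) (hki.const_mul ε), integral_const_mul]
      simp
    rw [h4] at h3
    have h5 := h.trans h3
    simpa using h5
  have h1 := key ‖k‖ (fun z => k.norm_coe_le_norm z) 1 (by simp)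
  have h2 := key ‖k‖ (fun z => k.norm_coe_le_norm z) (-1) (by simp)
  linarith

variable [MeasurableSpace X] [BorelSpace X]

theorem aestronglyMeasurable_pairing {η : Measure (Ω × X)} (hη : η.fst = μ) {F : Ω → C(X, ℝ)}
    (hF : AEStronglyMeasurable F μ) : AEStronglyMeasurable (fun p : Ω × X => F p.1 p.2) η := by
  have hmp : MeasurePreserving Prod.fst η μ := ⟨measurable_fst, hη⟩
  have h1 : AEStronglyMeasurable (fun p : Ω × X => F p.1) η :=
    hF.comp_measurePreserving hmp
  let := metrizableSpaceMetric X
  have h2 : AEStronglyMeasurable (fun p : Ω × X => p.2) η :=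
    measurable_snd.aestronglyMeasurable
  have hc : Continuous fun q : C(X, ℝ) × X => q.1 q.2 := continuous_eval
  exact hc.comp_aestronglyMeasurable (h1.prodMk h2)

theorem integrable_pairing {η : Measure (Ω × X)} (hη : η.fst = μ) {F : Ω → C(X, ℝ)}
    (hF : Integrable F μ) : Integrable (fun p : Ω × X => F p.1 p.2) η := by
  have hmp : MeasurePreserving Prod.fst η μ := ⟨measurable_fst, hη⟩
  have h1 : Integrable (fun p : Ω × X => ‖F p.1‖) η :=
    hmp.integrable_comp_of_integrable hF.norm
  exact h1.mono' (aestronglyMeasurable_pairing hη hF.1)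
    (Filter.Eventually.of_forall fun p => (F p.1).norm_coe_le_norm _)

theorem abs_integral_pairing_le {η : Measure (Ω × X)} (hη : η.fst = μ) {F : Ω → C(X, ℝ)}
    (hF : Integrable F μ) : |∫ p, F p.1 p.2 ∂η| ≤ ∫ s, ‖F s‖ ∂μ := by
  have hmp : MeasurePreserving Prod.fst η μ := ⟨measurable_fst, hη⟩
  have h1 : Integrable (fun p : Ω × X => ‖F p.1‖) η :=
    hmp.integrable_comp_of_integrable hF.norm
  have h2 : ∫ s, ‖F s‖ ∂μ = ∫ p, ‖F p.1‖ ∂η := by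
    have h3 : AEStronglyMeasurable (fun s => ‖F s‖) (η.map Prod.fst) := by
      rw [hmp.map_eq]; exact hF.1.norm
    rw [← hmp.map_eq, integral_map measurable_fst.aemeasurable h3]
  rw [h2]
  exact (abs_integral_le_integral_abs).trans (integral_mono (integrable_pairing hη hF).abs h1
    fun p => (F p.1).norm_coe_le_norm _)

/-- The field `F` is extended along `e` to the Cantor space, where continuous functions are dense in
`L¹` of the image measure. -/
theorem exists_dense_family (he : MeasurableEmbedding e) {F : Ω → C(X, ℝ)} (hF : Integrable F μ)
    {ε : ℝ} (hε : 0 < ε) :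
    ∃ f : C((ℕ → Bool) × X, ℝ), ∫ s, ‖F s - f.curry (e s)‖ ∂μ ≤ ε := by
  let : MeasurableSpace C(X, ℝ) := borel _
  have : BorelSpace C(X, ℝ) := ⟨rfl⟩
  obtain ⟨F', hF', hFF'⟩ := hF.1
  let G : (ℕ → Bool) → C(X, ℝ) := Function.extend e F' 0
  have hGe : ∀ s, G (e s) = F' s := fun s => he.injective.extend_apply _ _ _
  have hG : StronglyMeasurable G :=
    (he.measurable_extend hF'.measurable measurable_const).stronglyMeasurable
  have hGint : Integrable G (μ.map e) := by
    rw [he.integrable_map_iff]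
    refine hF.congr ?_
    filter_upwards [hFF'] with s hs
    rw [hs]; exact (hGe s).symm
  obtain ⟨g, hg, hgi⟩ := hGint.exists_boundedContinuous_integral_sub_le hε
  refine ⟨ContinuousMap.uncurry g.toContinuousMap, ?_⟩
  rw [he.integral_map] at hg
  refine le_trans (le_of_eq (integral_congr_ae ?_)) hg
  filter_upwards [hFF'] with s hs
  rw [hs, hGe]
  rfl

/-- Riesz representation is available on the compact model `(ℕ → Bool) × X`. The measure found there
has first marginal `μ.map e`, so it is carried by the image of `Ω × X` and can be pulled back.
Density extends the formula from continuous functions to all integrable fields. -/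
theorem exists_measure_of_state (he : MeasurableEmbedding e)
    {ξ : WeakDual ℝ (Lp C(X, ℝ) 1 μ)} (hξ : ξ ∈ states μ X) :
    ∃ η : Measure (Ω × X), η.fst = μ ∧
      ∀ (F : Ω → C(X, ℝ)) (hF : Integrable F μ), ξ (hF.toL1 F) = ∫ p, F p.1 p.2 ∂η := by
  obtain ⟨ρ, hρ, hint⟩ := exists_measure_of_positive (stateFunctional he.measurable ξ)
    (stateFunctional_nonneg he.measurable hξ) (by exact hξ.2)
  have hfst : ρ.fst = μ.map e := by
    have : IsProbabilityMeasure (μ.map e) :=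
      Measure.isProbabilityMeasure_map he.measurable.aemeasurable
    refine ext_of_forall_integral_eq_of_IsFiniteMeasure fun k => ?_
    rw [he.integral_map, Measure.fst, integral_map measurable_fst.aemeasurable
      k.continuous.aestronglyMeasurable]
    exact (hint (k.toContinuousMap.comp ContinuousMap.fst)).trans
      (integral_fst_eq he.measurable hξ k.toContinuousMap)
  let j : Ω × X → (ℕ → Bool) × X := Prod.map e id
  have hj : MeasurableEmbedding j := he.prodMap MeasurableEmbedding.id
  have hmap : (ρ.comap j).map j = ρ := by
    rw [hj.map_comap, Measure.restrict_eq_self_of_ae_mem]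
    have h1 : ∀ᵐ z ∂ρ.fst, z ∈ range e := by
      rw [hfst]
      exact (he.ae_map_iff).2 (Filter.Eventually.of_forall fun s => mem_range_self s)
    have h2 := ae_of_ae_map measurable_fst.aemeasurable h1
    filter_upwards [h2] with z hz
    obtain ⟨s, hs⟩ := hz
    exact ⟨(s, z.2), Prod.ext hs rfl⟩
  have hηfst : (ρ.comap j).fst = μ := by
    have h1 : (ρ.comap j).fst.map e = μ.map e := by
      rw [← hfst, Measure.fst, Measure.fst, Measure.map_map he.measurable measurable_fst,
        ← hmap, Measure.map_map measurable_fst hj.measurable, hmap]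
      rfl
    rw [← he.comap_map (ρ.comap j).fst, h1, he.comap_map]
  refine ⟨ρ.comap j, hηfst, fun F hF => ?_⟩
  have hcont : ∀ f : C((ℕ → Bool) × X, ℝ),
      ξ ((integrable_comp_continuous he.measurable f.curry).toL1 fun s => f.curry (e s)) =
        ∫ p, f.curry (e p.1) p.2 ∂(ρ.comap j) := by
    intro f
    rw [← stateFunctional_apply he.measurable, ← hint f]
    conv_lhs => rw [← hmap]
    rw [hj.integral_map]
    rfl
  refine eq_of_forall_dist_le fun ε hε => ?_
  obtain ⟨f, hf⟩ := exists_dense_family he hF (half_pos hε)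
  have hfi := integrable_comp_continuous (μ := μ) he.measurable f.curry
  have h1 := abs_state_le hξ (hF.sub hfi)
  have h2 := abs_integral_pairing_le hηfst (hF.sub hfi)
  rw [Integrable.toL1_sub _ _ hF hfi, map_sub, hcont] at h1
  simp only [Pi.sub_apply, ContinuousMap.sub_apply] at h1 h2
  rw [integral_sub (integrable_pairing hηfst hF) (integrable_pairing hηfst hfi)] at h2
  rw [Real.dist_eq]
  have h3 := abs_sub_le (ξ (hF.toL1 F)) (∫ p, f.curry (e p.1) p.2 ∂(ρ.comap j))
    (∫ p, F p.1 p.2 ∂(ρ.comap j))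
  rw [abs_sub_comm (∫ p, f.curry (e p.1) p.2 ∂(ρ.comap j))] at h3
  linarith

end Representation
end Dendro

namespace Dendro

/-! ### Equivariant families of probability measures over a boundary -/

section EquivariantMeasures

open Set ProbabilityTheory

attribute [local instance] borelCL borelHomeo topHomeo

variable {Γ Ω B X : Type u} [Group Γ] [Countable Γ]
  [MeasurableSpace Ω] [StandardBorelSpace Ω] [MulAction Γ Ω] [MeasurableConstSMul Γ Ω]
  {μ : Measure Ω} [IsProbabilityMeasure μ] [ErgodicSMul Γ Ω μ]
  [MeasurableSpace B] [StandardBorelSpace B] [MulAction Γ B] [MeasurableConstSMul Γ B]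
  {ν : Measure B} [SigmaFinite ν] [NeZero ν]
  [TopologicalSpace X] [CompactSpace X] [T2Space X] [SecondCountableTopology X]
  [PointSeparated X] [ConnectedSpace X] {σ : Γ → Ω → (X ≃ₜ X)}
  [MeasurableSpace X] [BorelSpace X]

/-- The action of a virtual dendro-morphism on the dendrite. -/
def actPoint (hσ : IsVirtualDendroMorphism μ σ) : FiberAction Γ Ω μ X where
  act γ s x := σ γ s x
  measurable_act γ := measurable_homeo_apply ((hσ.measurable γ).comp measurable_fst) measurable_snd
  act_one := by
    filter_upwards [hσ.ae_one] with s hs x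
    rw [hs]; rfl
  act_mul γ₁ γ₂ := by
    filter_upwards [hσ.cocycle γ₁ γ₂] with s hs x
    rw [hs]; rfl

theorem measure_ext_of_pairing {e : Ω → (ℕ → Bool)} (he : MeasurableEmbedding e)
    {η η' : Measure (Ω × X)} [IsFiniteMeasure η] [IsFiniteMeasure η']
    (h : ∀ f : C((ℕ → Bool) × X, ℝ), ∫ p, f (e p.1, p.2) ∂η = ∫ p, f (e p.1, p.2) ∂η') :
    η = η' := by
  have hj : MeasurableEmbedding (Prod.map e id : Ω × X → (ℕ → Bool) × X) :=
    he.prodMap MeasurableEmbedding.id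
  have : η.map (Prod.map e id) = η'.map (Prod.map e id) := by
    refine ext_of_forall_integral_eq_of_IsFiniteMeasure fun k => ?_
    rw [hj.integral_map, hj.integral_map]
    exact h k.toContinuousMap
  rw [← hj.comap_map η, this, hj.comap_map]

theorem measurable_measure_of_pairing {e : Ω → (ℕ → Bool)} (he : MeasurableEmbedding e)
    {η : B → Measure (Ω × X)} [∀ b, IsProbabilityMeasure (η b)]
    (h : ∀ f : C((ℕ → Bool) × X, ℝ), Measurable fun b => ∫ p, f (e p.1, p.2) ∂(η b)) :
    Measurable η := by
  have hj : MeasurableEmbedding (Prod.map e id : Ω × X → (ℕ → Bool) × X) :=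
    he.prodMap MeasurableEmbedding.id
  have hprob : ∀ b, IsProbabilityMeasure ((η b).map (Prod.map e id)) := fun b =>
    Measure.isProbabilityMeasure_map hj.measurable.aemeasurable
  have := metrizableSpaceMetric X
  have hm : Measurable fun b => (η b).map (Prod.map e id) := by
    refine measurable_lintegral_measure_of_closed fun k => ?_
    let f : C((ℕ → Bool) × X, ℝ) := ⟨fun z => k z, by fun_prop⟩
    have hk : ∀ b, ∫⁻ z, k z ∂((η b).map (Prod.map e id)) =
        ENNReal.ofReal (∫ p, f (e p.1, p.2) ∂(η b)) := fun b => by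
      rw [hj.lintegral_map, ofReal_integral_eq_lintegral_ofReal]
      · refine lintegral_congr fun p => ?_
        simp only [f, ContinuousMap.coe_mk, ENNReal.ofReal_coe_nnreal]
        rfl
      · refine (integrable_const ‖f‖).mono' ?_
          (Filter.Eventually.of_forall fun p => f.norm_coe_le_norm _)
        exact (f.continuous.measurable.comp hj.measurable).aestronglyMeasurable
      · exact Filter.Eventually.of_forall fun p => NNReal.coe_nonneg _
    simp only [hk]
    exact (h f).ennreal_ofReal
  refine Measure.measurable_of_measurable_coe _ fun A hA => ?_
  have hA' : ∀ b, η b A = (η b).map (Prod.map e id) (Prod.map e id '' A) := fun b => by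
    rw [hj.map_apply, preimage_image_eq _ hj.injective]
  simp only [hA']
  exact (Measure.measurable_coe (hj.measurableSet_image.2 hA)).comp hm

/-- Invariance of the state under transport, tested on the continuous functions of the compact
model, says that `γ⁻¹` carries the measure at `γ • b` to the measure at `b`. -/
theorem exists_equivariant_joinings (hB : IsBoundary Γ ν) (hσ : IsVirtualDendroMorphism μ σ) :
    ∃ η : B → Measure (Ω × X), Measurable η ∧ (∀ b, (η b).fst = μ) ∧
      ∀ γ : Γ, ∀ᵐ b ∂ν, η (γ • b) = (η b).map fun p => (γ • p.1, σ γ p.1 p.2) := by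
  obtain ⟨ξ, hξm, hξs, hξe⟩ := exists_equivariant_states (ν := ν) hB hσ
  obtain ⟨e, he⟩ := exists_measurableEmbedding_cantor Ω
  choose η hη hint using fun b => exists_measure_of_state he (hξs b)
  have hprob : ∀ b, IsProbabilityMeasure (η b) := fun b =>
    ⟨by rw [← Measure.fst_univ, hη b, measure_univ]⟩
  let r : B → (actPoint hσ).MargProb := fun b => FiberAction.MargProb.mk _ (η b) (hη b)
  refine ⟨η, measurable_measure_of_pairing he fun f => ?_, hη, fun γ => ?_⟩
  · have := hξm ((integrable_comp_continuous (μ := μ) he.measurable f.curry).toL1 _)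
    simp only [hint] at this
    exact this
  · filter_upwards [hξe γ] with b hb
    have h1 : γ⁻¹ • r (γ • b) = r b := by
      apply FiberAction.MargProb.ext
      refine measure_ext_of_pairing he fun f => ?_
      have hfi := integrable_comp_continuous (μ := μ) he.measurable f.curry
      have hti : Integrable (transport σ γ fun s => f.curry (e s)) μ :=
        memLp_one_iff_integrable.1 (memLp_transport hσ γ (memLp_one_iff_integrable.2 hfi))
      have h2 : ξ (γ • b) (hti.toL1 _) = ξ b (hfi.toL1 _) := by
        rw [← hb]
        exact congrArg (ξ (γ • b)) (transportLp_toLp hσ γ (memLp_one_iff_integrable.2 hfi)).symm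
      rw [hint, hint] at h2
      refine Eq.trans ?_ h2
      rw [FiberAction.MargProb.toMeasure_smul]
      have hsk := (actPoint hσ).measurable_skew γ⁻¹
      have hfe : Measurable fun p : Ω × X => f (e p.1, p.2) :=
        f.continuous.measurable.comp ((he.measurable.comp measurable_fst).prodMk measurable_snd)
      rw [integral_map hsk.aemeasurable hfe.aestronglyMeasurable]
      rfl
    have h3 : r (γ • b) = γ • r b := by rw [← h1, smul_inv_smul]
    exact congrArg FiberAction.MargProb.toMeasure h3

theorem measurable_map_family {Y : Type*} [MeasurableSpace Y] {m : Y → Measure X}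
    (hm : Measurable m) [∀ y, IsProbabilityMeasure (m y)] {g : Y → X → X}
    (hg : Measurable fun p : Y × X => g p.1 p.2) : Measurable fun y => (m y).map (g y) := by
  let κ : Kernel Y X := ⟨m, hm⟩
  have : IsMarkovKernel κ := ⟨inferInstance⟩
  refine Measure.measurable_of_measurable_coe _ fun A hA => ?_
  have h : ∀ y, (m y).map (g y) A = κ y (Prod.mk y ⁻¹' ((fun p : Y × X => g p.1 p.2) ⁻¹' A)) :=
    fun y => Measure.map_apply (hg.comp measurable_prodMk_left) hA
  simp only [h]
  exact Kernel.measurable_kernel_prodMk_left (hg hA)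

/-- The joinings are disintegrated over `μ`, jointly measurably in `b`. Equivariance of the joinings
passes to the conditional measures because disintegrations are essentially unique. -/
theorem exists_equivariant_measures (hB : IsBoundary Γ ν) (hσ : IsVirtualDendroMorphism μ σ) :
    ∃ m : B × Ω → Measure X, Measurable m ∧ (∀ w, IsProbabilityMeasure (m w)) ∧
      ∀ γ : Γ, ∀ᵐ w ∂(ν.prod μ), m (γ • w) = (m w).map (σ γ w.2) := by
  have := polishSpace_of_compact X
  obtain ⟨η, hηm, hη, hηe⟩ := exists_equivariant_joinings hB hσ
  have hprob : ∀ b, IsProbabilityMeasure (η b) := fun b =>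
    ⟨by rw [← Measure.fst_univ, hη b, measure_univ]⟩
  let κ : Kernel B (Ω × X) := ⟨η, hηm⟩
  have hκ : IsMarkovKernel κ := ⟨hprob⟩
  let c : Kernel (B × Ω) X := κ.condKernel
  have hdis : ∀ b, η b = μ ⊗ₘ c.sectR b := fun b => by
    have h1 : κ.fst b = μ := by rw [Kernel.fst_apply]; exact hη b
    have h2 : (κ.fst ⊗ₖ c) b = κ b := by rw [κ.disintegrate]
    rw [Kernel.compProd_apply_eq_compProd_sectR, h1] at h2
    exact h2.symm
  have hg : ∀ γ : Γ, Measurable fun p : Ω × X => σ γ p.1 p.2 := fun γ =>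
    (actPoint hσ).measurable_act γ
  have hmap : ∀ γ : Γ, Measurable fun w : B × Ω => (c w).map (σ γ w.2) := fun γ =>
    measurable_map_family (g := fun w : B × Ω => σ γ w.2) c.measurable
      ((hg γ).comp (by fun_prop : Measurable fun p : (B × Ω) × X => (p.1.2, p.2)))
  refine ⟨fun w => c w, c.measurable, inferInstance, fun γ => ?_⟩
  -- Needed to deduce the statement on the product from iterated null sets. The equality locus is
  -- measurable because the probability measures on `X` form a standard Borel space.
  have hms : MeasurableSet {w : B × Ω | c (γ • w) = (c w).map (σ γ w.2)} := by
    have hp : ∀ w : B × Ω, IsProbabilityMeasure ((c w).map (σ γ w.2)) := fun w =>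
      Measure.isProbabilityMeasure_map (σ γ w.2).continuous.measurable.aemeasurable
    let f₁ : B × Ω → ProbabilityMeasure X := fun w => ⟨c (γ • w), inferInstance⟩
    let f₂ : B × Ω → ProbabilityMeasure X := fun w => ⟨(c w).map (σ γ w.2), hp w⟩
    have h1 : Measurable f₁ := Measurable.subtype_mk (c.measurable.comp
      (((measurable_const_smul γ).comp measurable_fst).prodMk
        ((measurable_const_smul γ).comp measurable_snd)))
    have h2 : Measurable f₂ := Measurable.subtype_mk (hmap γ)
    convert! measurableSet_eq_fun h1 h2 using 1
    ext w
    exact (Subtype.ext_iff (a1 := f₁ w) (a2 := f₂ w)).symm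
  refine (Measure.ae_prod_mem_iff_ae_ae_mem hms).2 ?_
  filter_upwards [hηe γ] with b hb
  let κ₁ : Kernel Ω X := ⟨fun s => (c (b, s)).map (σ γ s), (hmap γ).comp measurable_prodMk_left⟩
  let κ₂ : Kernel Ω X := (c.sectR (γ • b)).comap (γ • ·) (measurable_const_smul γ)
  have hκ₁ : IsMarkovKernel κ₁ := ⟨fun s =>
    Measure.isProbabilityMeasure_map (σ γ s).continuous.measurable.aemeasurable⟩
  -- Both sides are the joining at `γ • b` with its first coordinate moved back by `γ⁻¹`, whence the
  -- set `A'`.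
  have heq : μ ⊗ₘ κ₂ = μ ⊗ₘ κ₁ := by
    ext A hA
    let A' : Set (Ω × X) := {p | (γ⁻¹ • p.1, p.2) ∈ A}
    have hA' : MeasurableSet A' :=
      (((measurable_const_smul γ⁻¹).comp measurable_fst).prodMk measurable_snd) hA
    have hsk : Measurable fun p : Ω × X => (γ • p.1, σ γ p.1 p.2) :=
      (actPoint hσ).measurable_skew γ
    have h1 : (μ ⊗ₘ κ₂) A = η (γ • b) A' := by
      rw [hdis, Measure.compProd_apply hA, Measure.compProd_apply hA',
        ← (measurePreserving_smul γ μ).lintegral_comp (Kernel.measurable_kernel_prodMk_left hA')]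
      refine lintegral_congr fun s => ?_
      change c (γ • b, γ • s) _ = c (γ • b, γ • s) _
      congr 1
      ext x
      simp [A']
    have h2 : (μ ⊗ₘ κ₁) A = η (γ • b) A' := by
      rw [hb, Measure.map_apply hsk hA', hdis b, Measure.compProd_apply hA,
        Measure.compProd_apply (hsk hA')]
      refine lintegral_congr fun s => ?_
      change (c (b, s)).map (σ γ s) _ = c (b, s) _
      rw [Measure.map_apply (σ γ s).continuous.measurable (measurable_prodMk_left hA)]
      congr 1
      ext x
      simp [A']
    rw [h1, h2]
  filter_upwards [Kernel.ae_eq_of_compProd_eq heq] with s hs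
  exact hs

end EquivariantMeasures
end Dendro

/-! ### The main theorem -/

theorem mainTheorem4 {Γ Ω B X : Type u} [Group Γ] [Countable Γ]
    [MeasurableSpace Ω] [StandardBorelSpace Ω] [MulAction Γ Ω] [MeasurableConstSMul Γ Ω]
    (μ : Measure Ω) [IsProbabilityMeasure μ] [ErgodicSMul Γ Ω μ]
    [MeasurableSpace B] [StandardBorelSpace B] [MulAction Γ B] [MeasurableConstSMul Γ B]
    (ν : Measure B) [SigmaFinite ν] [NeZero ν] (hB : Dendro.IsBoundary Γ ν)
    [TopologicalSpace X] [MeasurableSpace X] [BorelSpace X] (hX : Dendro.IsDendrite X)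
    (σ : Γ → Ω → (X ≃ₜ X)) (hσ : Dendro.IsVirtualDendroMorphism μ σ)
    (hne : ¬ Dendro.IsElementary μ σ) :
    (∃ M : Ω → NonemptyCompacts X, Dendro.IsMinimalFamily μ σ M ∧
      ∀ N : Ω → NonemptyCompacts X, Dendro.IsMinimalFamily μ σ N → N =ᵐ[μ] M) ∧
    ∃ φ : B × Ω → X, Dendro.IsFurstenbergMap ν μ σ φ ∧
      (∀ M : Ω → NonemptyCompacts X, Dendro.IsMinimalFamily μ σ M →
        ∀ᵐ s ∂μ, ∀ b : B, φ (b, s) ∈ Dendro.ends (M s : Set X)) ∧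
      ∀ ψ : B × Ω → X, Dendro.IsFurstenbergMap ν μ σ ψ → ψ =ᵐ[ν.prod μ] φ := by
  have := hX.connected
  have := hX.compact
  have := hX.metrizable
  have : SecondCountableTopology X := by
    let := metrizableSpaceMetric X
    infer_instance
  have : Dendro.PointSeparated X := ⟨hX.separated⟩
  obtain ⟨M, hM⟩ := Dendro.exists_minimalFamily hne
  obtain ⟨m, hm, hprob, heq⟩ := Dendro.exists_equivariant_measures hB hσ
  obtain ⟨φ₀, hφ₀⟩ := Dendro.exists_furstenbergMap_of_measure hB hσ hne hM hm hprob heq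
  obtain ⟨φ, hφ, hends⟩ := hφ₀.exists_slices_ends hB hσ hne hM
  refine ⟨⟨M, hM, fun N hN => hM.ae_eq hN⟩, φ, hφ, fun N hN => ?_, fun ψ hψ =>
    hφ.ae_eq hB hσ hne hM hψ⟩
  -- Minimal families agree almost everywhere, so what holds for `M` holds for `N`.
  filter_upwards [hends, hM.ae_eq hN] with s h1 h2
  rw [h2]
  exact h1
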